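/- Let $\varepsilon>0$ and let $c_0,c_1,c_2$ be real constants. Consider the unit-cost word RAM with $w$-bit words, where $\log_2 n\le w\le c_2\log_2 n$; its memory consists of words addressed by words, every arithmetic operation ($+,-,\cdot$, integer division, bitwise operations, shifts), comparison, memory access and output of a word takes one step, and a data structure that occupies $S$ memory words uses $S\cdot w$ bits (this includes the working space of its operations, apart from a constant number of registers). Positions in a bit vector $B$ of length $n$ are $0,\dots,n-1$. There are programs for the operations $\mathrm{zero}$ and $\mathrm{report}$ and constants $C>0$ and $n_0$, all depending only on $\varepsilon,c_0,c_1,c_2$, such that the following holds for all $n\ge n_0$, all such $w$ and all real $\tau$ with $2\le\tau\le c_1\log_2 n/\log_2\log_2 n$. Every bit vector $B$ of length $n$ with at most $c_0n/\tau$ zeros can be stored in a data structure of at most $C\,n\log_2\tau/\tau$ bits that supports, in the worst case, (i) $\mathrm{zero}(i)$, which sets $B[i]=0$, in at most $C(\log_2 n)^{\varepsilon}$ steps (for any sequence of such operations throughout which $B$ has at most $c_0n/\tau$ zeros), and (ii) $\mathrm{report}(s,e)$, which outputs all $j$ with $s\le j\le e$ and $B[j]=1$, each exactly once, in at most $C(k+1)$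 steps, where $k$ is the number of these positions. -/

import Mathlib

namespace WordRAM

/-! A unit-cost word RAM with `w`-bit words. A program is a finite imperative program over
finitely many word registers and a memory of `S` words with indirect addressing. -/

/-- The arithmetic and bitwise instructions. -/
inductive BinOp
  | add | sub | mul | div | and | or | xor | shl | shr

/-- Arithmetic is unsigned and modulo `2 ^ w`; shifts by `w` or more give `0`, and so does
division by `0`. -/
def BinOp.eval {w : ℕ} : BinOp → BitVec w → BitVec w → BitVec w
  | .add, x, y => x + y
  | .sub, x, y => x - y
  | .mul, x, y => x * y
  | .div, x, y => x.udiv y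
  | .and, x, y => x &&& y
  | .or, x, y => x ||| y
  | .xor, x, y => x ^^^ y
  | .shl, x, y => x <<< y.toNat
  | .shr, x, y => x >>> y.toNat

/-- Tests comparing the contents of two registers (as unsigned numbers). -/
inductive Test
  | eq (a b : ℕ)
  | lt (a b : ℕ)

def Test.Holds {w : ℕ} (reg : ℕ → BitVec w) : Test → Prop
  | .eq a b => reg a = reg b
  | .lt a b => (reg a).toNat < (reg b).toNat

/-- Programs. Natural number arguments are register names, except the literal `k` in `const`. -/
inductive Cmd
  | skip
  /-- `reg d := k mod 2 ^ w` -/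
  | const (d k : ℕ)
  /-- `reg d := o (reg a) (reg b)` -/
  | op (o : BinOp) (d a b : ℕ)
  /-- `reg d := mem[reg a]` -/
  | load (d a : ℕ)
  /-- `mem[reg a] := reg s` -/
  | store (a s : ℕ)
  /-- append `reg a` to the output -/
  | emit (a : ℕ)
  | seq (p q : Cmd)
  | ite (t : Test) (p q : Cmd)
  | loop (t : Test) (p : Cmd)

/-- A machine configuration: registers, a memory of `S` words of `w` bits, and a write-only
output sequence. -/
structure State (w S : ℕ) where
  reg : ℕ → BitVec w
  mem : Fin S → BitVec w
  out : List (BitVec w)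

/-- Start of an operation: the memory is what the previous operation left, the arguments are in
registers `0, 1, …`, all other registers are `0` and the output is empty. -/
def State.start {w S : ℕ} (M : Fin S → BitVec w) (args : List (BitVec w)) : State w S where
  reg := fun r => args.getD r 0
  mem := M
  out := []

/-- `Exec p σ σ' t`: started in `σ`, the program `p` halts in `σ'` after `t` steps. Every
instruction and every evaluation of a test takes one step. A memory access at an address `≥ S`
has no successor configuration, so a program that makes one does not halt. -/
inductive Exec {w S : ℕ} : Cmd → State w S → State w S → ℕ → Prop
  | skip (σ) : Exec .skip σ σ 1
  | const (σ) (d k : ℕ) :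
      Exec (.const d k) σ { σ with reg := Function.update σ.reg d (BitVec.ofNat w k) } 1
  | op (σ) (o : BinOp) (d a b : ℕ) :
      Exec (.op o d a b) σ
        { σ with reg := Function.update σ.reg d (o.eval (σ.reg a) (σ.reg b)) } 1
  | load (σ) (d a : ℕ) (h : (σ.reg a).toNat < S) :
      Exec (.load d a) σ
        { σ with reg := Function.update σ.reg d (σ.mem ⟨(σ.reg a).toNat, h⟩) } 1
  | store (σ) (a s : ℕ) (h : (σ.reg a).toNat < S) :
      Exec (.store a s) σ
        { σ with mem := Function.update σ.mem ⟨(σ.reg a).toNat, h⟩ (σ.reg s) } 1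
  | emit (σ) (a : ℕ) : Exec (.emit a) σ { σ with out := σ.out ++ [σ.reg a] } 1
  | seq {p q : Cmd} {σ₁ σ₂ σ₃} {t₁ t₂ : ℕ} :
      Exec p σ₁ σ₂ t₁ → Exec q σ₂ σ₃ t₂ → Exec (.seq p q) σ₁ σ₃ (t₁ + t₂)
  | ite_true {c : Test} {p q : Cmd} {σ σ'} {t : ℕ} :
      c.Holds σ.reg → Exec p σ σ' t → Exec (.ite c p q) σ σ' (t + 1)
  | ite_false {c : Test} {p q : Cmd} {σ σ'} {t : ℕ} :
      ¬ c.Holds σ.reg → Exec q σ σ' t → Exec (.ite c p q) σ σ' (t + 1)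
  | loop_true {c : Test} {p : Cmd} {σ₁ σ₂ σ₃} {t₁ t₂ : ℕ} :
      c.Holds σ₁.reg → Exec p σ₁ σ₂ t₁ → Exec (.loop c p) σ₂ σ₃ t₂ →
        Exec (.loop c p) σ₁ σ₃ (t₁ + t₂ + 1)
  | loop_false {c : Test} {p : Cmd} {σ} :
      ¬ c.Holds σ.reg → Exec (.loop c p) σ σ 1

end WordRAM

namespace BitVector

/-- The number of zeros of a bit vector of length `n` (with positions `0, …, n - 1`). -/
def zeros {n : ℕ} (B : Fin n → Bool) : ℕ :=
  (Finset.univ.filter fun i => B i = false).card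

/-- The positions `j` with `s ≤ j ≤ e` and `B j = 1`. -/
def onesIn {n : ℕ} (B : Fin n → Bool) (s e : Fin n) : Finset (Fin n) :=
  Finset.univ.filter fun j => s ≤ j ∧ j ≤ e ∧ B j = true

open WordRAM in
/-- The programs `zeroP` and `reportP` operate, within a memory of `S` words of `w` bits, a data
structure for bit vectors of length `n` with at most `m` zeros. `R B M` says that the memory
contents `M` is a valid state of the data structure when it stores `B`. Every such bit vector can
be stored. From any valid state, `zero i` leads to a valid state for `B` with position `i` set to
zero, in at most `tz` steps, provided that the new bit vector still has at most `m` zeros; and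
`report s e` outputs every position in `onesIn B s e` exactly once, in some order, in at most
`tr * (k + 1)` steps where `k` is the number of these positions, and leads to a valid state for
`B`. -/
def IsZeroReportStructure (zeroP reportP : Cmd) (n w S : ℕ) (m tz tr : ℝ) : Prop :=
  ∃ R : (Fin n → Bool) → (Fin S → BitVec w) → Prop,
    (∀ B, (zeros B : ℝ) ≤ m → ∃ M, R B M) ∧
    (∀ B M, R B M → ∀ i : Fin n, (zeros (Function.update B i false) : ℝ) ≤ m →
      ∃ (σ : State w S) (t : ℕ),
        Exec zeroP (State.start M [BitVec.ofNat w i]) σ t ∧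
        (t : ℝ) ≤ tz ∧
        R (Function.update B i false) σ.mem) ∧
    (∀ B M, R B M → ∀ s e : Fin n,
      ∃ (σ : State w S) (t : ℕ),
        Exec reportP (State.start M [BitVec.ofNat w s, BitVec.ofNat w e]) σ t ∧
        (t : ℝ) ≤ tr * (((onesIn B s e).card : ℝ) + 1) ∧
        σ.out.Nodup ∧
        (∀ x : BitVec w, x ∈ σ.out ↔ ∃ j ∈ onesIn B s e, x.toNat = j) ∧
        R B σ.mem)

end BitVector

/-! ### Arithmetic expressions, and a Hoare logic over natural-number states -/

/-! Let `2 ^ t` be `τ` rounded down to a power of two and let `q` be about `log n / 10`, so that a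
code below `Q = 2 ^ q` fits in a word and a table with five such codes as index has only `Q ^ 5`
entries, at most the square root of `n`. The bit vector is cut into chunks of `r` blocks of `q - 2`
bits, where `r` is about `2 ^ t / t`. There are O(n t / (2 ^ t q)) chunks, so O(1) words per chunk
are affordable: the word size is O(q), and the space becomes O(n log τ / τ) bits.

Zeros are stored, since ones may be dense. A chunk has a header of `q` bits which tells, for each
block, which cell holds its zeros and whether it contains a one. A cell is a word code that lists up
to `2 * Z` zeros of the blocks of a chunk, with `Z` of order `q / t`; since about `t + 4` bits per
zero suffice (`card_powerset_filter_le`), such a cell has fewer than `Q` values. A block with more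
than `Z` zeros has a cell of its own, as a plain bitmap. Each block reserves a capacity, its number
of zeros rounded up to a power of two, and moves to another cell only when the capacity grows; its
old entry becomes garbage. As capacities at least double, garbage is charged to the current
capacity, and a chunk uses at most 2 + 4z/Z cells for z zeros (`Inv.set`, `nb_mul_le`). For cell
numbers to be short enough for the header, `K = 2 ^ (t + 10)` consecutive chunks form a group with
its own numbering, below `K * K`, translated into addresses by a page table (`GInv.set`, `cnt_le`,
`np_le`). All operations on headers and cells are single table lookups, so the ones of a chunk are
enumerated in constant time each (`nextP_spec`, `scanP_spec`).

Chunks with a one are linked in a list. To report an interval, the two end chunks are scanned;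
between them it suffices to find a single chunk with a one and to walk the list in both directions,
because every chunk visited produces output. If there is such a chunk, then it is below one of the
two children of the lowest common ancestor of the boundary chunks in a binary trie, and the first
element below the right child or the last below the left child lies in the interval
(`searchP_spec`).

The trie would be costly to maintain with exact pointers to first elements, because a deletion can
change them at all O(log n) ancestors. Instead the pointer at height `j` need only agree with the
first element down to height `down j`, which is `j` with its lowest nonzero digit in base `b`
cleared. With `b` about `(log n) ^ ε` and `k` about `1 / ε` digits, a query follows at most `k`
pointers (`lev_lt_lev_down`, `TrieOK.step`). A deletion rewrites pointers only at heights `c`, `up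
c`, `up (up c)`, …, of which there are O(b k): between two of these heights the obsolete pointer
still agrees with the new first element as far as required (`le_down`, `pot_up_lt`, `PartOK.step`).

Correctness of the programs is shown in a Hoare logic with time bounds on states of natural numbers,
with overflow excluded in the evaluation of expressions. A data structure for an arbitrary bit
vector exists because it is reached from the all-ones vector by setting zeros one by one
(`exists_valid`). -/

namespace WordRAM

/-- Arithmetic expressions over the registers and the memory. -/
inductive Ex
  | v (r : ℕ)
  | k (c : ℕ)
  | bin (o : BinOp) (a b : Ex)
  | ld (a : Ex)

namespace Ex

instance : Add Ex := ⟨bin .add⟩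
instance : Sub Ex := ⟨bin .sub⟩
instance : Mul Ex := ⟨bin .mul⟩
instance : Div Ex := ⟨bin .div⟩

/-- Code that leaves the value of the expression in register `d`, using registers `≥ d` only. -/
def code : Ex → ℕ → Cmd
  -- There is no move instruction; the bitwise or of a register with itself copies it.
  | v r, d => .op .or d r r
  | k c, d => .const d c
  | bin o a b, d => .seq (a.code d) (.seq (b.code (d + 1)) (.op o d d (d + 1)))
  | ld a, d => .seq (a.code d) (.load d d)

def cost : Ex → ℕ
  | v _ => 1
  | k _ => 1
  | bin _ a b => a.cost + (b.cost + 1)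
  | ld a => a.cost + 1

end Ex

/-- A configuration with natural numbers in place of words. -/
structure NState where
  reg : ℕ → ℕ
  mem : ℕ → ℕ
  out : List ℕ

/-- `Ev w S s e x`: in `s`, the expression `e` has value `x`, without any overflow. -/
inductive Ev (w S : ℕ) (s : NState) : Ex → ℕ → Prop
  | v {r : ℕ} (h : r < 32) : Ev w S s (.v r) (s.reg r)
  | k {c : ℕ} (h : c < 2 ^ w) : Ev w S s (.k c) c
  | add {a b : Ex} {x y : ℕ} : Ev w S s a x → Ev w S s b y → x + y < 2 ^ w →
      Ev w S s (a + b) (x + y)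
  | sub {a b : Ex} {x y : ℕ} : Ev w S s a x → Ev w S s b y → y ≤ x → Ev w S s (a - b) (x - y)
  | mul {a b : Ex} {x y : ℕ} : Ev w S s a x → Ev w S s b y → x * y < 2 ^ w →
      Ev w S s (a * b) (x * y)
  | div {a b : Ex} {x y : ℕ} : Ev w S s a x → Ev w S s b y → Ev w S s (a / b) (x / y)
  | xor {a b : Ex} {x y : ℕ} : Ev w S s a x → Ev w S s b y → Ev w S s (.bin .xor a b) (x ^^^ y)
  | shr {a b : Ex} {x y : ℕ} : Ev w S s a x → Ev w S s b y → Ev w S s (.bin .shr a b) (x >>> y)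
  | ld {a : Ex} {x : ℕ} : Ev w S s a x → x < S → Ev w S s (.ld a) (s.mem x)

/-- The words of `σ` represent the numbers of `s`; registers from `32` on are scratch space. -/
def Rel {w S : ℕ} (σ : State w S) (s : NState) : Prop :=
  (∀ r < 32, (σ.reg r).toNat = s.reg r) ∧ (∀ a : Fin S, (σ.mem a).toNat = s.mem a) ∧
    σ.out.map BitVec.toNat = s.out

/-- The registers from `d` on serve as a stack: the second operand is computed at `d + 1` and leaves
the first one intact at `d`. Since `d` is at least `32`, the registers that `Rel` constrains are
never touched, and the same number state remains valid for the second operand. -/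
theorem Ev.sound {w S : ℕ} {s : NState} {e : Ex} {x : ℕ} (he : Ev w S s e x) :
    ∀ (σ : State w S) (d : ℕ), Rel σ s → 32 ≤ d →
      ∃ g : ℕ → BitVec w, Exec (e.code d) σ { σ with reg := g } e.cost ∧
        (∀ i < d, g i = σ.reg i) ∧ (g d).toNat = x := by
  have two : ∀ {a b : Ex} {x y : ℕ} (o : BinOp) (z : ℕ),
      (∀ (σ : State w S) (d : ℕ), Rel σ s → 32 ≤ d →
        ∃ g : ℕ → BitVec w, Exec (a.code d) σ { σ with reg := g } a.cost ∧
          (∀ i < d, g i = σ.reg i) ∧ (g d).toNat = x) →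
      (∀ (σ : State w S) (d : ℕ), Rel σ s → 32 ≤ d →
        ∃ g : ℕ → BitVec w, Exec (b.code d) σ { σ with reg := g } b.cost ∧
          (∀ i < d, g i = σ.reg i) ∧ (g d).toNat = y) →
      (∀ u v : BitVec w, u.toNat = x → v.toNat = y → (o.eval u v).toNat = z) →
      ∀ (σ : State w S) (d : ℕ), Rel σ s → 32 ≤ d →
        ∃ g : ℕ → BitVec w, Exec ((Ex.bin o a b).code d) σ { σ with reg := g } (Ex.bin o a b).cost ∧
          (∀ i < d, g i = σ.reg i) ∧ (g d).toNat = z := by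
    intro a b x y o z iha ihb ho σ d hσ hd
    obtain ⟨g₁, e₁, l₁, v₁⟩ := iha σ d hσ hd
    obtain ⟨g₂, e₂, l₂, v₂⟩ := ihb { σ with reg := g₁ } (d + 1)
      ⟨fun i hi => by rw [← hσ.1 i hi]; exact congrArg _ (l₁ i (by omega)), hσ.2⟩ (by omega)
    refine ⟨_, .seq e₁ (.seq e₂ (.op _ o d d (d + 1))), fun i hi => ?_, ?_⟩
    · rw [Function.update_of_ne hi.ne]
      exact (l₂ i (by omega)).trans (l₁ i hi)
    · simp only [Function.update_self]
      exact ho _ _ (by rw [l₂ d (by omega)]; exact v₁) v₂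
  induction he with
  | @v r h =>
    intro σ d hσ hd
    refine ⟨_, .op σ .or d r r, fun i hi => Function.update_of_ne hi.ne _ _, ?_⟩
    simp [BinOp.eval, hσ.1 r h]
  | @k c h =>
    intro σ d hσ hd
    refine ⟨_, .const σ d c, fun i hi => Function.update_of_ne hi.ne _ _, ?_⟩
    simp [Nat.mod_eq_of_lt h]
  | add _ _ h iha ihb =>
    refine two _ _ iha ihb fun u v hu hv => ?_
    simp only [BinOp.eval, BitVec.toNat_add, hu, hv, Nat.mod_eq_of_lt h]
  | sub _ _ h iha ihb =>
    refine two _ _ iha ihb fun u v hu hv => ?_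
    simp only [BinOp.eval]
    rw [BitVec.toNat_sub_of_le (by rw [BitVec.le_def, hu, hv]; exact h), hu, hv]
  | mul _ _ h iha ihb =>
    refine two _ _ iha ihb fun u v hu hv => ?_
    simp only [BinOp.eval, BitVec.toNat_mul, hu, hv, Nat.mod_eq_of_lt h]
  | div _ _ iha ihb =>
    refine two _ _ iha ihb fun u v hu hv => ?_
    simp only [BinOp.eval, BitVec.udiv_eq, BitVec.toNat_udiv, hu, hv]
  | xor _ _ iha ihb =>
    refine two _ _ iha ihb fun u v hu hv => ?_
    simp only [BinOp.eval, BitVec.toNat_xor, hu, hv]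
  | shr _ _ iha ihb =>
    refine two _ _ iha ihb fun u v hu hv => ?_
    simp only [BinOp.eval, BitVec.toNat_ushiftRight, hu, hv]
  | @ld a x _ h iha =>
    intro σ d hσ hd
    obtain ⟨g₁, e₁, l₁, v₁⟩ := iha σ d hσ hd
    have hx : (g₁ d).toNat < S := by omega
    refine ⟨_, .seq e₁ (.load { σ with reg := g₁ } d d hx), fun i hi => ?_, ?_⟩
    · rw [Function.update_of_ne hi.ne]; exact l₁ i hi
    · simp only [Function.update_self]
      rw [hσ.2.1]; simp [v₁]

/-- `WP w S p s t Q`: started in a configuration represented by `s`, the program `p` halts within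
`t` steps in a configuration represented by some `s'` with `Q s'`. -/
def WP (w S : ℕ) (p : Cmd) (s : NState) (t : ℕ) (Q : NState → Prop) : Prop :=
  ∀ σ : State w S, Rel σ s → ∃ (σ' : State w S) (s' : NState) (t' : ℕ),
    Exec p σ σ' t' ∧ t' ≤ t ∧ Rel σ' s' ∧ Q s'

def setE (r : ℕ) (e : Ex) : Cmd := .seq (e.code 32) (.op .or r 32 32)

def storeE (a b : Ex) : Cmd := .seq (a.code 32) (.seq (b.code 33) (.store 32 33))

def emitE (e : Ex) : Cmd := .seq (e.code 32) (.emit 32)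

namespace WP

variable {w S : ℕ} {p q : Cmd} {s : NState} {t t' : ℕ} {Q Q' : NState → Prop}

theorem mono (h : WP w S p s t Q) (ht : t ≤ t') (hQ : ∀ s, Q s → Q' s) : WP w S p s t' Q' := by
  intro σ hσ
  obtain ⟨σ', s', u, he, hu, hr, hq⟩ := h σ hσ
  exact ⟨σ', s', u, he, hu.trans ht, hr, hQ _ hq⟩

theorem skip (h : Q s) : WP w S .skip s 1 Q := fun σ hσ => ⟨σ, s, 1, .skip σ, le_rfl, hσ, h⟩

theorem seq (h : WP w S p s t fun s' => WP w S q s' t' Q) : WP w S (.seq p q) s (t + t') Q := by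
  intro σ hσ
  obtain ⟨σ₁, s₁, u₁, e₁, l₁, r₁, h₁⟩ := h σ hσ
  obtain ⟨σ₂, s₂, u₂, e₂, l₂, r₂, h₂⟩ := h₁ σ₁ r₁
  exact ⟨σ₂, s₂, _, .seq e₁ e₂, add_le_add l₁ l₂, r₂, h₂⟩

theorem set {r : ℕ} {e : Ex} {x : ℕ} (hr : r < 32) (he : Ev w S s e x)
    (h : Q ⟨Function.update s.reg r x, s.mem, s.out⟩) : WP w S (setE r e) s (e.cost + 1) Q := by
  intro σ hσ
  obtain ⟨g, e₁, l₁, v₁⟩ := he.sound σ 32 hσ le_rfl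
  refine ⟨_, ⟨Function.update s.reg r x, s.mem, s.out⟩, _, .seq e₁ (.op _ .or r 32 32), le_rfl, ⟨fun i hi => ?_, hσ.2⟩, h⟩
  by_cases hir : i = r
  · subst hir; simp [BinOp.eval, v₁]
  · simp [Function.update_of_ne hir, l₁ i hi, hσ.1 i hi]

theorem store {a b : Ex} {x y : ℕ} (ha : Ev w S s a x) (hb : Ev w S s b y) (hx : x < S)
    (h : Q ⟨s.reg, Function.update s.mem x y, s.out⟩) :
    WP w S (storeE a b) s (a.cost + (b.cost + 1)) Q := by
  intro σ hσ
  obtain ⟨g, e₁, l₁, v₁⟩ := ha.sound σ 32 hσ le_rfl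
  obtain ⟨g₂, e₂, l₂, v₂⟩ := hb.sound { σ with reg := g } 33
    ⟨fun i hi => by rw [← hσ.1 i hi]; exact congrArg _ (l₁ i (by omega)), hσ.2⟩ (by omega)
  have hg : (g₂ 32).toNat = x := by rw [l₂ 32 (by omega)]; exact v₁
  refine ⟨_, ⟨s.reg, Function.update s.mem x y, s.out⟩, _, .seq e₁ (.seq e₂ (.store { σ with reg := g₂ } 32 33 (by simpa [hg] using hx))),
    le_rfl, ⟨fun i hi => ?_, fun c => ?_, hσ.2.2⟩, h⟩
  · simp [l₂ i (by omega), l₁ i hi, hσ.1 i hi]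
  · by_cases hc : (c : ℕ) = x
    · have : c = ⟨(g₂ 32).toNat, by simpa [hg] using hx⟩ := Fin.ext (by simp [hc, hg])
      subst this
      simp [v₂, hg]
    · have : c ≠ ⟨(g₂ 32).toNat, by simpa [hg] using hx⟩ := by
        intro hh; exact hc (by rw [hh]; exact hg)
      simp [Function.update_of_ne this, Function.update_of_ne hc, hσ.2.1 c]

theorem emit {a : Ex} {x : ℕ} (ha : Ev w S s a x) (h : Q ⟨s.reg, s.mem, s.out ++ [x]⟩) :
    WP w S (emitE a) s (a.cost + 1) Q := by
  intro σ hσ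
  obtain ⟨g, e₁, l₁, v₁⟩ := ha.sound σ 32 hσ le_rfl
  refine ⟨_, ⟨s.reg, s.mem, s.out ++ [x]⟩, _, .seq e₁ (.emit _ 32), le_rfl,
    ⟨fun i hi => by simp [l₁ i hi, hσ.1 i hi], hσ.2.1, ?_⟩, h⟩
  simp [v₁, hσ.2.2]

section
variable {R m : ℕ → ℕ} {O : List ℕ}

/-- In this form the unused time is passed on by subtraction, so that running through a
straight-line program leaves only concrete numerical inequalities. -/
theorem set_seq {r : ℕ} {e : Ex} {x : ℕ} (hr : r < 32) (he : Ev w S ⟨R, m, O⟩ e x)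
    (ht : e.cost + 1 ≤ t) (h : WP w S q ⟨Function.update R r x, m, O⟩ (t - (e.cost + 1)) Q) :
    WP w S (.seq (setE r e) q) ⟨R, m, O⟩ t Q :=
  mono (seq (set hr he h)) (by omega) fun _ h => h

theorem set_le {r : ℕ} {e : Ex} {x : ℕ} (hr : r < 32) (he : Ev w S ⟨R, m, O⟩ e x)
    (ht : e.cost + 1 ≤ t) (h : Q ⟨Function.update R r x, m, O⟩) :
    WP w S (setE r e) ⟨R, m, O⟩ t Q :=
  mono (set hr he h) ht fun _ h => h

theorem store_seq {a b : Ex} {x y : ℕ} (ha : Ev w S ⟨R, m, O⟩ a x) (hb : Ev w S ⟨R, m, O⟩ b y)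
    (hx : x < S) (ht : a.cost + (b.cost + 1) ≤ t)
    (h : WP w S q ⟨R, Function.update m x y, O⟩ (t - (a.cost + (b.cost + 1))) Q) :
    WP w S (.seq (storeE a b) q) ⟨R, m, O⟩ t Q :=
  mono (seq (store ha hb hx h)) (by omega) fun _ h => h

theorem store_le {a b : Ex} {x y : ℕ} (ha : Ev w S ⟨R, m, O⟩ a x) (hb : Ev w S ⟨R, m, O⟩ b y)
    (hx : x < S) (ht : a.cost + (b.cost + 1) ≤ t) (h : Q ⟨R, Function.update m x y, O⟩) :
    WP w S (storeE a b) ⟨R, m, O⟩ t Q :=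
  mono (store ha hb hx h) ht fun _ h => h

theorem emit_seq {a : Ex} {x : ℕ} (ha : Ev w S ⟨R, m, O⟩ a x) (ht : a.cost + 1 ≤ t)
    (h : WP w S q ⟨R, m, O ++ [x]⟩ (t - (a.cost + 1)) Q) :
    WP w S (.seq (emitE a) q) ⟨R, m, O⟩ t Q :=
  mono (seq (emit ha h)) (by omega) fun _ h => h

end

theorem seq_le {u : ℕ} (hu : u ≤ t) (h : WP w S p s u fun s' => WP w S q s' (t - u) Q) :
    WP w S (.seq p q) s t Q :=
  mono (seq h) (by omega) fun _ h => h

theorem skip_le (ht : 1 ≤ t) (h : Q s) : WP w S .skip s t Q := mono (skip h) ht fun _ h => h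

/-- The meaning of a test on number states. -/
def _root_.WordRAM.Test.NHolds (s : NState) : Test → Prop
  | .eq a b => s.reg a = s.reg b
  | .lt a b => s.reg a < s.reg b

def _root_.WordRAM.Test.Low : Test → Prop
  | .eq a b => a < 32 ∧ b < 32
  | .lt a b => a < 32 ∧ b < 32

theorem _root_.WordRAM.Test.holds_iff {c : Test} (hc : c.Low) {σ : State w S} (hσ : Rel σ s) :
    c.Holds σ.reg ↔ c.NHolds s := by
  cases c with
  | eq a b => simp only [Test.Holds, Test.NHolds, ← hσ.1 a hc.1, ← hσ.1 b hc.2, BitVec.toNat_inj]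
  | lt a b => simp only [Test.Holds, Test.NHolds, ← hσ.1 a hc.1, ← hσ.1 b hc.2]

theorem ite {c : Test} (hc : c.Low) (h₁ : c.NHolds s → WP w S p s t Q)
    (h₂ : ¬ c.NHolds s → WP w S q s t Q) : WP w S (.ite c p q) s (t + 1) Q := by
  intro σ hσ
  by_cases h : c.NHolds s
  · obtain ⟨σ', s', u, e, l, r, hq⟩ := h₁ h σ hσ
    exact ⟨σ', s', _, .ite_true ((c.holds_iff hc hσ).2 h) e, by omega, r, hq⟩
  · obtain ⟨σ', s', u, e, l, r, hq⟩ := h₂ h σ hσ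
    exact ⟨σ', s', _, .ite_false (fun hh => h ((c.holds_iff hc hσ).1 hh)) e, by omega, r, hq⟩

theorem ite_le {c : Test} (hc : c.Low) (ht : 1 ≤ t) (h₁ : c.NHolds s → WP w S p s (t - 1) Q)
    (h₂ : ¬ c.NHolds s → WP w S q s (t - 1) Q) : WP w S (.ite c p q) s t Q :=
  mono (ite hc h₁ h₂) (by omega) fun _ h => h

theorem loop_true {c : Test} (hc : c.Low) (h : c.NHolds s)
    (h₁ : WP w S p s t fun s' => WP w S (.loop c p) s' t' Q) :
    WP w S (.loop c p) s (t + t' + 1) Q := by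
  intro σ hσ
  obtain ⟨σ₁, s₁, u₁, e₁, l₁, r₁, h₁⟩ := h₁ σ hσ
  obtain ⟨σ₂, s₂, u₂, e₂, l₂, r₂, h₂⟩ := h₁ σ₁ r₁
  exact ⟨σ₂, s₂, _, .loop_true ((c.holds_iff hc hσ).2 h) e₁ e₂, by omega, r₂, h₂⟩

theorem loop_false {c : Test} (hc : c.Low) (h : ¬ c.NHolds s) (hQ : Q s) :
    WP w S (.loop c p) s 1 Q :=
  fun σ hσ => ⟨σ, s, 1, .loop_false fun hh => h ((c.holds_iff hc hσ).1 hh), le_rfl, hσ, hQ⟩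

end WP

end WordRAM

/-! ### A sparse set of levels with short ascending and descending chains -/

namespace Trie

/-- The exponent of the largest power of `b` dividing `j`, capped at `k`. -/
def lev (b k j : ℕ) : ℕ := Nat.findGreatest (fun i => b ^ i ∣ j) k

/-- Clears the lowest nonzero digit of `j` in base `b`, if `1 ≤ j < b ^ k`. -/
def down (b k j : ℕ) : ℕ := j - j % b ^ (lev b k j + 1)

/-- Adds one to the lowest nonzero digit of `j` in base `b`, with carry, if `1 ≤ j < b ^ k`. -/
def up (b k j : ℕ) : ℕ := j + b ^ lev b k j

/-- A potential that decreases along ascending chains. -/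
def pot (b k j : ℕ) : ℕ := b * (k - lev b k j) - j / b ^ lev b k j % b

section
variable {b k c j : ℕ}

theorem pow_lev_dvd (b k j : ℕ) : b ^ lev b k j ∣ j :=
  Nat.findGreatest_spec (P := fun i => b ^ i ∣ j) (Nat.zero_le k) (by simp)

theorem le_lev {i : ℕ} (hi : i ≤ k) (h : b ^ i ∣ j) : i ≤ lev b k j :=
  Nat.le_findGreatest (P := fun i => b ^ i ∣ j) hi h

theorem lev_lt (hj : 1 ≤ j) (hjk : j < b ^ k) : lev b k j < k := by
  refine lt_of_le_of_ne (Nat.findGreatest_le k) fun h => ?_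
  have := Nat.le_of_dvd hj (h ▸ pow_lev_dvd b k j)
  omega

theorem not_pow_dvd (hj : 1 ≤ j) (hjk : j < b ^ k) : ¬ b ^ (lev b k j + 1) ∣ j := fun h => by
  have := le_lev (k := k) (lev_lt hj hjk) h
  omega

theorem dvd_down : b ^ (lev b k j + 1) ∣ down b k j := Nat.dvd_sub_mod j

theorem down_lt (hj : 1 ≤ j) (hjk : j < b ^ k) : down b k j < j := by
  have : j % b ^ (lev b k j + 1) ≠ 0 := fun h => not_pow_dvd hj hjk (Nat.dvd_of_mod_eq_zero h)
  exact Nat.sub_lt hj (Nat.pos_of_ne_zero this)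

/-- Since `lev` is below `k` for positive heights below `b ^ k`, a descending chain reaches `0`
after at most `k` steps. -/
theorem lev_lt_lev_down (hj : 1 ≤ j) (hjk : j < b ^ k) : lev b k j < lev b k (down b k j) :=
  le_lev (lev_lt hj hjk) dvd_down

theorem lt_up (hb : 2 ≤ b) : j < up b k j := by
  have : 0 < b ^ lev b k j := by positivity
  unfold up; omega

theorem up_le (hj : 1 ≤ j) : up b k j ≤ 2 * j := by
  have := Nat.le_of_dvd hj (pow_lev_dvd b k j)
  unfold up; omega

/-- A height strictly between `c` and `up c` has a smaller `lev` than `c`, because otherwise `b ^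
lev c` would divide the positive difference `j - c`, which is less than it. Hence `c` is a multiple
of `b ^ (lev j + 1)`, and rounding `j` down to such a multiple does not go below `c`. This is what
allows a deletion to skip the heights between `c` and `up c`. -/
theorem le_down (hb : 2 ≤ b) (hcj : c < j) (hju : j < up b k c) : c ≤ down b k j := by
  have hl : lev b k j < lev b k c := by
    by_contra hh
    have h1 : b ^ lev b k c ∣ j := (pow_dvd_pow b (not_lt.1 hh)).trans (pow_lev_dvd b k j)
    have h2 : b ^ lev b k c ∣ j - c := Nat.dvd_sub h1 (pow_lev_dvd b k c)
    have := Nat.le_of_dvd (by omega) h2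
    unfold up at hju; omega
  obtain ⟨a, ha⟩ : b ^ (lev b k j + 1) ∣ c := (pow_dvd_pow b hl).trans (pow_lev_dvd b k c)
  have hd : down b k j = b ^ (lev b k j + 1) * (j / b ^ (lev b k j + 1)) := by
    have := Nat.div_add_mod j (b ^ (lev b k j + 1))
    unfold down; omega
  rw [hd]
  conv_lhs => rw [ha]
  refine Nat.mul_le_mul_left _ ?_
  have hpos : 0 < b ^ (lev b k j + 1) := by positivity
  rw [Nat.le_div_iff_mul_le hpos, mul_comm, ← ha]
  omega

theorem pot_le : pot b k j ≤ b * k :=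
  (Nat.sub_le _ _).trans (Nat.mul_le_mul_left _ (Nat.sub_le _ _))

/-- Either there is no carry, and the lowest nonzero digit grows by one; or `lev` increases, which
lowers the first term by at least `b`, while the digit subtracted before was less than `b`. So an
ascending chain below `b ^ k` has O(b k) members. -/
theorem pot_up_lt (hb : 2 ≤ b) (hc : 1 ≤ c) (hck : up b k c < b ^ k) :
    pot b k (up b k c) < pot b k c := by
  have hck' : c < b ^ k := (lt_up hb).trans hck
  set l := lev b k c with hl
  have hlk : l < k := lev_lt hc hck'
  obtain ⟨a, ha⟩ := pow_lev_dvd b k c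
  rw [← hl] at ha
  have hbl : 0 < b ^ l := by positivity
  have hca : c / b ^ l = a := by rw [ha]; exact Nat.mul_div_cancel_left a hbl
  have hu : up b k c = b ^ l * (a + 1) := by unfold up; rw [← hl, mul_add]; omega
  have hmod : a % b < b := Nat.mod_lt _ (by omega)
  have hge : l ≤ lev b k (up b k c) := le_lev hlk.le ⟨_, hu⟩
  unfold pot
  rw [← hl, hca]
  have hkl : b ≤ b * (k - l) := Nat.le_mul_of_pos_right _ (by omega)
  rcases hge.eq_or_lt with h | h
  · rw [← h, hu, Nat.mul_div_cancel_left _ hbl]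
    have hnd : ¬ b ∣ a + 1 := fun hd => by
      refine not_pow_dvd (b := b) (k := k) (j := up b k c) (by have := lt_up (k := k) (j := c) hb; omega) hck ?_
      rw [← h, hu, pow_succ]
      exact Nat.mul_dvd_mul_left _ hd
    have : (a + 1) % b = a % b + 1 := by
      have h1 : a % b + 1 ≠ b := fun hh => hnd (by
        rw [Nat.dvd_iff_mod_eq_zero, Nat.add_mod, Nat.mod_eq_of_lt (by omega : 1 < b), hh, Nat.mod_self])
      rw [Nat.add_mod, Nat.mod_eq_of_lt (by omega : 1 < b), Nat.mod_eq_of_lt (by omega)]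
    omega
  · have : b * (k - lev b k (up b k c)) ≤ b * (k - l) - b := by
      calc b * (k - lev b k (up b k c)) ≤ b * (k - l - 1) := Nat.mul_le_mul_left _ (by omega)
        _ = b * (k - l) - b := by rw [Nat.mul_sub]; simp
    have hlt : a % b < b * (k - l) := by omega
    omega

end

/-! ### First elements below the nodes of a binary trie

The leaves of the trie are the numbers `2 ^ h, …, 2 ^ (h + 1) - 1`, and the ancestor of `x` at
height `j` is `x >>> j`. -/

section
variable {lt : ℕ → ℕ → Prop} {A : Set ℕ} {b k h : ℕ} {T : ℕ → ℕ}

theorem shiftRight_mono {x y : ℕ} (j : ℕ) (hxy : x ≤ y) : x >>> j ≤ y >>> j := by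
  simp only [Nat.shiftRight_eq_div_pow]
  exact Nat.div_le_div_right hxy

/-- For leaves this says that the bit length of the xor is the height of the lowest common ancestor,
so that height costs a single lookup. -/
theorem shiftRight_eq_iff {x y j : ℕ} : x >>> j = y >>> j ↔ Nat.size (x ^^^ y) ≤ j := by
  rw [Nat.size_le, ← Nat.xor_eq_zero_iff, ← Nat.shiftRight_xor_distrib, Nat.shiftRight_eq_div_pow,
    Nat.div_eq_zero_iff]
  simp

theorem shiftRight_congr {x y i j : ℕ} (hxy : x >>> i = y >>> i) (hij : i ≤ j) :
    x >>> j = y >>> j :=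
  shiftRight_eq_iff.2 ((shiftRight_eq_iff.1 hxy).trans hij)

def Leaf (h x : ℕ) : Prop := 2 ^ h ≤ x ∧ x < 2 ^ (h + 1)

theorem Leaf.shiftRight_lt {x : ℕ} (hx : Leaf h x) (j : ℕ) : x >>> j < 2 ^ (h + 1) :=
  lt_of_le_of_lt (Nat.shiftRight_le x j) hx.2

theorem Leaf.size_shiftRight {x j : ℕ} (hx : Leaf h x) (hj : j ≤ h) :
    Nat.size (x >>> j) = h + 1 - j := by
  rw [Nat.shiftRight_eq_div_pow]
  refine le_antisymm (Nat.size_le.2 ?_) ?_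
  · rw [Nat.div_lt_iff_lt_mul (by positivity), ← pow_add, show h + 1 - j + j = h + 1 by omega]
    exact hx.2
  · have : h - j < Nat.size (x / 2 ^ j) := by
      rw [Nat.lt_size, Nat.le_div_iff_mul_le (by positivity), ← pow_add,
        show h - j + j = h by omega]
      exact hx.1
    omega

/-- With this numbering the bit length of a node determines its height. So one array of pointers
indexed by nodes serves all heights, and a write at one height does not affect another. -/
theorem Leaf.height_unique {x y i j : ℕ} (hx : Leaf h x) (hy : Leaf h y) (hi : i ≤ h) (hj : j ≤ h)
    (hxy : x >>> i = y >>> j) : i = j := by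
  have h1 := hx.size_shiftRight hi
  have h2 := hy.size_shiftRight hj
  rw [hxy] at h1
  omega

theorem Leaf.size_xor_le {x y : ℕ} (hx : Leaf h x) (hy : Leaf h y) : Nat.size (x ^^^ y) ≤ h := by
  rw [← shiftRight_eq_iff, Nat.shiftRight_eq_div_pow, Nat.shiftRight_eq_div_pow]
  have : ∀ z, Leaf h z → z / 2 ^ h = 1 := fun z hz => by
    refine Nat.div_eq_of_lt_le (by simpa using hz.1) ?_
    have := hz.2
    rw [pow_succ] at this
    omega
  rw [this x hx, this y hy]

/-- `m` is the first element of `A` below the node `v` of height `j`. -/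
def IsFirst (lt : ℕ → ℕ → Prop) (A : Set ℕ) (j v m : ℕ) : Prop :=
  m ∈ A ∧ m >>> j = v ∧ ∀ a ∈ A, a >>> j = v → ¬ lt a m

/-- The node `v` of height `j` points to a leaf that has the same ancestor at height `down j` as
the first element below `v`, if there is one. -/
def TrieOK (b k h : ℕ) (lt : ℕ → ℕ → Prop) (A : Set ℕ) (T : ℕ → ℕ) : Prop :=
  ∀ j, 1 ≤ j → j ≤ h → ∀ v m, IsFirst lt A j v m → T v >>> down b k j = m >>> down b k j

/-- Pointers to first and to last elements are both needed; a variable order lets one argument serve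
for both. -/
def Dir (lt : ℕ → ℕ → Prop) : Prop := lt = (· < ·) ∨ lt = (· > ·)

theorem Dir.convex (hd : Dir lt) {x y z j v : ℕ} (hx : x >>> j = v) (hz : z >>> j = v)
    (hxy : ¬ lt y x) (hyz : ¬ lt z y) : y >>> j = v := by
  rcases hd with rfl | rfl
  · have := shiftRight_mono j (not_lt.1 hxy)
    have := shiftRight_mono j (not_lt.1 hyz)
    omega
  · have := shiftRight_mono j (not_lt.1 hxy)
    have := shiftRight_mono j (not_lt.1 hyz)
    omega

theorem Dir.trichotomy (hd : Dir lt) (x y : ℕ) : lt x y ∨ x = y ∨ lt y x := by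
  rcases hd with rfl | rfl
  · exact lt_trichotomy x y
  · exact (lt_trichotomy x y).elim (fun h => .inr (.inr h)) fun h => h.elim (fun h => .inr (.inl h))
      fun h => .inl h

theorem Dir.asymm (hd : Dir lt) {x y : ℕ} (hxy : lt x y) : ¬ lt y x := by
  rcases hd with rfl | rfl
  · exact not_lt.2 (le_of_lt hxy)
  · exact not_lt.2 (le_of_lt hxy)

theorem Dir.trans (hd : Dir lt) {x y z : ℕ} (hxy : lt x y) (hyz : lt y z) : lt x z := by
  rcases hd with rfl | rfl
  · exact lt_trans hxy hyz
  · exact lt_trans hyz hxy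

theorem Dir.irrefl (hd : Dir lt) (x : ℕ) : ¬ lt x x := fun hx => hd.asymm hx hx

/-- One descending step of the search for the first element. -/
theorem TrieOK.step (hT : TrieOK b k h lt A T) {j₀ v₀ j y m : ℕ}
    (hj : 1 ≤ j) (hjh : j ≤ h) (hjj : j ≤ j₀) (hm : IsFirst lt A j₀ v₀ m)
    (hy : y >>> j = m >>> j) : T (y >>> j) >>> down b k j = m >>> down b k j := by
  refine hT j hj hjh _ m ⟨hm.1, hy.symm, fun a ha hav => hm.2.2 a ha ?_⟩
  rw [← hm.2.1]
  exact shiftRight_congr (hav.trans hy) hjj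

/-- `T` is as required for `A \ {x}`, except at the ancestors of `x` of height at least `c`, where it
is still `T₀`. -/
def PartOK (b k h : ℕ) (lt : ℕ → ℕ → Prop) (A : Set ℕ) (T₀ : ℕ → ℕ) (x c : ℕ) (T : ℕ → ℕ) : Prop :=
  (∀ j, 1 ≤ j → j ≤ h → ∀ v m, ¬ (v = x >>> j ∧ c ≤ j) → IsFirst lt (A \ {x}) j v m →
    T v >>> down b k j = m >>> down b k j) ∧ ∀ j, c ≤ j → j ≤ h → T (x >>> j) = T₀ (x >>> j)

/-- `x` is an element of `A` with predecessor `pr` and successor `nx`. -/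
structure Between (lt : ℕ → ℕ → Prop) (A : Set ℕ) (pr x nx : ℕ) : Prop where
  mem : x ∈ A
  pr_mem : pr ∈ A
  nx_mem : nx ∈ A
  pr_lt : lt pr x
  lt_nx : lt x nx
  nx_le : ∀ a ∈ A, lt x a → ¬ lt a nx
  le_pr : ∀ a ∈ A, lt a x → ¬ lt pr a

variable {pr x nx : ℕ}

theorem Between.pr_of_lt (hd : Dir lt) (hB : Between lt A pr x nx) {a j : ℕ} (ha : a ∈ A)
    (hax : lt a x) (h : a >>> j = x >>> j) : pr >>> j = x >>> j :=
  hd.convex h rfl (fun hh => hB.le_pr a ha hax hh) (hd.asymm hB.pr_lt)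

theorem Between.nx_of_lt (hd : Dir lt) (hB : Between lt A pr x nx) {a j : ℕ} (ha : a ∈ A)
    (hax : lt x a) (h : a >>> j = x >>> j) : nx >>> j = x >>> j :=
  hd.convex rfl h (hd.asymm hB.lt_nx) fun hh => hB.nx_le a ha hax hh

theorem IsFirst.of_diff {j v m : ℕ} (h : IsFirst lt (A \ {x}) j v m) (hx : x >>> j = v → ¬ lt x m) :
    IsFirst lt A j v m := by
  refine ⟨h.1.1, h.2.1, fun a ha hav => ?_⟩
  by_cases hax : a = x
  · subst hax; exact hx hav
  · exact h.2.2 a ⟨ha, hax⟩ hav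

theorem Between.not_lt_first (hd : Dir lt) (hB : Between lt A pr x nx) {j v m : ℕ}
    (hm : IsFirst lt (A \ {x}) j v m) (hv : v = x >>> j) (hj : pr >>> j = x >>> j) : ¬ lt x m :=
  fun hxm => hm.2.2 pr ⟨hB.pr_mem, fun h => hd.irrefl x (by have := hB.pr_lt; rwa [h] at this)⟩
    (hj.trans hv.symm) (hd.trans hB.pr_lt hxm)

/-- Below this height `nx`, and thus every element beyond `x`, is outside the subtree at the
ancestor of `x`. So whatever is first there without `x` precedes `x` and was first before the
deletion. -/
theorem PartOK.start (hd : Dir lt) (hT : TrieOK b k h lt A T) (hB : Between lt A pr x nx) :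
    PartOK b k h lt A T x (Nat.size (x ^^^ nx)) T := by
  refine ⟨fun j hj hjh v m hv hm => hT j hj hjh v m (hm.of_diff ?_), fun _ _ _ => rfl⟩
  rintro rfl hxm
  have := hB.nx_of_lt hd hm.1.1 hxm hm.2.1
  exact hv ⟨rfl, shiftRight_eq_iff.1 this.symm⟩

/-- From the height where `x` and `pr` meet, `pr` is below every ancestor of `x`, so `x` was not
first there and the old pointers are still right. -/
theorem PartOK.finish (hd : Dir lt) {T₀ : ℕ → ℕ} (hT₀ : TrieOK b k h lt A T₀)
    (hB : Between lt A pr x nx) {c : ℕ} (hP : PartOK b k h lt A T₀ x c T)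
    (hc : Nat.size (x ^^^ pr) ≤ c) : TrieOK b k h lt (A \ {x}) T := by
  intro j hj hjh v m hm
  by_cases hv : v = x >>> j ∧ c ≤ j
  · obtain ⟨rfl, hcj⟩ := hv
    rw [hP.2 j hcj hjh]
    exact hT₀ j hj hjh _ m (hm.of_diff fun _ => hB.not_lt_first hd hm rfl
      (shiftRight_eq_iff.2 (hc.trans hcj)).symm)
  · exact hP.1 j hj hjh v m hv hm

/-- At the ancestors of `x` in this range of heights, `x` was first and `nx` takes its place. At
height `c` the pointer is rewritten. At a height `j` strictly between `c` and `up c` the old pointer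
agreed with `x` at height `down j`; this is at least `c` by `le_down`, and there `x` and `nx` have
the same ancestor. -/
theorem PartOK.step (hb : 2 ≤ b) (hd : Dir lt) (hA : ∀ a ∈ A, Leaf h a) {T₀ : ℕ → ℕ}
    (hT₀ : TrieOK b k h lt A T₀) (hB : Between lt A pr x nx) {c : ℕ}
    (hP : PartOK b k h lt A T₀ x c T) (hc1 : Nat.size (x ^^^ nx) ≤ c)
    (hc2 : c < Nat.size (x ^^^ pr)) :
    PartOK b k h lt A T₀ x (up b k c) (Function.update T (x >>> c) nx) := by
  have hch : c ≤ h := hc2.le.trans ((hA x hB.mem).size_xor_le (hA pr hB.pr_mem))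
  have hne : ∀ j v m, j ≤ h → m ∈ A → m >>> j = v → j ≠ c → v ≠ x >>> c := by
    rintro j v m hj hm rfl hjc he
    exact hjc ((hA m hm).height_unique (hA x hB.mem) hj hch he)
  have hnx : ∀ j m, c ≤ j → ¬ Nat.size (x ^^^ pr) ≤ j → IsFirst lt (A \ {x}) j (x >>> j) m →
      m = nx := by
    intro j m hcj hj hm
    have h2 : nx >>> j = x >>> j := (shiftRight_eq_iff.2 (hc1.trans hcj)).symm
    rcases hd.trichotomy m nx with h | h | h
    · rcases hd.trichotomy m x with h' | h' | h'
      · exact absurd (shiftRight_eq_iff.1 (hB.pr_of_lt hd hm.1.1 h' hm.2.1).symm) hj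
      · exact absurd h' hm.1.2
      · exact absurd h (hB.nx_le m hm.1.1 h')
    · exact h
    · refine absurd h (hm.2.2 nx ⟨hB.nx_mem, fun h => ?_⟩ h2)
      have := hB.lt_nx
      rw [h] at this
      exact hd.irrefl x this
  refine ⟨fun j hj hjh v m hv hm => ?_, fun j hj hjh => ?_⟩
  · by_cases hjc : j = c
    · subst hjc
      by_cases hvx : v = x >>> j
      · subst hvx
        rw [Function.update_self, hnx j m le_rfl (by omega) hm]
      · rw [Function.update_of_ne hvx]
        exact hP.1 j hj hjh v m (by tauto) hm
    · rw [Function.update_of_ne (hne j v m hjh hm.1.1 hm.2.1 hjc)]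
      by_cases hvx : v = x >>> j ∧ c ≤ j
      · obtain ⟨rfl, hcj⟩ := hvx
        have hju : j < up b k c := not_le.1 fun hh => hv ⟨rfl, hh⟩
        rw [hP.2 j hcj hjh]
        by_cases hjp : Nat.size (x ^^^ pr) ≤ j
        · exact hT₀ j hj hjh _ m (hm.of_diff fun _ => hB.not_lt_first hd hm rfl
            (shiftRight_eq_iff.2 hjp).symm)
        · have hx : IsFirst lt A j (x >>> j) x := ⟨hB.mem, rfl, fun a ha hax hlt => hjp
            (shiftRight_eq_iff.1 (hB.pr_of_lt hd ha hlt hax).symm)⟩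
          rw [hT₀ j hj hjh _ x hx, hnx j m hcj hjp hm]
          exact shiftRight_eq_iff.2 (hc1.trans (le_down hb (by omega) hju))
      · exact hP.1 j hj hjh v m hvx hm
  · have hcj : c < j := (lt_up hb).trans_le hj
    rw [Function.update_of_ne (hne j _ x hjh hB.mem rfl hcj.ne')]
    exact hP.2 j hcj.le hjh

/-- For every set of leaves there are suitable pointers. -/
theorem exists_trieOK (b k h : ℕ) (hd : Dir lt) (hA : ∀ a ∈ A, Leaf h a) :
    ∃ T : ℕ → ℕ, (∀ v, Leaf h (T v)) ∧ TrieOK b k h lt A T := by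
  have : ∀ v, ∃ y, Leaf h y ∧ ∀ j, 1 ≤ j → j ≤ h → ∀ m, IsFirst lt A j v m → y = m := by
    intro v
    by_cases hv : ∃ j m, j ≤ h ∧ IsFirst lt A j v m
    · obtain ⟨j, m, hjh, hm⟩ := hv
      refine ⟨m, hA m hm.1, fun j' _ hj' m' hm' => ?_⟩
      obtain rfl := (hA m hm.1).height_unique (hA m' hm'.1) hjh hj' (hm.2.1.trans hm'.2.1.symm)
      rcases hd.trichotomy m m' with h | h | h
      · exact absurd h (hm'.2.2 m hm.1 hm.2.1)
      · exact h
      · exact absurd h (hm.2.2 m' hm'.1 hm'.2.1)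
    · exact ⟨2 ^ h, ⟨le_rfl, Nat.pow_lt_pow_right one_lt_two h.lt_succ_self⟩, fun j _ hj m hm => absurd ⟨j, m, hj, hm⟩ hv⟩
  choose T hT using this
  exact ⟨T, fun v => (hT v).1, fun j hj hjh v m hm => by rw [(hT v).2 j hj hjh m hm]⟩

end

end Trie

section
open Finset
/-! ### A compressed representation of the zeros of a chunk

A chunk consists of `r` blocks of `β` bits. The zeros of its blocks are stored in cells, several
sparse blocks to a cell; the header of the chunk says for each block in which cell it is. -/

namespace Chunk

/-- `slot j` is the cell of block `j`, and `ne j` says whether block `j` contains a one. `opn` is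
the cell that still accepts sparse blocks, and `fill` is the capacity already granted from it. -/
structure Hdr where
  slot : ℕ → ℕ
  ne : ℕ → Bool
  opn : ℕ
  fill : ℕ

/-- A cell holds either a few zeros of every block of a chunk, or all zeros of a single block. -/
inductive Cell
  | bin (f : ℕ → Finset ℕ)
  | plain (P : Finset ℕ)

def Cell.pat : Cell → ℕ → Finset ℕ
  | bin f, j => f j
  | plain P, _ => P

def Cell.blank : Cell := bin fun _ => ∅

/-- The capacity reserved for a block with `z` zeros. -/
def cap (Z z : ℕ) : ℕ := if Z < z then 2 * Z else if z = 0 then 0 else 2 ^ Nat.clog 2 z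

def Cell.set (Z : ℕ) (c : Cell) (j : ℕ) (P : Finset ℕ) : Cell :=
  if Z < #P then plain P else
    match c with
    | bin f => bin (Function.update f j P)
    -- A default that is never used: a block with at most `Z` zeros is not put into a plain cell.
    | plain _ => blank

theorem Cell.set_bin {Z j : ℕ} {f : ℕ → Finset ℕ} {P : Finset ℕ} (h : ¬ Z < #P) :
    (Cell.bin f).set Z j P = .bin (Function.update f j P) := if_neg h

/-- `P` already contains the new zero, so `#P - 1` is the former number of zeros. A block moves only
if its capacity changes: to the open cell if there is room, otherwise to the fresh cell `new`. -/
def Hdr.tgt (Z : ℕ) (H : Hdr) (j : ℕ) (P : Finset ℕ) (new : ℕ) : ℕ :=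
  if cap Z #P = cap Z (#P - 1) then H.slot j
  else if cap Z #P ≤ Z ∧ H.fill + cap Z #P ≤ 2 * Z then H.opn else new

/-- The header after block `j` has got the set of zeros `P` with one more element. -/
def Hdr.set (β Z : ℕ) (H : Hdr) (j : ℕ) (P : Finset ℕ) (new : ℕ) : Hdr where
  slot := Function.update H.slot j (H.tgt Z j P new)
  ne := Function.update H.ne j (decide (P ≠ range β))
  opn := if cap Z #P = cap Z (#P - 1) ∨ Z < cap Z #P then H.opn else H.tgt Z j P new
  fill := if cap Z #P = cap Z (#P - 1) ∨ Z < cap Z #P then H.fill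
    else if H.fill + cap Z #P ≤ 2 * Z then H.fill + cap Z #P else cap Z #P

section cap
variable {Z z : ℕ}

theorem cap_zero : cap Z 0 = 0 := by simp [cap]

theorem cap_of_lt (h : Z < z) : cap Z z = 2 * Z := by simp [cap, h]

theorem cap_of_le {e : ℕ} (hZ : Z = 2 ^ e) (h : z ≤ Z) : z ≤ cap Z z ∧ cap Z z ≤ Z := by
  rw [cap, if_neg (by omega)]
  split_ifs with h0
  · omega
  · refine ⟨Nat.le_pow_clog one_lt_two z, ?_⟩
    rw [hZ] at h ⊢
    exact Nat.pow_le_pow_right two_pos (Nat.clog_le_of_le_pow h)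

theorem cap_le_two_mul : cap Z z ≤ 2 * z := by
  unfold cap
  split_ifs with h0 h1
  · omega
  · omega
  · rcases Nat.lt_or_ge 1 z with h | h
    · have hc : Nat.clog 2 z ≠ 0 := by have := Nat.clog_pos one_lt_two h; omega
      have := Nat.pow_pred_clog_lt_self one_lt_two h
      obtain ⟨c, hc⟩ := Nat.exists_eq_succ_of_ne_zero hc
      rw [hc, Nat.pow_succ]
      rw [hc, Nat.pred_succ] at this
      omega
    · obtain rfl : z = 1 := by omega
      simp

theorem cap_pos (hZ : 0 < Z) (hz : 0 < z) : 0 < cap Z z := by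
  unfold cap
  split_ifs with h0 h1
  · omega
  · omega
  · positivity

theorem cap_self {e : ℕ} (hZ : Z = 2 ^ e) : cap Z Z = Z := by
  have : Z ≠ 0 := by rw [hZ]; positivity
  rw [cap, if_neg (lt_irrefl _), if_neg this, hZ, Nat.clog_pow 2 e one_lt_two]

/-- The capacities are `0`, the powers of two up to `Z`, and finally `2 * Z`. As they at least
double, all capacities ever granted to a block add up to at most twice the present one, which pays
for the space left behind in abandoned cells. -/
theorem two_mul_cap_le {e : ℕ} (hZ : Z = 2 ^ e) (h : cap Z (z + 1) ≠ cap Z z) :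
    2 * cap Z z ≤ cap Z (z + 1) := by
  rcases Nat.lt_or_ge Z z with h1 | h1
  · exact absurd (by rw [cap_of_lt h1, cap_of_lt (by omega)]) h
  rcases Nat.eq_or_lt_of_le h1 with h2 | h2
  · subst h2
    rw [cap_self hZ, cap_of_lt (by omega)]
  rcases Nat.eq_zero_or_pos z with h3 | h3
  · subst h3; simp [cap_zero]
  have e1 : cap Z z = 2 ^ Nat.clog 2 z := by rw [cap, if_neg (by omega), if_neg (by omega)]
  have e2 : cap Z (z + 1) = 2 ^ Nat.clog 2 (z + 1) := by
    rw [cap, if_neg (by omega), if_neg (by omega)]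
  rw [e1, e2] at h ⊢
  rw [← pow_succ']
  refine Nat.pow_le_pow_right two_pos ?_
  have : Nat.clog 2 z ≤ Nat.clog 2 (z + 1) := Nat.clog_mono_right 2 (by omega)
  rcases this.eq_or_lt with h4 | h4
  · exact absurd (by rw [h4]) h
  · exact h4

end cap

/-- The zeros that a cell has to provide for, when the blocks have the zeros `pat`. -/
def weight (r Z : ℕ) (slot : ℕ → ℕ) (pat f : ℕ → Finset ℕ) (id : ℕ) : ℕ :=
  ∑ j ∈ range r, if slot j = id then cap Z #(pat j) else #(f j)

def Cell.Valid (r β Z : ℕ) : Cell → Prop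
  | bin f => (∀ j, f j ⊆ range β) ∧ (∀ j, r ≤ j → f j = ∅) ∧ ∑ j ∈ range r, #(f j) ≤ 2 * Z
  | plain P => P ⊆ range β

/-- The header `H` and the cells it refers to represent the blocks `pat` of the chunk named `Y`.
Cell number `0` is shared and empty; `own` says to which chunk the other cells belong, and `nb` is
the number of cells of the chunk. -/
structure Inv (r β Z : ℕ) (cell : ℕ → Cell) (own : ℕ → ℕ) (cnt Y : ℕ) (H : Hdr)
    (pat : ℕ → Finset ℕ) (nb : ℕ) : Prop where
  content : ∀ j < r, (cell (H.slot j)).pat j = pat j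
  ne : ∀ j < r, H.ne j = true ↔ pat j ≠ range β
  -- Fixing the values outside the chunk makes a header finite data, so that it can be encoded in a
  -- word.
  beyond : ∀ j, r ≤ j → H.slot j = 0 ∧ H.ne j = false
  slot_lt : ∀ j, H.slot j < cnt
  opn_lt : H.opn < cnt
  slot_own : ∀ j < r, H.slot j = 0 ∨ own (H.slot j) = Y
  slot_ne : ∀ j < r, pat j ≠ ∅ → H.slot j ≠ 0
  big : ∀ j < r, Z < #(pat j) → cell (H.slot j) = .plain (pat j) ∧
    ∀ j' < r, H.slot j' = H.slot j → j' = j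
  small : ∀ j < r, #(pat j) ≤ Z → ∃ f, cell (H.slot j) = .bin f
  weight_le : ∀ id f, own id = Y → cell id = .bin f → weight r Z H.slot pat f id ≤ 2 * Z
  -- The first alternative means that no cell is open; the maximal value of `fill` then forces a new
  -- cell.
  opn : (H.opn = 0 ∧ H.fill = 2 * Z) ∨ (own H.opn = Y ∧ ∃ f, cell H.opn = .bin f ∧
    weight r Z H.slot pat f H.opn ≤ H.fill)
  fill_le : H.fill ≤ 2 * Z
  -- Amortisation: an open cell is replaced only when more than `Z` of its `2 * Z` units are
  -- granted, and the sum of capacities grows by at least half of each grant.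
  count : nb * Z + H.fill ≤ 2 * Z + 2 * ∑ j ∈ range r, cap Z #(pat j)

section
variable {r β Z e : ℕ} {cell cell' : ℕ → Cell} {own own' : ℕ → ℕ} {cnt cnt' Y : ℕ} {H : Hdr}
  {pat : ℕ → Finset ℕ} {nb : ℕ}

/-- Operations on cells of other chunks do no harm. -/
theorem Inv.frame (hI : Inv r β Z cell own cnt Y H pat nb) (h0 : cell' 0 = cell 0)
    (h1 : ∀ id, own id = Y → cell' id = cell id ∧ own' id = Y) (h2 : ∀ id, own' id = Y → own id = Y)
    (h3 : cnt ≤ cnt') : Inv r β Z cell' own' cnt' Y H pat nb := by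
  have hs : ∀ j < r, cell' (H.slot j) = cell (H.slot j) := fun j hj => by
    rcases hI.slot_own j hj with h | h
    · rw [h, h0]
    · exact (h1 _ h).1
  constructor
  · intro j hj; rw [hs j hj]; exact hI.content j hj
  · exact hI.ne
  · exact hI.beyond
  · exact fun j => (hI.slot_lt j).trans_le h3
  · exact hI.opn_lt.trans_le h3
  · exact fun j hj => (hI.slot_own j hj).imp_right fun h => (h1 _ h).2
  · exact hI.slot_ne
  · intro j hj; rw [hs j hj]; exact hI.big j hj
  · intro j hj; rw [hs j hj]; exact hI.small j hj
  · intro id f ho hc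
    exact hI.weight_le id f (h2 _ ho) (by rw [← (h1 _ (h2 _ ho)).1]; exact hc)
  · refine hI.opn.imp_right fun ⟨a, f, b⟩ => ⟨(h1 _ a).2, f, by rw [(h1 _ a).1]; exact b⟩
  · exact hI.fill_le
  · exact hI.count

/-- The contents of the target cell after the operation. -/
def tgtCell (Z : ℕ) (H : Hdr) (cell : ℕ → Cell) (cnt j : ℕ) (P : Finset ℕ) : Cell :=
  (if H.tgt Z j P cnt = cnt then Cell.blank else cell (H.tgt Z j P cnt)).set Z j P

def newOwn (Z : ℕ) (H : Hdr) (own : ℕ → ℕ) (cnt Y j : ℕ) (P : Finset ℕ) : ℕ → ℕ :=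
  if H.tgt Z j P cnt = cnt then Function.update own cnt Y else own

theorem weight_update {j : ℕ} (hj : j < r) (slot : ℕ → ℕ) (pat f : ℕ → Finset ℕ) (T : ℕ)
    (P : Finset ℕ) :
    weight r Z (Function.update slot j T) (Function.update pat j P) (Function.update f j P) T +
      (if slot j = T then cap Z #(pat j) else #(f j)) = weight r Z slot pat f T + cap Z #P := by
  unfold weight
  rw [← Finset.add_sum_erase _ _ (mem_range.2 hj), ← Finset.add_sum_erase (range r)
    (fun j => if slot j = T then cap Z #(pat j) else #(f j)) (mem_range.2 hj)]
  have : ∀ i ∈ (range r).erase j, (if Function.update slot j T i = T then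
      cap Z #(Function.update pat j P i) else #(Function.update f j P i)) =
      if slot i = T then cap Z #(pat i) else #(f i) := fun i hi => by
    have := ne_of_mem_erase hi
    simp only [Function.update_of_ne this]
  rw [sum_congr rfl this]
  simp only [Function.update_self, if_true]
  omega

theorem sum_cap_update {j : ℕ} (hj : j < r) (pat : ℕ → Finset ℕ) (P : Finset ℕ) :
    ∑ i ∈ range r, cap Z #(Function.update pat j P i) + cap Z #(pat j) =
      ∑ i ∈ range r, cap Z #(pat i) + cap Z #P := by
  rw [← Finset.add_sum_erase _ _ (mem_range.2 hj), ← Finset.add_sum_erase (range r)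
    (fun i => cap Z #(pat i)) (mem_range.2 hj)]
  have : ∀ i ∈ (range r).erase j, cap Z #(Function.update pat j P i) = cap Z #(pat i) :=
    fun i hi => by rw [Function.update_of_ne (ne_of_mem_erase hi)]
  rw [sum_congr rfl this]
  simp only [Function.update_self]
  omega

theorem sum_card_le_weight (hZ : Z = 2 ^ e) {slot : ℕ → ℕ} {f : ℕ → Finset ℕ} {id : ℕ}
    (h : ∀ j < r, slot j = id → #(pat j) ≤ Z ∧ f j = pat j) :
    ∑ j ∈ range r, #(f j) ≤ weight r Z slot pat f id := by
  refine sum_le_sum fun j hj => ?_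
  split_ifs with hs
  · obtain ⟨h1, h2⟩ := h j (mem_range.1 hj) hs
    rw [h2]; exact (cap_of_le hZ h1).1
  · exact le_rfl

/-- If block `j` leaves the cell, its entry remains as garbage, but the garbage is at most the
capacity that was counted for the block before. So the weight does not increase. -/
theorem weight_other {j T id : ℕ} {slot : ℕ → ℕ} {f : ℕ → Finset ℕ} {P : Finset ℕ} (hT : id ≠ T)
    (h : slot j = id → #(f j) ≤ cap Z #(pat j)) :
    weight r Z (Function.update slot j T) (Function.update pat j P) f id ≤
      weight r Z slot pat f id := by
  refine sum_le_sum fun i _ => ?_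
  by_cases hij : i = j
  · subst hij
    rw [Function.update_self, if_neg (Ne.symm hT)]
    split_ifs with hs
    · exact h hs
    · exact le_rfl
  · rw [Function.update_of_ne hij, Function.update_of_ne hij]

theorem Inv.card_le_cap (hI : Inv r β Z cell own cnt Y H pat nb) (hZ : Z = 2 ^ e) {id j : ℕ}
    {f : ℕ → Finset ℕ} (hf : cell id = .bin f) (hj : j < r) (hs : H.slot j = id) :
    #(f j) ≤ cap Z #(pat j) := by
  have h1 := hI.content j hj
  rw [hs, hf] at h1
  change f j = pat j at h1
  rw [h1]
  rcases Nat.lt_or_ge Z #(pat j) with h2 | h2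
  · have := (hI.big j hj h2).1
    rw [hs, hf] at this
    cases this
  · exact (cap_of_le hZ h2).1

/-- The bookkeeping common to all cases of the operation. -/
theorem Inv.write (hI : Inv r β Z cell own cnt Y H pat nb) (hZ : Z = 2 ^ e)
    {j T : ℕ} {P : Finset ℕ} (hj : j < r) {c : Cell} {H' : Hdr} {nb' : ℕ}
    (hc : c.pat j = P) (hc' : ∀ i < r, i ≠ j → H.slot i = T → c.pat i = pat i)
    (hbig : Z < #P → c = .plain P ∧ ∀ i < r, i ≠ j → H.slot i ≠ T)
    (hsmall : #P ≤ Z → ∃ f, c = .bin f ∧ weight r Z (Function.update H.slot j T)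
      (Function.update pat j P) f T ≤ 2 * Z)
    (hothers : ∀ i < r, i ≠ j → H.slot i = T → #(pat i) ≤ Z)
    (hslot : H'.slot = Function.update H.slot j T)
    (hne : H'.ne = Function.update H.ne j (decide (P ≠ range β)))
    (hcnt : cnt ≤ cnt') (hTc : T < cnt') (hoT : own' T = Y)
    (hown : ∀ id, id ≠ T → own' id = own id)
    (hopnlt : H'.opn < cnt')
    (hopn : (H'.opn = 0 ∧ H'.fill = 2 * Z) ∨ (own' H'.opn = Y ∧
      ∃ f, Function.update cell T c H'.opn = .bin f ∧
      weight r Z (Function.update H.slot j T) (Function.update pat j P) f H'.opn ≤ H'.fill))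
    (hfill : H'.fill ≤ 2 * Z) (hT0 : T ≠ 0)
    (hcount : nb' * Z + H'.fill ≤ 2 * Z + 2 * ∑ i ∈ range r, cap Z #(Function.update pat j P i)) :
    Inv r β Z (Function.update cell T c) own' cnt' Y H' (Function.update pat j P) nb' := by
  constructor
  · intro i hi
    by_cases hij : i = j
    · subst hij; simp [hslot, hc]
    · rw [hslot, Function.update_of_ne hij, Function.update_of_ne hij]
      by_cases hT : H.slot i = T
      · rw [hT, Function.update_self]; exact hc' i hi hij hT
      · rw [Function.update_of_ne hT]; exact hI.content i hi
  · intro i hi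
    by_cases hij : i = j
    · subst hij; simp [hne]
    · rw [hne, Function.update_of_ne hij, Function.update_of_ne hij]; exact hI.ne i hi
  · intro i hi
    have hij : i ≠ j := by omega
    rw [hslot, hne, Function.update_of_ne hij, Function.update_of_ne hij]
    exact hI.beyond i hi
  · intro i
    by_cases hij : i = j
    · subst hij; simpa [hslot] using hTc
    · rw [hslot, Function.update_of_ne hij]; exact (hI.slot_lt i).trans_le hcnt
  · exact hopnlt
  · intro i hi
    by_cases hij : i = j
    · subst hij; right; simpa [hslot] using hoT
    · rw [hslot, Function.update_of_ne hij]
      by_cases hT : H.slot i = T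
      · right; rw [hT]; exact hoT
      · rw [hown _ hT]; exact hI.slot_own i hi
  · intro i hi hp
    by_cases hij : i = j
    · subst hij; simpa [hslot] using hT0
    · rw [Function.update_of_ne hij] at hp
      rw [hslot, Function.update_of_ne hij]; exact hI.slot_ne i hi hp
  · intro i hi hp
    by_cases hij : i = j
    · subst hij
      rw [Function.update_self] at hp ⊢
      obtain ⟨h1, h2⟩ := hbig hp
      refine ⟨by simp [hslot, h1], fun i' hi' h => ?_⟩
      by_contra hii
      rw [hslot, Function.update_of_ne hii, Function.update_self] at h
      exact h2 i' hi' hii h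
    · rw [Function.update_of_ne hij] at hp ⊢
      have hT : H.slot i ≠ T := fun h => by have := hothers i hi hij h; omega
      obtain ⟨h1, h2⟩ := hI.big i hi hp
      refine ⟨by rw [hslot, Function.update_of_ne hij, Function.update_of_ne hT, h1],
        fun i' hi' h => ?_⟩
      rw [hslot, Function.update_of_ne hij] at h
      by_cases hii : i' = j
      · subst hii; rw [Function.update_self] at h; exact absurd h.symm hT
      · rw [Function.update_of_ne hii] at h; exact h2 i' hi' h
  · intro i hi hp
    by_cases hij : i = j
    · subst hij
      rw [Function.update_self] at hp
      obtain ⟨f, hf, -⟩ := hsmall hp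
      exact ⟨f, by simp [hslot, hf]⟩
    · rw [Function.update_of_ne hij] at hp
      rw [hslot, Function.update_of_ne hij]
      by_cases hT : H.slot i = T
      · rw [hT, Function.update_self]
        have : #P ≤ Z := not_lt.1 fun h => (hbig h).2 i hi hij hT
        obtain ⟨f, hf, -⟩ := hsmall this
        exact ⟨f, hf⟩
      · rw [Function.update_of_ne hT]; exact hI.small i hi hp
  · intro id f ho hcf
    rw [hslot]
    by_cases hT : id = T
    · subst hT
      rw [Function.update_self] at hcf
      have : #P ≤ Z := not_lt.1 fun h => by rw [(hbig h).1] at hcf; cases hcf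
      obtain ⟨f', hf', hw⟩ := hsmall this
      rw [hf'] at hcf
      cases hcf
      exact hw
    · rw [Function.update_of_ne hT] at hcf
      rw [hown _ hT] at ho
      exact (weight_other hT fun hs => hI.card_le_cap hZ hcf hj hs).trans (hI.weight_le id f ho hcf)
  · rw [hslot]; exact hopn
  · exact hfill
  · exact hcount

/-- Writing the zeros `P` of block `j` into a cell with several blocks. -/
theorem valid_update (hZ : Z = 2 ^ e) {j T : ℕ} {slot : ℕ → ℕ} {f : ℕ → Finset ℕ} {P : Finset ℕ}
    (hf : Cell.Valid r β Z (.bin f)) (hj : j < r) (hP : P ⊆ range β) (hPZ : #P ≤ Z)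
    (hs : ∀ i < r, i ≠ j → slot i = T → #(pat i) ≤ Z ∧ f i = pat i)
    (hw : weight r Z (Function.update slot j T) (Function.update pat j P) (Function.update f j P) T ≤
      2 * Z) : Cell.Valid r β Z (.bin (Function.update f j P)) := by
  refine ⟨fun i => ?_, fun i hi => ?_, (sum_card_le_weight hZ fun i hi h => ?_).trans hw⟩
  · by_cases hij : i = j
    · subst hij; simpa using hP
    · rw [Function.update_of_ne hij]; exact hf.1 i
  · rw [Function.update_of_ne (by omega)]; exact hf.2.1 i hi
  · by_cases hij : i = j
    · subst hij; simpa using hPZ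
    · rw [Function.update_of_ne hij] at h
      rw [Function.update_of_ne hij, Function.update_of_ne hij]
      exact hs i hi hij h

/-- The block stays in its cell, moves to the open cell, opens a new shared cell, or gets a new cell
of its own. In a shared cell, only entries of blocks that reside there have to be correct; the
others are garbage bounded by `weight`. The count is preserved because the new capacity is at least
twice the old one. -/
theorem Inv.set (hI : Inv r β Z cell own cnt Y H pat nb) (hZ : Z = 2 ^ e)
    (hv : ∀ id < cnt, (cell id).Valid r β Z) (hcnt : 0 < cnt) (hY : Y ≠ 0) (h00 : own 0 = 0)
    {j o : ℕ} {P : Finset ℕ} (hj : j < r)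
    (ho : o ∉ pat j) (hP : P = insert o (pat j)) (hPβ : P ⊆ range β) :
    Inv r β Z (Function.update cell (H.tgt Z j P cnt) (tgtCell Z H cell cnt j P))
      (newOwn Z H own cnt Y j P) (if H.tgt Z j P cnt = cnt then cnt + 1 else cnt) Y
      (H.set β Z j P cnt) (Function.update pat j P)
      (if H.tgt Z j P cnt = cnt then nb + 1 else nb) ∧
    (tgtCell Z H cell cnt j P).Valid r β Z ∧ newOwn Z H own cnt Y j P (H.tgt Z j P cnt) = Y ∧
    H.tgt Z j P cnt ≤ cnt := by
  have hZ0 : 0 < Z := by rw [hZ]; positivity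
  have hPc : #P = #(pat j) + 1 := by rw [hP, card_insert_of_notMem ho]
  have hsum := sum_cap_update (Z := Z) hj pat P
  have hcount := hI.count
  have hfill := hI.fill_le
  have hfresh : ∀ i < r, i ≠ j → H.slot i ≠ cnt := fun i _ _ => (hI.slot_lt i).ne
  by_cases hA : cap Z #P = cap Z (#P - 1)
  · -- the block stays in its cell
    have hT : H.tgt Z j P cnt = H.slot j := if_pos hA
    have hTc : H.slot j ≠ cnt := (hI.slot_lt j).ne
    rw [hPc, Nat.add_sub_cancel] at hA
    have hne : pat j ≠ ∅ := fun h => by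
      rw [h, card_empty, cap_zero] at hA
      have := cap_pos (z := 0 + 1) hZ0 (by omega)
      omega
    have hs0 := hI.slot_ne j hj hne
    have hown : own (H.slot j) = Y := (hI.slot_own j hj).resolve_left hs0
    have hset : (H.set β Z j P cnt).opn = H.opn ∧ (H.set β Z j P cnt).fill = H.fill := by
      simp [Hdr.set, hPc, hA]
    have hslot : (H.set β Z j P cnt).slot = Function.update H.slot j (H.slot j) := by
      rw [Hdr.set, hT]
    rw [newOwn, tgtCell, hT, if_neg hTc, if_neg hTc, if_neg hTc, if_neg hTc]
    by_cases hb : Z < #P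
    -- The capacity jumps from `Z` to `2 * Z` between `Z` and `Z + 1` zeros; being unchanged here,
    -- it shows that the block had a cell of its own already.
    · have hz : Z < #(pat j) := by
        by_contra hz
        have hz : #(pat j) = Z := by omega
        rw [hz, cap_self hZ, cap_of_lt (by omega)] at hA
        omega
      obtain ⟨h1, h2⟩ := hI.big j hj hz
      have hc : (cell (H.slot j)).set Z j P = .plain P := if_pos hb
      rw [hc]
      refine ⟨hI.write hZ hj rfl (fun i hi hij h => absurd (h2 i hi h) hij)
        (fun _ => ⟨rfl, fun i hi hij h => hij (h2 i hi h)⟩) (fun h => by omega)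
        (fun i hi hij h => absurd (h2 i hi h) hij) hslot rfl le_rfl (hI.slot_lt j) hown
        (fun _ _ => rfl) (by rw [hset.1]; exact hI.opn_lt) ?_ (by rw [hset.2]; exact hfill) hs0 ?_,
        hPβ, hown, (hI.slot_lt j).le⟩
      · rw [hset.1, hset.2]
        refine hI.opn.imp_right fun ⟨a, f, hf, hw⟩ => ?_
        have hne : H.opn ≠ H.slot j := fun h => by rw [h, h1] at hf; cases hf
        exact ⟨a, f, by rw [Function.update_of_ne hne, hf],
          (weight_other hne fun hs => absurd hs.symm hne).trans hw⟩
      · rw [hset.2]; rw [hPc] at hsum; omega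
    · have hz : #(pat j) ≤ Z := by omega
      obtain ⟨f, hf⟩ := hI.small j hj hz
      have hc : (cell (H.slot j)).set Z j P = .bin (Function.update f j P) := by
        rw [hf, Cell.set_bin hb]
      have hw := weight_update (Z := Z) hj H.slot pat f (H.slot j) P
      rw [if_pos rfl, hPc, hA] at hw
      have hwle := hI.weight_le _ f hown hf
      have hoth : ∀ i < r, i ≠ j → H.slot i = H.slot j → #(pat i) ≤ Z ∧ f i = pat i := by
        intro i hi _ h
        have h1 := hI.content i hi
        rw [h, hf] at h1
        refine ⟨not_lt.1 fun hb => ?_, h1⟩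
        have := (hI.big i hi hb).1
        rw [h, hf] at this
        cases this
      rw [hc]
      refine ⟨hI.write hZ hj (by simp [Cell.pat]) (fun i hi hij h => ?_)
        (fun h => absurd h hb) (fun _ => ⟨_, rfl, by omega⟩)
        (fun i hi hij h => (hoth i hi hij h).1) hslot rfl le_rfl (hI.slot_lt j) hown
        (fun _ _ => rfl) (by rw [hset.1]; exact hI.opn_lt) ?_ (by rw [hset.2]; exact hfill) hs0 ?_,
        valid_update hZ (hf ▸ hv _ (hI.slot_lt j)) hj hPβ (by omega) hoth (by omega), hown,
        (hI.slot_lt j).le⟩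
      · rw [Cell.pat, Function.update_of_ne hij]; exact (hoth i hi hij h).2
      · rw [hset.1, hset.2]
        refine hI.opn.imp_right fun ⟨a, f', hf', hw'⟩ => ?_
        by_cases hne : H.opn = H.slot j
        · rw [hne, hf] at hf'
          cases hf'
          rw [hne] at hw'
          exact ⟨a, _, by rw [hne, Function.update_self], by rw [hne]; omega⟩
        · exact ⟨a, f', by rw [Function.update_of_ne hne, hf'],
            (weight_other hne fun hs => absurd hs.symm hne).trans hw'⟩
      · rw [hset.2]; rw [hPc] at hsum; omega
  have hA' : cap Z (#(pat j) + 1) ≠ cap Z #(pat j) := by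
    rw [hPc, Nat.add_sub_cancel] at hA; exact hA
  have h2cap := two_mul_cap_le hZ hA'
  have hcpos := cap_pos (z := #(pat j) + 1) hZ0 (by omega)
  rw [← hPc] at h2cap hcpos
  by_cases hB : cap Z #P ≤ Z ∧ H.fill + cap Z #P ≤ 2 * Z
  · -- the block moves to the open cell
    have hT : H.tgt Z j P cnt = H.opn := by rw [Hdr.tgt, if_neg hA, if_pos hB]
    have hTc : H.opn ≠ cnt := hI.opn_lt.ne
    have hPZ : #P ≤ Z := not_lt.1 fun h => by have := cap_of_lt h; omega
    obtain ⟨hown, f, hf, hw⟩ : own H.opn = Y ∧ ∃ f, cell H.opn = .bin f ∧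
        weight r Z H.slot pat f H.opn ≤ H.fill := hI.opn.resolve_left fun h => by omega
    have hs0 : H.opn ≠ 0 := fun h => hY (by rw [← hown, h, h00])
    have hset : (H.set β Z j P cnt).opn = H.opn ∧
        (H.set β Z j P cnt).fill = H.fill + cap Z #P := by
      simp only [Hdr.set]
      rw [if_neg (by omega), if_neg (by omega), if_pos hB.2]
      exact ⟨hT, rfl⟩
    have hslot : (H.set β Z j P cnt).slot = Function.update H.slot j H.opn := by
      rw [Hdr.set, hT]
    rw [newOwn, tgtCell, hT, if_neg hTc, if_neg hTc, if_neg hTc, if_neg hTc]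
    have hc : (cell H.opn).set Z j P = .bin (Function.update f j P) := by
      rw [hf, Cell.set_bin (by omega)]
    have hwu := weight_update (Z := Z) hj H.slot pat f H.opn P
    have hoth : ∀ i < r, i ≠ j → H.slot i = H.opn → #(pat i) ≤ Z ∧ f i = pat i := by
      intro i hi _ h
      have h1 := hI.content i hi
      rw [h, hf] at h1
      refine ⟨not_lt.1 fun hb => ?_, h1⟩
      have := (hI.big i hi hb).1
      rw [h, hf] at this
      cases this
    rw [hc]
    refine ⟨hI.write hZ hj (by simp [Cell.pat]) (fun i hi hij h => ?_)
      (fun h => by omega) (fun _ => ⟨_, rfl, by omega⟩)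
      (fun i hi hij h => (hoth i hi hij h).1) hslot rfl le_rfl hI.opn_lt hown
      (fun _ _ => rfl) (by rw [hset.1]; exact hI.opn_lt) ?_ (by rw [hset.2]; exact hB.2) hs0 ?_,
      valid_update hZ (hf ▸ hv _ hI.opn_lt) hj hPβ hPZ hoth (by omega), hown, hI.opn_lt.le⟩
    · rw [Cell.pat, Function.update_of_ne hij]; exact (hoth i hi hij h).2
    · rw [hset.1, hset.2]
      exact .inr ⟨hown, _, by rw [Function.update_self], by omega⟩
    · rw [hset.2]; omega
  have hT : H.tgt Z j P cnt = cnt := by rw [Hdr.tgt, if_neg hA, if_neg hB]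
  have hslot : (H.set β Z j P cnt).slot = Function.update H.slot j cnt := by
    rw [Hdr.set, hT]
  have hownne : ∀ id, id ≠ cnt → Function.update own cnt Y id = own id := fun id h =>
    Function.update_of_ne h _ _
  rw [newOwn, tgtCell, hT, if_pos rfl, if_pos rfl, if_pos rfl, if_pos rfl]
  by_cases hC : cap Z #P ≤ Z
  · -- a new cell for several blocks
    have hPZ : #P ≤ Z := not_lt.1 fun h => by have := cap_of_lt h; omega
    have hset : (H.set β Z j P cnt).opn = cnt ∧ (H.set β Z j P cnt).fill = cap Z #P := by
      simp only [Hdr.set]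
      rw [if_neg (by omega), if_neg (by omega), if_neg (by omega)]
      exact ⟨hT, rfl⟩
    have hc : Cell.blank.set Z j P = .bin (Function.update (fun _ => ∅) j P) := by
      rw [Cell.blank, Cell.set_bin (by omega)]
    have hwu := weight_update (Z := Z) hj H.slot pat (fun _ => ∅) cnt P
    have hw0 : weight r Z H.slot pat (fun _ => ∅) cnt = 0 :=
      sum_eq_zero fun i _ => by rw [if_neg (hI.slot_lt i).ne]; rfl
    rw [hc]
    refine ⟨hI.write hZ hj (by simp [Cell.pat]) (fun i hi hij h => absurd h (hfresh i hi hij))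
      (fun h => by omega) (fun _ => ⟨_, rfl, by omega⟩)
      (fun i hi hij h => absurd h (hfresh i hi hij)) hslot rfl (by omega) (by omega) (by simp)
      hownne (by omega) ?_ (by omega) (by omega) ?_,
      valid_update hZ (f := fun _ => ∅) ⟨by simp, by simp, by simp⟩ hj hPβ hPZ
        (fun i hi hij h => absurd h (hfresh i hi hij)) (by omega : weight r Z
          (Function.update H.slot j cnt) (Function.update pat j P) _ cnt ≤ 2 * Z), by simp, le_rfl⟩
    · rw [hset.1, hset.2]
      exact .inr ⟨by simp, _, by rw [Function.update_self], by omega⟩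
    -- The request did not fit, so the old `fill` exceeded `2 * Z - cap`, hence `Z`. This pays for
    -- one more cell; the growth of the capacity pays for the new `fill`.
    · rw [hset.2, add_mul]; omega
  · -- a new cell for this block alone
    have hPZ : Z < #P := not_le.1 fun h => hC (cap_of_le hZ h).2
    have hset : (H.set β Z j P cnt).opn = H.opn ∧ (H.set β Z j P cnt).fill = H.fill := by
      simp only [Hdr.set]
      rw [if_pos (by omega), if_pos (by omega)]
      exact ⟨rfl, rfl⟩
    have hc : Cell.blank.set Z j P = .plain P := if_pos hPZ
    have hcP := cap_of_lt hPZ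
    rw [hc]
    refine ⟨hI.write hZ hj rfl (fun i hi hij h => absurd h (hfresh i hi hij))
      (fun _ => ⟨rfl, hfresh⟩) (fun h => by omega)
      (fun i hi hij h => absurd h (hfresh i hi hij)) hslot rfl (by omega) (by omega) (by simp)
      hownne (by have := hI.opn_lt; omega) ?_ (by omega) (by omega) ?_, hPβ, by simp, le_rfl⟩
    · rw [hset.1, hset.2]
      have hne : H.opn ≠ cnt := hI.opn_lt.ne
      refine hI.opn.imp_right fun ⟨a, f, hf, hw⟩ => ⟨by rw [hownne _ hne, a], f, by
        rw [Function.update_of_ne hne, hf], (weight_other hne fun hs => ?_).trans hw⟩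
      exact hI.card_le_cap hZ hf hj hs
    -- The capacity at least doubles to reach `2 * Z`, so the right-hand side grows by at least `2 *
    -- Z`, more than the `Z` needed for the new cell.
    · rw [hset.2, add_mul]; omega

end

end Chunk

end

/-! ### Sizes, groups of chunks, and the allocation of cells and pages -/

section
open Finset
namespace ZeroReport
open Chunk Trie

/-- The sizes of the data structure, and the codes by which headers, cells and sets of zeros of a
block are stored in words. -/
structure Par where
  (n w S h r β Z e K Q b k m : ℕ)
  (encH : Hdr → ℕ) (decH : ℕ → Hdr) (encC : Cell → ℕ) (decC : ℕ → Cell)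
  (encP : Finset ℕ → ℕ) (decP : ℕ → Finset ℕ)
  hZ : Z = 2 ^ e
  r_pos : 0 < r
  β_pos : 0 < β
  K_pos : 0 < K
  K_dvd : K ∣ 2 ^ h
  -- Besides the chunks of positions there is room for two sentinel chunks, one at each end.
  fits : n + 2 * (r * β) ≤ 2 ^ h * (r * β)
  S_lt : S < 2 ^ w
  lt_Q : 16 < Q
  r_lt : r < Q
  β_lt : β < Q
  h_lt : h < Q
  KK_lt : K * K < Q
  -- Records for the nodes of the trie, the lookup table, and the pages of cells.
  space : 16 * 2 ^ (h + 1) + Q ^ 5 + (3 * 2 ^ h + 4 * m / Z) ≤ S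
  n_le : n ≤ 2 ^ w
  -- Then even a chunk full of zeros needs at most `K - 1` cells, so the cell numbers in a group of
  -- `K` chunks stay below `K * K`.
  K_ge : 3 + 4 * (r * β) / Z ≤ K
  b_ge : 2 ≤ b
  h_lt_pow : h < b ^ k
  encH_spec : ∀ H : Hdr, (∀ j, H.slot j < K * K) → (∀ j, r ≤ j → H.slot j = 0 ∧ H.ne j = false) →
    H.opn < K * K → H.fill ≤ 2 * Z → encH H < Q ∧ decH (encH H) = H
  encC_spec : ∀ c : Cell, c.Valid r β Z → encC c < Q ∧ decC (encC c) = c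
  -- Codes of sets are passed around increased by one, so that `0` is free to mean that nothing has
  -- to be done.
  encP_spec : ∀ P, P ⊆ range β → encP P + 1 < Q ∧ decP (encP P) = P

/-- The state of all chunks and cells. Chunks are named by the leaves of the trie; `K` consecutive
chunks form a group, which has its own sequence of `cnt` cells, on pages of `K` cells. -/
structure Ghost where
  H : ℕ → Hdr
  cell : ℕ → ℕ → Cell
  own : ℕ → ℕ → ℕ
  cnt : ℕ → ℕ
  nb : ℕ → ℕ
  pg : ℕ → ℕ → ℕ
  np : ℕ

variable (p : Par)

def Par.L : ℕ := p.r * p.β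

/-- The names of the groups. -/
def Par.Grp (s : ℕ) : Prop := 2 ^ p.h / p.K ≤ s ∧ s < 2 ^ (p.h + 1) / p.K

/-- The owner `0` means that a cell belongs to no chunk, as no chunk has the name `0`. The summand
`1` in `cnt_eq` is the shared cell number `0` of the group. A group has just the pages that its
`cnt` cells touch. -/
structure GInv (pat : ℕ → ℕ → Finset ℕ) (g : Ghost) : Prop where
  inv : ∀ Y, Leaf p.h Y → Inv p.r p.β p.Z (g.cell (Y / p.K)) (g.own (Y / p.K)) (g.cnt (Y / p.K)) Y
    (g.H Y) (pat Y) (g.nb Y)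
  valid : ∀ s id, id < g.cnt s → (g.cell s id).Valid p.r p.β p.Z
  own_zero : ∀ s, g.own s 0 = 0
  own_fresh : ∀ s id, g.cnt s ≤ id → g.own s id = 0
  cnt_eq : ∀ s, g.cnt s = 1 + ∑ Y ∈ Ico (s * p.K) (s * p.K + p.K), g.nb Y
  np_eq : g.np = ∑ s ∈ Ico (2 ^ p.h / p.K) (2 ^ (p.h + 1) / p.K), ((g.cnt s - 1) / p.K + 1)
  pg_lt : ∀ s, p.Grp s → ∀ i, i * p.K < g.cnt s → g.pg s i < g.np
  pg_inj : ∀ s s' i i', p.Grp s → p.Grp s' → i * p.K < g.cnt s → i' * p.K < g.cnt s' →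
    g.pg s i = g.pg s' i' → s = s' ∧ i = i'

variable {p} {pat : ℕ → ℕ → Finset ℕ} {g : Ghost}

theorem Par.S_le (p : Par) : p.S ≤ 2 ^ p.w := p.S_lt.le

theorem Par.Z_pos (p : Par) : 0 < p.Z := by rw [p.hZ]; positivity

theorem Par.grp {Y : ℕ} (hY : Leaf p.h Y) : p.Grp (Y / p.K) := by
  refine ⟨Nat.div_le_div_right hY.1, ?_⟩
  rw [Nat.div_lt_iff_lt_mul p.K_pos, Nat.div_mul_cancel (p.K_dvd.trans (pow_dvd_pow 2 (by omega)))]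
  exact hY.2

theorem Par.grp_bounds {s : ℕ} (hs : p.Grp s) : 2 ^ p.h ≤ s * p.K ∧ s * p.K + p.K ≤ 2 ^ (p.h + 1) := by
  have h1 := Nat.mul_le_mul_right p.K hs.1
  have h2 := Nat.mul_le_mul_right p.K (Nat.succ_le_of_lt hs.2)
  rw [Nat.div_mul_cancel p.K_dvd] at h1
  rw [Nat.div_mul_cancel (p.K_dvd.trans (pow_dvd_pow 2 (by omega))), Nat.succ_mul] at h2
  exact ⟨h1, h2⟩

theorem sum_Ico_blocks (f : ℕ → ℕ) (K a : ℕ) {t : ℕ} (ht : a ≤ t) :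
    ∑ s ∈ Ico a t, ∑ Y ∈ Ico (s * K) (s * K + K), f Y = ∑ Y ∈ Ico (a * K) (t * K), f Y := by
  induction t, ht using Nat.le_induction with
  | base => simp
  | succ t ht ih =>
    rw [sum_Ico_succ_top ht, ih, Nat.succ_mul]
    exact sum_Ico_consecutive f (Nat.mul_le_mul_right K ht) (Nat.le_add_right _ _)

namespace GInv

/-- The capacity is at most twice the number of zeros, so the amortised count bounds the cells by
the zeros. -/
theorem nb_mul_le (hG : GInv p pat g) {Y : ℕ} (hY : Leaf p.h Y) :
    g.nb Y * p.Z ≤ 2 * p.Z + 4 * ∑ j ∈ range p.r, #(pat Y j) := by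
  have h1 := (hG.inv Y hY).count
  have h2 : ∑ j ∈ range p.r, cap p.Z #(pat Y j) ≤ ∑ j ∈ range p.r, 2 * #(pat Y j) :=
    sum_le_sum fun j _ => cap_le_two_mul
  rw [← mul_sum] at h2
  omega

theorem cnt_pos (hG : GInv p pat g) (s : ℕ) : 0 < g.cnt s := by rw [hG.cnt_eq]; omega

theorem cnt_le (hG : GInv p pat g) (hpat : ∀ Y j, pat Y j ⊆ range p.β) {s : ℕ} (hs : p.Grp s) :
    g.cnt s ≤ p.K * p.K := by
  have hnb : ∀ Y ∈ Ico (s * p.K) (s * p.K + p.K), g.nb Y ≤ p.K - 1 := by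
    intro Y hY
    rw [mem_Ico] at hY
    obtain ⟨h1, h2⟩ := Par.grp_bounds hs
    have h3 := hG.nb_mul_le ⟨h1.trans hY.1, hY.2.trans_le h2⟩
    have h4 : ∑ j ∈ range p.r, #(pat Y j) ≤ p.r * p.β := by
      refine (sum_le_card_nsmul _ _ p.β fun j _ => ?_).trans (by simp)
      exact (card_le_card (hpat Y j)).trans (by simp)
    have h5 : g.nb Y ≤ (4 * (p.r * p.β) + p.Z * 2) / p.Z := by
      rw [Nat.le_div_iff_mul_le p.Z_pos]; omega
    rw [Nat.add_mul_div_left _ _ p.Z_pos] at h5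
    have := p.K_ge
    omega
  have h := sum_le_card_nsmul _ _ _ hnb
  rw [Nat.card_Ico, Nat.add_sub_cancel_left, smul_eq_mul] at h
  rw [hG.cnt_eq]
  obtain ⟨K', hK'⟩ := Nat.exists_eq_succ_of_ne_zero p.K_pos.ne'
  rw [hK'] at h ⊢
  simp only [Nat.succ_eq_add_one, Nat.add_sub_cancel] at h ⊢
  nlinarith

/-- Rounding up to whole pages wastes at most one page per group, that is one cell per chunk. The
cells themselves number at most two per chunk plus `4 * m / Z`. -/
theorem np_le (hG : GInv p pat g) {m : ℕ}
    (hm : ∑ Y ∈ Ico (2 ^ p.h) (2 ^ (p.h + 1)), ∑ j ∈ range p.r, #(pat Y j) ≤ m) :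
    p.K * g.np ≤ 3 * 2 ^ p.h + 4 * m / p.Z := by
  have hK : 2 ^ p.h / p.K ≤ 2 ^ (p.h + 1) / p.K := Nat.div_le_div_right (by rw [pow_succ]; omega)
  have e1 : 2 ^ p.h / p.K * p.K = 2 ^ p.h := Nat.div_mul_cancel p.K_dvd
  have e2 : 2 ^ (p.h + 1) / p.K * p.K = 2 ^ (p.h + 1) :=
    Nat.div_mul_cancel (p.K_dvd.trans (pow_dvd_pow 2 (by omega)))
  have h1 : p.K * g.np ≤ ∑ s ∈ Ico (2 ^ p.h / p.K) (2 ^ (p.h + 1) / p.K),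
      (∑ Y ∈ Ico (s * p.K) (s * p.K + p.K), g.nb Y + p.K) := by
    rw [hG.np_eq, mul_sum]
    refine sum_le_sum fun s _ => ?_
    rw [hG.cnt_eq, Nat.add_sub_cancel_left, mul_add, mul_one]
    exact Nat.add_le_add_right (Nat.mul_div_le _ _) _
  rw [sum_add_distrib, sum_Ico_blocks _ _ _ hK, e1, e2, sum_const, Nat.card_Ico, smul_eq_mul,
    Nat.sub_mul, e1, e2] at h1
  have h2 : (∑ Y ∈ Ico (2 ^ p.h) (2 ^ (p.h + 1)), g.nb Y) * p.Z ≤ p.Z * (2 * 2 ^ p.h) + 4 * m := by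
    calc _ = ∑ Y ∈ Ico (2 ^ p.h) (2 ^ (p.h + 1)), g.nb Y * p.Z := sum_mul ..
      _ ≤ ∑ Y ∈ Ico (2 ^ p.h) (2 ^ (p.h + 1)), (2 * p.Z + 4 * ∑ j ∈ range p.r, #(pat Y j)) :=
        sum_le_sum fun Y hY => hG.nb_mul_le (by rw [mem_Ico] at hY; exact hY)
      _ = 2 ^ p.h * (2 * p.Z) +
          4 * ∑ Y ∈ Ico (2 ^ p.h) (2 ^ (p.h + 1)), ∑ j ∈ range p.r, #(pat Y j) := by
        rw [sum_add_distrib, sum_const, Nat.card_Ico, smul_eq_mul, ← mul_sum]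
        congr 2
        rw [pow_succ]; omega
      _ ≤ _ := by
        have := Nat.mul_le_mul_left 4 hm
        linarith
  rw [← Nat.le_div_iff_mul_le p.Z_pos, Nat.mul_add_div p.Z_pos] at h2
  rw [pow_succ] at h1 h2
  omega

end GInv

/-- The state after block `j` of chunk `Y` has got the set of zeros `P` with one more element. -/
def Ghost.set (p : Par) (g : Ghost) (Y j : ℕ) (P : Finset ℕ) : Ghost :=
  let s := Y / p.K
  let cnt := g.cnt s
  let T := (g.H Y).tgt p.Z j P cnt
  { H := Function.update g.H Y ((g.H Y).set p.β p.Z j P cnt)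
    cell := Function.update g.cell s
      (Function.update (g.cell s) T (tgtCell p.Z (g.H Y) (g.cell s) cnt j P))
    own := Function.update g.own s (newOwn p.Z (g.H Y) (g.own s) cnt Y j P)
    cnt := Function.update g.cnt s (if T = cnt then cnt + 1 else cnt)
    nb := Function.update g.nb Y (if T = cnt then g.nb Y + 1 else g.nb Y)
    pg := if T = cnt ∧ p.K ∣ cnt then
      Function.update g.pg s (Function.update (g.pg s) (cnt / p.K) g.np) else g.pg
    np := if T = cnt ∧ p.K ∣ cnt then g.np + 1 else g.np }

/-- The target cell was owned by chunk `Y` or is fresh, so the other chunks of the group are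
unharmed by `Inv.frame`. A page is added exactly when the number of the fresh cell is a multiple of
`K`, and it takes the first unused page number, which keeps the pages disjoint. -/
theorem GInv.set (hG : GInv p pat g) {Y j o : ℕ} {P : Finset ℕ} (hY : Leaf p.h Y) (hj : j < p.r)
    (ho : o ∉ pat Y j) (hP : P = insert o (pat Y j)) (hPβ : P ⊆ range p.β) :
    GInv p (Function.update pat Y (Function.update (pat Y) j P)) (g.set p Y j P) := by
  have hY0 : Y ≠ 0 := by have := hY.1; have : 0 < 2 ^ p.h := by positivity
                         omega
  obtain ⟨h1, h2, h3, h4⟩ := (hG.inv Y hY).set p.hZ (hG.valid _) (hG.cnt_pos _) hY0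
    (hG.own_zero _) hj ho hP hPβ
  have hcnt := hG.cnt_pos (Y / p.K)
  have hgrp := Par.grp hY
  have hYIco : Y ∈ Ico (Y / p.K * p.K) (Y / p.K * p.K + p.K) := by
    have := Nat.div_add_mod' Y p.K
    have := Nat.mod_lt Y p.K_pos
    rw [mem_Ico]; omega
  have hT0 : (g.H Y).tgt p.Z j P (g.cnt (Y / p.K)) ≠ 0 := fun h => by
    have hh := h3
    rw [newOwn, h, if_neg hcnt.ne, hG.own_zero] at hh
    exact hY0 hh.symm
  have hownT : (g.H Y).tgt p.Z j P (g.cnt (Y / p.K)) ≠ g.cnt (Y / p.K) →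
      g.own (Y / p.K) ((g.H Y).tgt p.Z j P (g.cnt (Y / p.K))) = Y := fun h => by
    rw [newOwn, if_neg h] at h3; exact h3
  set s := Y / p.K with hs
  set T := (g.H Y).tgt p.Z j P (g.cnt s) with hT
  have hfreshT : ∀ Y', Y' ≠ Y → Y' ≠ 0 → g.own s T ≠ Y' := fun Y' hY' hY'0 h => by
    by_cases hTc : T = g.cnt s
    · rw [hTc, hG.own_fresh s _ le_rfl] at h; exact hY'0 h.symm
    · exact hY' (h.symm.trans (hownT hTc))
  refine ⟨fun Y' hY' => ?_, fun s' id hid => ?_, fun s' => ?_, fun s' id hid => ?_, fun s' => ?_, ?_,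
    ?_, ?_⟩
  · simp only [Ghost.set, ← hs, ← hT]
    by_cases hYY : Y' = Y
    · subst hYY
      simp only [Function.update_self, ← hs]
      exact h1
    · rw [Function.update_of_ne hYY, Function.update_of_ne hYY, Function.update_of_ne hYY]
      have hY'0 : Y' ≠ 0 := by have := hY'.1; have : 0 < 2 ^ p.h := by positivity
                               omega
      by_cases hss : Y' / p.K = s
      · rw [hss, Function.update_self, Function.update_self, Function.update_self]
        have hinv := hG.inv Y' hY'
        rw [hss] at hinv
        refine hinv.frame ?_ (fun id hid => ?_) (fun id hid => ?_) ?_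
        · exact Function.update_of_ne hT0.symm _ _
        · have hne : id ≠ T := fun h => hfreshT Y' hYY hY'0 (h ▸ hid)
          refine ⟨Function.update_of_ne hne _ _, ?_⟩
          rw [newOwn]
          split_ifs with hc
          · rw [Function.update_of_ne (by rw [← hc]; exact hne)]; exact hid
          · exact hid
        · rw [newOwn] at hid
          split_ifs at hid with hc
          · by_cases h : id = g.cnt s
            · rw [h, Function.update_self] at hid; exact absurd hid.symm hYY
            · rwa [Function.update_of_ne h] at hid
          · exact hid
        · split_ifs <;> omega
      · rw [Function.update_of_ne hss, Function.update_of_ne hss, Function.update_of_ne hss]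
        exact hG.inv Y' hY'
  · simp only [Ghost.set, ← hs, ← hT] at hid ⊢
    by_cases hss : s' = s
    · subst hss
      rw [Function.update_self] at hid ⊢
      by_cases hidT : id = T
      · rw [hidT, Function.update_self]; exact h2
      · rw [Function.update_of_ne hidT]
        exact hG.valid _ _ (by split_ifs at hid <;> omega)
    · rw [Function.update_of_ne hss] at hid ⊢
      exact hG.valid _ _ hid
  · simp only [Ghost.set, ← hs, ← hT]
    by_cases hss : s' = s
    · subst hss
      rw [Function.update_self, newOwn]
      split_ifs
      · rw [Function.update_of_ne hcnt.ne]; exact hG.own_zero _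
      · exact hG.own_zero _
    · rw [Function.update_of_ne hss]; exact hG.own_zero _
  · simp only [Ghost.set, ← hs, ← hT] at hid ⊢
    by_cases hss : s' = s
    · subst hss
      rw [Function.update_self] at hid ⊢
      rw [newOwn, ← hT]
      split_ifs at hid ⊢ with hc
      · rw [Function.update_of_ne (by omega)]; exact hG.own_fresh _ _ (by omega)
      · exact hG.own_fresh _ _ hid
    · rw [Function.update_of_ne hss] at hid ⊢
      exact hG.own_fresh _ _ hid
  · simp only [Ghost.set, ← hs, ← hT]
    by_cases hss : s' = s
    · subst hss
      rw [Function.update_self]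
      split_ifs with hc
      · rw [← add_sum_erase _ _ hYIco, Function.update_self,
          sum_congr rfl fun i hi => Function.update_of_ne (ne_of_mem_erase hi) _ _]
        have := hG.cnt_eq s
        rw [← add_sum_erase _ _ hYIco] at this
        omega
      · rw [Function.update_eq_self]; exact hG.cnt_eq _
    · rw [Function.update_of_ne hss, hG.cnt_eq]
      congr 1
      refine sum_congr rfl fun i hi => ?_
      rw [Function.update_of_ne]
      rintro rfl
      refine hss ?_
      rw [mem_Ico] at hi
      exact (Nat.div_eq_of_lt_le hi.1 (by rw [Nat.succ_mul]; exact hi.2)).symm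
  · simp only [Ghost.set, ← hs, ← hT]
    have hmem : s ∈ Ico (2 ^ p.h / p.K) (2 ^ (p.h + 1) / p.K) := mem_Ico.2 hgrp
    rw [← add_sum_erase _ _ hmem, Function.update_self,
      sum_congr rfl fun i hi => by rw [Function.update_of_ne (ne_of_mem_erase hi)]]
    have h := hG.np_eq
    rw [← add_sum_erase _ _ hmem] at h
    obtain ⟨c, hc⟩ := Nat.exists_eq_succ_of_ne_zero hcnt.ne'
    rw [hc] at h ⊢
    simp only [Nat.succ_eq_add_one, Nat.add_sub_cancel] at h ⊢
    have hd := Nat.succ_div (a := c) (b := p.K)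
    by_cases hTc : T = c + 1
    · rw [if_pos hTc, Nat.add_sub_cancel]
      by_cases hk : p.K ∣ c + 1
      · rw [if_pos ⟨hTc, hk⟩]; rw [if_pos hk] at hd; omega
      · rw [if_neg fun hh => hk hh.2]; rw [if_neg hk] at hd; omega
    · rw [if_neg hTc, if_neg fun hh => hTc hh.1, Nat.add_sub_cancel]; omega
  all_goals
    -- An entry of the page tables that is in use afterwards is either the page just allocated or an
    -- old entry that was already in use.
    have key : ∀ s' i, (i * p.K < Function.update g.cnt s (if T = g.cnt s then g.cnt s + 1 else g.cnt s) s') →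
        ((g.set p Y j P).pg s' i = g.np ∧ s' = s ∧ i = g.cnt s / p.K ∧ (g.set p Y j P).np = g.np + 1) ∨
        ((g.set p Y j P).pg s' i = g.pg s' i ∧ i * p.K < g.cnt s') := by
      intro s' i hi
      simp only [Ghost.set, ← hs, ← hT]
      by_cases hss : s' = s
      · subst hss
        rw [Function.update_self] at hi
        by_cases hTc : T = g.cnt s
        · rw [if_pos hTc] at hi
          by_cases hk : p.K ∣ g.cnt s
          · rw [if_pos ⟨hTc, hk⟩, if_pos ⟨hTc, hk⟩, Function.update_self]
            by_cases hi' : i = g.cnt s / p.K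
            · left; rw [hi', Function.update_self]; exact ⟨rfl, rfl, rfl, rfl⟩
            · right
              rw [Function.update_of_ne hi']
              refine ⟨rfl, lt_of_le_of_ne (by omega) fun hh => hi' ?_⟩
              rw [← hh, Nat.mul_div_cancel _ p.K_pos]
          · right
            rw [if_neg fun hh => hk hh.2]
            exact ⟨rfl, lt_of_le_of_ne (by omega) fun hh => hk ⟨i, by rw [← hh, mul_comm]⟩⟩
        · rw [if_neg hTc] at hi
          right; rw [if_neg fun hh => hTc hh.1]; exact ⟨rfl, hi⟩
      · rw [Function.update_of_ne hss] at hi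
        right
        refine ⟨?_, hi⟩
        split_ifs
        · rw [Function.update_of_ne hss]
        · rfl
    have hnp : g.np ≤ (g.set p Y j P).np := by simp only [Ghost.set]; split_ifs <;> omega
  · intro s' hs' i hi
    rcases key s' i hi with ⟨e, -, -, e'⟩ | ⟨e, hlt⟩
    · rw [e, e']; omega
    · rw [e]; exact (hG.pg_lt s' hs' i hlt).trans_le hnp
  · intro s₁ s₂ i₁ i₂ hs₁ hs₂ hi₁ hi₂ he
    rcases key s₁ i₁ hi₁ with ⟨e₁, a₁, b₁, -⟩ | ⟨e₁, l₁⟩ <;>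
      rcases key s₂ i₂ hi₂ with ⟨e₂, a₂, b₂, -⟩ | ⟨e₂, l₂⟩
    · exact ⟨a₁.trans a₂.symm, b₁.trans b₂.symm⟩
    · have := hG.pg_lt s₂ hs₂ i₂ l₂
      rw [e₁, e₂] at he; omega
    · have := hG.pg_lt s₁ hs₁ i₁ l₁
      rw [e₁, e₂] at he; omega
    · exact hG.pg_inj _ _ _ _ hs₁ hs₂ l₁ l₂ (e₁ ▸ e₂ ▸ he)

end ZeroReport

end

section
open Finset
namespace ZeroReport
open Chunk Trie WordRAM BitVector

/-! ### The layout of the memory -/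

/-- The value is `β` if there is no one in the block from offset `o ≤ β` on. -/
noncomputable def nextOne (β : ℕ) (P : Finset ℕ) (o : ℕ) : ℕ := sInf {x | o ≤ x ∧ (x ∈ P → β ≤ x)}

/-- The value is `r` if there is no later block with a one, for `j < r`. -/
noncomputable def nextNE (r : ℕ) (H : Hdr) (j : ℕ) : ℕ := sInf {x | j < x ∧ (x < r → H.ne x = true)}

/-- The functions that are tabulated; the first argument selects one of them. -/
noncomputable def Par.F (p : Par) (op a b c d : ℕ) : ℕ :=
  match op with
  | 0 => (p.decH a).slot b
  -- Block number `r` is met at the end of a chunk; offset `0` then keeps the position at the end.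
  | 1 => if b < p.r then nextOne p.β ((p.decC a).pat b) c else 0
  | 2 => nextNE p.r (p.decH a) b
  | 3 => if ∃ x, x < p.r ∧ (p.decH a).ne x = true then 1 else 0
  -- The value `0` signals that the bit is zero already.
  | 4 => if c ∈ (p.decC a).pat b then 0 else p.encP (insert c ((p.decC a).pat b)) + 1
  | 5 => (p.decH a).tgt p.Z b (p.decP (c - 1)) d
  | 6 => p.encC ((p.decC a).set p.Z b (p.decP (c - 1)))
  | 7 => p.encC (Cell.blank.set p.Z a (p.decP (b - 1)))
  | 8 => p.encH ((p.decH a).set p.β p.Z b (p.decP (c - 1)) d)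
  | 9 => down p.b p.k a
  | 10 => up p.b p.k a
  | _ => 0

/-- The number of records; record `x` consists of the words `16 * x, …, 16 * x + 15`. -/
def Par.D (p : Par) : ℕ := 2 ^ (p.h + 1)

def Par.Y₀ (p : Par) : ℕ := 2 ^ p.h + 1

/-- The start of the table and that of the pages. -/
def Par.TB (p : Par) : ℕ := 16 * p.D
def Par.HB (p : Par) : ℕ := p.TB + p.Q ^ 5

def Par.tabIdx (p : Par) (op a b c d : ℕ) : ℕ := (((op * p.Q + a) * p.Q + b) * p.Q + c) * p.Q + d

/-- The nodes of the trie are numbered from `1`, so the words of record `0` are free for the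
parameters. The reduction modulo `2 ^ w` concerns only table entries that are never used, such as
those for arguments that are not codes. -/
structure Stat (p : Par) (m : ℕ → ℕ) : Prop where
  L : m 0 = p.L
  β : m 1 = p.β
  K : m 2 = p.K
  Q : m 3 = p.Q
  TB : m 4 = p.TB
  Y₀ : m 7 = p.Y₀
  tab : ∀ op a b c d, op < p.Q → a < p.Q → b < p.Q → c < p.Q → d < p.Q →
    m (p.TB + p.tabIdx op a b c d) = p.F op a b c d % 2 ^ p.w
  bl : ∀ x < p.D, m (16 * x + 5) = Nat.size x - 1

/-- The addresses of the words that change. -/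
def Par.Wr (p : Par) (a : ℕ) : Prop :=
  a = 6 ∨ (∃ x f, 1 ≤ x ∧ x < p.D ∧ f < 16 ∧ f ≠ 5 ∧ a = 16 * x + f) ∨ p.HB ≤ a

variable {p : Par} {s : NState}

theorem Par.D_pos (p : Par) : 0 < p.D := by unfold Par.D; positivity

theorem Par.tabIdx_lt {op a b c d : ℕ} (h0 : op < p.Q) (ha : a < p.Q) (hb : b < p.Q)
    (hc : c < p.Q) (hd : d < p.Q) : p.tabIdx op a b c d < p.Q ^ 5 := by
  have key : ∀ {x y N : ℕ}, x < N → y < p.Q → x * p.Q + y < N * p.Q := fun {x y N} hx hy => by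
    have := Nat.mul_le_mul_right p.Q (Nat.succ_le_of_lt hx)
    rw [Nat.succ_mul] at this
    omega
  have := key (key (key (key h0 ha) hb) hc) hd
  calc _ < _ := this
    _ = p.Q ^ 5 := by ring

theorem Stat.congr {m m' : ℕ → ℕ} (hm : Stat p m) (h : ∀ a, ¬ p.Wr a → m' a = m a) :
    Stat p m' := by
  have hD := p.D_pos
  have small : ∀ a, a < 16 → a ≠ 6 → m' a = m a := fun a ha ha' => h a fun hw => by
    rcases hw with hw | ⟨x, f, hx⟩ | hw
    · exact ha' hw
    · omega
    · unfold Par.HB Par.TB at hw; omega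
  refine ⟨?_, ?_, ?_, ?_, ?_, ?_, fun op a b c d h0 ha hb hc hd => ?_, fun x hx => ?_⟩
  · rw [small 0 (by omega) (by omega)]; exact hm.L
  · rw [small 1 (by omega) (by omega)]; exact hm.β
  · rw [small 2 (by omega) (by omega)]; exact hm.K
  · rw [small 3 (by omega) (by omega)]; exact hm.Q
  · rw [small 4 (by omega) (by omega)]; exact hm.TB
  · rw [small 7 (by omega) (by omega)]; exact hm.Y₀
  · rw [h _ fun hw => ?_]
    · exact hm.tab op a b c d h0 ha hb hc hd
    · have := Par.tabIdx_lt h0 ha hb hc hd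
      unfold Par.Wr Par.HB at hw
      rcases hw with hw | ⟨x, f, h1, h2, h3, h4, h5⟩ | hw
      · unfold Par.TB at hw; omega
      · unfold Par.TB at h5; omega
      · omega
  · rw [h _ fun hw => ?_]
    · exact hm.bl x hx
    · unfold Par.Wr Par.HB Par.TB at hw
      rcases hw with hw | ⟨x, f, h1, h2, h3, h4, h5⟩ | hw
      · omega
      · omega
      · omega

/-! ### Expressions for reading the memory -/

def par (i : ℕ) : Ex := .ld (.k i)

def fldE (f : ℕ) (e : Ex) : Ex := .ld (e * .k 16 + .k f)

def tabE (op : ℕ) (a b c d : Ex) : Ex :=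
  .ld (par 4 + ((((.k op * par 3 + a) * par 3 + b) * par 3 + c) * par 3 + d))

/-- The space for pages. -/
def Par.HS (p : Par) : ℕ := 3 * 2 ^ p.h + 4 * p.m / p.Z

theorem Par.space' (p : Par) : p.HB + p.HS ≤ p.S := p.space

theorem Par.Q_le (p : Par) : p.Q ≤ p.Q ^ 5 := Nat.le_self_pow (by omega) _

theorem Par.lit {c : ℕ} (hc : c ≤ 16) : c < 2 ^ p.w := by
  have := p.space'
  have := p.S_le
  have := p.Q_le
  have := p.lt_Q
  unfold Par.HB at *
  omega

theorem Ev.par {i : ℕ} (hi : i < 16) : Ev p.w p.S s (par i) (s.mem i) := by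
  refine .ld (.k (Par.lit (by omega))) ?_
  have := p.space'
  have := p.Q_le
  have := p.lt_Q
  unfold Par.HB at *
  omega

theorem Par.fld_lt {x f : ℕ} (hx : x < p.D) (hf : f < 16) : 16 * x + f < p.S := by
  have := p.space'
  unfold Par.HB Par.TB at this
  omega

theorem Ev.fld_addr {e : Ex} {x f : ℕ} (he : Ev p.w p.S s e x) (hx : x < p.D) (hf : f < 16) :
    Ev p.w p.S s (e * .k 16 + .k f) (16 * x + f) := by
  have := Par.fld_lt hx hf
  have := p.S_le
  rw [mul_comm 16]
  exact .add (.mul he (.k (Par.lit le_rfl)) (by omega)) (.k (Par.lit (by omega))) (by omega)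

theorem Ev.fld {e : Ex} {x f : ℕ} (he : Ev p.w p.S s e x) (hx : x < p.D) (hf : f < 16) :
    Ev p.w p.S s (fldE f e) (s.mem (16 * x + f)) :=
  .ld (Ev.fld_addr he hx hf) (Par.fld_lt hx hf)

/-- The index is evaluated by Horner's rule, and each intermediate value is at most the index
itself, which is below `Q ^ 5`; hence there is no overflow. -/
theorem Ev.tab (hs : Stat p s.mem) {op : ℕ} {ea eb ec ed : Ex} {a b c d x : ℕ}
    (hop : op ≤ 16) (hea : Ev p.w p.S s ea a) (heb : Ev p.w p.S s eb b) (hec : Ev p.w p.S s ec c)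
    (hed : Ev p.w p.S s ed d) (ha : a < p.Q) (hb : b < p.Q) (hc : c < p.Q) (hd : d < p.Q)
    (hF : p.F op a b c d = x) (hx : x < 2 ^ p.w) : Ev p.w p.S s (tabE op ea eb ec ed) x := by
  have h1 : Ev p.w p.S s (ZeroReport.par 3) p.Q := hs.Q ▸ Ev.par (by omega)
  have h2 : Ev p.w p.S s (ZeroReport.par 4) p.TB := hs.TB ▸ Ev.par (by omega)
  have hQ := p.lt_Q
  have hidx := Par.tabIdx_lt (by omega : op < p.Q) ha hb hc hd
  have hsp := p.space'
  have hS := p.S_le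
  have hop' := Par.lit (p := p) hop
  unfold Par.HB at hsp
  have hlt : ∀ y, y ≤ p.tabIdx op a b c d → y < 2 ^ p.w := fun y hy => by omega
  have hmono : ∀ y z : ℕ, y ≤ y * p.Q + z := fun y z =>
    (Nat.le_mul_of_pos_right y (by omega)).trans (Nat.le_add_right _ _)
  have m1 : (((op * p.Q + a) * p.Q + b) * p.Q + c) ≤ p.tabIdx op a b c d := hmono _ _
  have m2 : ((op * p.Q + a) * p.Q + b) ≤ p.tabIdx op a b c d := (hmono _ _).trans m1
  have m3 : (op * p.Q + a) ≤ p.tabIdx op a b c d := (hmono _ _).trans m2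
  have m1' : (((op * p.Q + a) * p.Q + b) * p.Q + c) * p.Q ≤ p.tabIdx op a b c d :=
    Nat.le_add_right _ _
  have e5 := (((((Ev.k hop').mul h1 (hlt _ ((Nat.le_add_right _ _).trans m3))).add hea
    (hlt _ m3)).mul h1 (hlt _ ((Nat.le_add_right _ _).trans m2))).add heb
    (hlt _ m2)).mul h1 (hlt _ ((Nat.le_add_right _ _).trans m1)) |>.add hec (hlt _ m1) |>.mul h1
    (hlt _ m1') |>.add hed (hlt _ le_rfl)
  have h := Ev.ld (h2.add e5 (by unfold Par.tabIdx at hidx; omega))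
    (by unfold Par.tabIdx at hidx; omega)
  have hm := hs.tab op a b c d (by omega) ha hb hc hd
  rw [hF, Nat.mod_eq_of_lt hx] at hm
  unfold Par.tabIdx at hm
  rw [hm] at h
  exact h

/-! ### Bit vectors and chunks -/

variable {B : Fin p.n → Bool}

/-- Positions from `n` on count as ones, so they are never stored as zeros and the last chunk is
never removed. -/
def one (p : Par) (B : Fin p.n → Bool) (x : ℕ) : Prop := ∀ h : x < p.n, B ⟨x, h⟩ = true

/-- The position of the first bit of chunk `Y`. -/
def Par.pos (p : Par) (Y : ℕ) : ℕ := (Y - p.Y₀) * p.L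

open Classical in
/-- The zeros of block `j` of chunk `Y`. -/
noncomputable def pat (p : Par) (B : Fin p.n → Bool) (Y j : ℕ) : Finset ℕ :=
  -- The chunk before the first position has no zeros; it is a sentinel.
  (range p.β).filter fun o => p.Y₀ ≤ Y ∧ ¬ one p B (p.pos Y + (j * p.β + o))

open Classical in
/-- The ones at the positions from `a` to `b - 1`. -/
noncomputable def ones (p : Par) (B : Fin p.n → Bool) (a b : ℕ) : Multiset ℕ :=
  ((Ico a b).filter (one p B)).val

theorem pat_subset (B : Fin p.n → Bool) (Y j : ℕ) : pat p B Y j ⊆ range p.β := by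
  classical exact filter_subset _ _

theorem mem_pat {Y j o : ℕ} :
    o ∈ pat p B Y j ↔ o < p.β ∧ p.Y₀ ≤ Y ∧ ¬ one p B (p.pos Y + (j * p.β + o)) := by
  simp [pat]

theorem ones_append {a b c : ℕ} (hab : a ≤ b) (hbc : b ≤ c) :
    ones p B a c = ones p B a b + ones p B b c := by
  classical
  unfold ones
  rw [← Ico_union_Ico_eq_Ico hab hbc, filter_union, ← disjUnion_eq_union]
  · rfl
  · exact (Ico_disjoint_Ico_consecutive a b c).mono (filter_subset _ _) (filter_subset _ _)

theorem ones_eq_zero {a b : ℕ} (h : ∀ x, a ≤ x → x < b → ¬ one p B x) : ones p B a b = 0 := by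
  classical
  unfold ones
  rw [filter_eq_empty_iff.2 fun x hx => h x (mem_Ico.1 hx).1 (mem_Ico.1 hx).2]
  rfl

theorem ones_eq_cons {a x b : ℕ} (hax : a ≤ x) (hxb : x < b) (hx : one p B x)
    (h : ∀ y, a ≤ y → y < x → ¬ one p B y) : ones p B a b = {x} + ones p B (x + 1) b := by
  classical
  rw [ones_append hax hxb.le, ones_append (Nat.le_succ x) hxb, ones_eq_zero h, zero_add]
  congr 1
  unfold ones
  rw [Nat.Ico_succ_singleton, filter_singleton, if_pos hx]
  rfl

theorem Par.L_pos (p : Par) : 0 < p.L := Nat.mul_pos p.r_pos p.β_pos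

/-- The set of chunks with a one. -/
def Alive (p : Par) (B : Fin p.n → Bool) : Set ℕ :=
  {Y | Leaf p.h Y ∧ ∃ j < p.r, pat p B Y j ≠ range p.β}

theorem pat_ne_iff {Y j : ℕ} :
    pat p B Y j ≠ range p.β ↔ ∃ o < p.β, o ∉ pat p B Y j := by
  constructor
  · intro h
    by_contra! hh
    exact h (Subset.antisymm (pat_subset B Y j) fun o ho => hh o (mem_range.1 ho))
  · rintro ⟨o, ho, hn⟩ h
    exact hn (h ▸ mem_range.2 ho)

theorem not_mem_pat_iff {Y j o : ℕ} (hY : p.Y₀ ≤ Y) (ho : o < p.β) :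
    o ∉ pat p B Y j ↔ one p B (p.pos Y + (j * p.β + o)) := by
  rw [mem_pat]; tauto

theorem ones_of_not_alive {Y : ℕ} (hY : Leaf p.h Y) (hY₀ : p.Y₀ ≤ Y) (h : Y ∉ Alive p B) :
    ones p B (p.pos Y) (p.pos (Y + 1)) = 0 := by
  refine ones_eq_zero fun x hx hx' h1 => h ⟨hY, (x - p.pos Y) / p.β, ?_, pat_ne_iff.2
    ⟨(x - p.pos Y) % p.β, Nat.mod_lt _ p.β_pos, ?_⟩⟩
  · rw [Nat.div_lt_iff_lt_mul p.β_pos]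
    unfold Par.pos at *
    rw [Nat.sub_add_comm hY₀, Nat.succ_mul] at hx'
    change _ < p.L
    omega
  · rw [not_mem_pat_iff hY₀ (Nat.mod_lt _ p.β_pos), Nat.div_add_mod', Nat.add_sub_cancel' hx]
    exact h1

/-- The constant cost of visiting a chunk can thus be charged to the ones that it contains. -/
theorem card_ones_pos {Y : ℕ} (hY₀ : p.Y₀ ≤ Y) (h : Y ∈ Alive p B) :
    1 ≤ (ones p B (p.pos Y) (p.pos (Y + 1))).card := by
  classical
  obtain ⟨hY, j, hj, hp⟩ := h
  obtain ⟨o, ho, hn⟩ := pat_ne_iff.1 hp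
  rw [not_mem_pat_iff hY₀ ho] at hn
  unfold ones
  refine card_pos.2 ⟨_, mem_filter.2 ⟨mem_Ico.2 ⟨Nat.le_add_right _ _, ?_⟩, hn⟩⟩
  have : j * p.β + o < p.L := by
    have := Nat.mul_le_mul_right p.β (Nat.succ_le_of_lt hj)
    rw [Nat.succ_mul] at this
    unfold Par.L; omega
  unfold Par.pos
  rw [Nat.sub_add_comm hY₀, Nat.succ_mul]
  omega

theorem one_update {i : Fin p.n} {x : ℕ} :
    one p (Function.update B i false) x ↔ one p B x ∧ x ≠ i := by
  unfold one
  constructor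
  · intro h
    have hne : x ≠ i := by
      rintro rfl
      simpa using h i.2
    refine ⟨fun hx => ?_, hne⟩
    have := h hx
    rwa [Function.update_of_ne (fun hh => hne (congrArg Fin.val hh))] at this
  · rintro ⟨h, hne⟩ hx
    rw [Function.update_of_ne (fun hh => hne (congrArg Fin.val hh))]
    exact h hx

/-- The chunk, block and offset of a position. -/
def Par.chunk (p : Par) (i : ℕ) : ℕ := i / p.L + p.Y₀
def Par.block (p : Par) (i : ℕ) : ℕ := (i - i / p.L * p.L) / p.β
def Par.offset (p : Par) (i : ℕ) : ℕ := i - i / p.L * p.L - (i - i / p.L * p.L) / p.β * p.β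

theorem Par.block_lt (i : ℕ) : p.block i < p.r := by
  unfold Par.block
  rw [Nat.div_lt_iff_lt_mul p.β_pos]
  have := Nat.div_add_mod' i p.L
  have := Nat.mod_lt i p.L_pos
  change _ < p.L
  omega

theorem Par.offset_lt (i : ℕ) : p.offset i < p.β := by
  unfold Par.offset
  have := Nat.div_add_mod' (i - i / p.L * p.L) p.β
  have := Nat.mod_lt (i - i / p.L * p.L) p.β_pos
  omega

theorem Par.pos_chunk (i : ℕ) : p.pos (p.chunk i) + (p.block i * p.β + p.offset i) = i := by
  unfold Par.pos Par.chunk Par.block Par.offset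
  have := Nat.div_add_mod' (i - i / p.L * p.L) p.β
  have := Nat.div_add_mod' i p.L
  rw [Nat.add_sub_cancel]
  omega

theorem Par.pos_inj {Y Y' j j' o o' : ℕ} (hY : p.Y₀ ≤ Y) (hY' : p.Y₀ ≤ Y') (hj : j < p.r)
    (hj' : j' < p.r) (ho : o < p.β) (ho' : o' < p.β)
    (h : p.pos Y + (j * p.β + o) = p.pos Y' + (j' * p.β + o')) : Y = Y' ∧ j = j' ∧ o = o' := by
  have key : ∀ {a a' b b' N : ℕ}, b < N → b' < N → a * N + b = a' * N + b' → a = a' ∧ b = b' := by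
    intro a a' b b' N hb hb' h
    have h1 : (a * N + b) / N = a := by
      rw [mul_comm, Nat.mul_add_div (by omega), Nat.div_eq_of_lt hb, add_zero]
    have h2 : (a' * N + b') / N = a' := by
      rw [mul_comm, Nat.mul_add_div (by omega), Nat.div_eq_of_lt hb', add_zero]
    have : a = a' := by rw [← h1, ← h2, h]
    subst this
    exact ⟨rfl, by omega⟩
  have hL : ∀ {j o : ℕ}, j < p.r → o < p.β → j * p.β + o < p.L := fun {j o} hj ho => by
    have := Nat.mul_le_mul_right p.β (Nat.succ_le_of_lt hj)
    rw [Nat.succ_mul] at this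
    unfold Par.L; omega
  obtain ⟨h1, h2⟩ := key (hL hj ho) (hL hj' ho') h
  obtain ⟨h3, h4⟩ := key ho ho' h2
  exact ⟨by omega, h3, h4⟩

/-- Chunks of positions are inner leaves of the trie. -/
theorem Par.chunk_lt {i : ℕ} (hi : i < p.n) : p.chunk i + 1 < p.D := by
  unfold Par.chunk Par.Y₀ Par.D
  have h1 := p.fits
  have h2 : i / p.L < 2 ^ p.h - 2 := by
    rw [Nat.div_lt_iff_lt_mul p.L_pos, Nat.sub_mul]
    change p.n + 2 * p.L ≤ _ * p.L at h1
    omega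
  rw [pow_succ]
  generalize i / p.L = c at *
  omega

theorem Par.leaf_chunk {i : ℕ} (hi : i < p.n) : Leaf p.h (p.chunk i) :=
  ⟨by unfold Par.chunk Par.Y₀; generalize i / p.L = c; omega, by have := Par.chunk_lt hi; unfold Par.D at this; omega⟩

theorem pat_update (i : Fin p.n) {Y j : ℕ} (hj : j < p.r) :
    pat p (Function.update B i false) Y j =
      if Y = p.chunk i ∧ j = p.block i then insert (p.offset i) (pat p B Y j) else pat p B Y j := by
  have hpos := Par.pos_chunk (p := p) i
  have hb := Par.block_lt (p := p) i
  have ho := Par.offset_lt (p := p) i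
  have hc : p.Y₀ ≤ p.chunk i := Nat.le_add_left _ _
  ext o
  have key : o ∈ pat p (Function.update B i false) Y j ↔ (o < p.β ∧ p.Y₀ ≤ Y ∧
      p.pos Y + (j * p.β + o) = i) ∨ o ∈ pat p B Y j := by
    rw [mem_pat, mem_pat, one_update]; tauto
  rw [key]
  split_ifs with h
  · obtain ⟨rfl, rfl⟩ := h
    rw [mem_insert]
    refine or_congr_left ⟨fun h => ?_, ?_⟩
    · exact (Par.pos_inj h.2.1 hc hj hb h.1 ho (h.2.2.trans hpos.symm)).2.2
    · rintro rfl; exact ⟨ho, hc, hpos⟩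
  · refine or_iff_right fun hh => h ?_
    have := Par.pos_inj hh.2.1 hc hj hb hh.1 ho (hh.2.2.trans hpos.symm)
    exact ⟨this.1, this.2.1⟩

/-- Chunk, block and offset determine the position injectively, and only positions below `n` are
counted as zeros. -/
theorem sum_card_pat_le (B : Fin p.n → Bool) :
    ∑ Y ∈ Ico (2 ^ p.h) (2 ^ (p.h + 1)), ∑ j ∈ range p.r, #(pat p B Y j) ≤ zeros B := by
  classical
  rw [← sum_product', ← card_sigma]
  unfold zeros
  rw [← card_map Fin.valEmbedding]
  refine card_le_card_of_injOn (fun a => p.pos a.1.1 + (a.1.2 * p.β + a.2)) (fun a ha => ?_) ?_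
  · have := (mem_pat.1 (mem_sigma.1 ha).2).2.2
    unfold one at this
    push Not at this
    obtain ⟨h, h'⟩ := this
    exact mem_map.2 ⟨⟨_, h⟩, mem_filter.2 ⟨mem_univ _, by simpa using h'⟩, rfl⟩
  · rintro ⟨⟨Y, j⟩, o⟩ ha ⟨⟨Y', j'⟩, o'⟩ ha' h
    simp only [mem_coe, mem_sigma, mem_product, mem_range, mem_pat] at ha ha'
    obtain ⟨rfl, rfl, rfl⟩ := Par.pos_inj ha.2.2.1 ha'.2.2.1 ha.1.2 ha'.1.2 ha.2.1 ha'.2.1 h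
    rfl

end ZeroReport

end

/-! ### The state of the chunks in memory -/

section
open Finset
namespace ZeroReport
open Chunk Trie WordRAM BitVector

/-- The memory `m` holds the state `g` of the chunks. -/
structure GMem (p : Par) (g : Ghost) (m : ℕ → ℕ) : Prop where
  hdr : ∀ Y, Leaf p.h Y → m (16 * Y + 0) = p.encH (g.H Y)
  pt : ∀ s, p.Grp s → ∀ i, i * p.K < g.cnt s →
    m (16 * (s * p.K + i) + 6) = p.HB + p.K * g.pg s i
  cnt : ∀ s, p.Grp s → m (16 * (s * p.K) + 7) = g.cnt s
  cell : ∀ s, p.Grp s → ∀ id < g.cnt s,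
    m (p.HB + p.K * g.pg s (id / p.K) + id % p.K) = p.encC (g.cell s id)
  bump : m 6 = p.HB + p.K * g.np

structure Core (p : Par) (pat : ℕ → ℕ → Finset ℕ) (g : Ghost) (m : ℕ → ℕ) : Prop where
  stat : Stat p m
  ginv : GInv p pat g
  gmem : GMem p g m
  sub : ∀ Y j, pat Y j ⊆ range p.β
  room : p.HB + p.K * g.np ≤ p.S

variable {p : Par} {s : NState} {pat : ℕ → ℕ → Finset ℕ} {g : Ghost}

theorem Par.of_lt_Q {x : ℕ} (hx : x < p.Q) : x < 2 ^ p.w := by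
  have := p.space'
  have := p.S_le
  have := p.Q_le
  unfold Par.HB at *
  omega

theorem Par.of_lt_D {x : ℕ} (hx : x < p.D) : x < 2 ^ p.w := by
  have := Par.fld_lt hx (by omega : 0 < 16)
  have := p.S_le
  omega

theorem Par.of_lt_L {x : ℕ} (hx : x ≤ p.L) : x < 2 ^ p.w := by
  have h1 := p.K_ge
  have h2 := p.KK_lt
  have h3 : p.r * p.β ≤ p.Q * p.Q := Nat.mul_le_mul p.r_lt.le p.β_lt.le
  have h4 : p.Q * p.Q < p.Q ^ 5 := by
    have := p.lt_Q
    calc p.Q * p.Q = p.Q ^ 2 := by ring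
      _ < p.Q ^ 5 := Nat.pow_lt_pow_right (by omega) (by omega)
  have := p.space'
  have := p.S_le
  unfold Par.HB at *
  unfold Par.L at hx
  omega

namespace GInv

theorem encH_spec (hG : GInv p pat g) (hsub : ∀ Y j, pat Y j ⊆ range p.β) {Y : ℕ}
    (hY : Leaf p.h Y) : p.encH (g.H Y) < p.Q ∧ p.decH (p.encH (g.H Y)) = g.H Y := by
  have hc := hG.cnt_le hsub (Par.grp hY)
  have hI := hG.inv Y hY
  exact p.encH_spec _ (fun j => (hI.slot_lt j).trans_le hc) hI.beyond (hI.opn_lt.trans_le hc)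
    hI.fill_le

theorem encC_spec (hG : GInv p pat g) {s id : ℕ} (hid : id < g.cnt s) :
    p.encC (g.cell s id) < p.Q ∧ p.decC (p.encC (g.cell s id)) = g.cell s id :=
  p.encC_spec _ (hG.valid s id hid)

end GInv

/-- The address of the cell with number in register `i` of the group whose first chunk is in
register `b`. -/
def addrE (b i : ℕ) : Ex :=
  fldE 6 (.v b + .v i / par 2) + (.v i - .v i / par 2 * par 2)

theorem Ev.reg {r x : ℕ} (hr : r < 32) (h : s.reg r = x) : Ev p.w p.S s (.v r) x := h ▸ .v hr

theorem Par.rec_lt {t i : ℕ} (ht : p.Grp t) (hi : i < p.K) : t * p.K + i < p.D := by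
  have := (Par.grp_bounds ht).2
  unfold Par.D; omega

theorem Ev.addr (hs : Stat p s.mem) {b i t id a : ℕ} (ht : p.Grp t) (hid : id < p.K * p.K)
    (hb : b < 32) (hi : i < 32) (hsb : s.reg b = t * p.K) (hsi : s.reg i = id)
    (hpt : s.mem (16 * (t * p.K + id / p.K) + 6) = a) (ha : a + id % p.K < 2 ^ p.w) :
    Ev p.w p.S s (addrE b i) (a + id % p.K) := by
  have hr := Par.rec_lt ht (show id / p.K < p.K by rwa [Nat.div_lt_iff_lt_mul p.K_pos])
  have hKK := p.KK_lt
  have hmul : id / p.K * p.K < 2 ^ p.w :=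
    Par.of_lt_Q ((Nat.div_mul_le_self id p.K).trans_lt (by omega))
  have ep : Ev p.w p.S s (ZeroReport.par 2) p.K := hs.K ▸ Ev.par (by omega)
  have e1 : Ev p.w p.S s (.v i / ZeroReport.par 2) (id / p.K) := .div (Ev.reg hi hsi) ep
  have e2 := Ev.fld ((Ev.reg hb hsb).add e1 (Par.of_lt_D hr)) hr (by omega : 6 < 16)
  rw [hpt] at e2
  have e3 := (Ev.reg hi hsi).sub (e1.mul ep hmul) (Nat.div_mul_le_self id p.K)
  rw [← Nat.mod_eq_sub_div_mul] at e3
  exact e2.add e3 ha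

namespace Core

theorem id_div_mul_lt {t id : ℕ} (hid : id < g.cnt t) : id / p.K * p.K < g.cnt t :=
  (Nat.div_mul_le_self _ _).trans_lt hid

theorem addr_lt (hC : Core p pat g s.mem) {t id : ℕ} (ht : p.Grp t) (hid : id < g.cnt t) :
    p.HB + p.K * g.pg t (id / p.K) + id % p.K < p.HB + p.K * g.np := by
  have h1 := hC.ginv.pg_lt t ht (id / p.K) (id_div_mul_lt hid)
  have h2 := Nat.mul_le_mul_left p.K (Nat.succ_le_of_lt h1)
  have h3 := Nat.mod_lt id p.K_pos
  rw [Nat.mul_succ] at h2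
  omega

theorem ev_addr (hC : Core p pat g s.mem) {b i t id : ℕ} (ht : p.Grp t) (hid : id < g.cnt t)
    (hb : b < 32) (hi : i < 32) (hsb : s.reg b = t * p.K) (hsi : s.reg i = id) :
    Ev p.w p.S s (addrE b i) (p.HB + p.K * g.pg t (id / p.K) + id % p.K) :=
  Ev.addr hC.stat ht (hid.trans_le (hC.ginv.cnt_le hC.sub ht)) hb hi hsb hsi
    (hC.gmem.pt t ht _ (id_div_mul_lt hid))
    ((hC.addr_lt ht hid).trans_le (hC.room.trans p.S_le))

theorem ev_cell (hC : Core p pat g s.mem) {b i t id : ℕ} (ht : p.Grp t) (hid : id < g.cnt t)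
    (hb : b < 32) (hi : i < 32) (hsb : s.reg b = t * p.K) (hsi : s.reg i = id) :
    Ev p.w p.S s (.ld (addrE b i)) (p.encC (g.cell t id)) := by
  rw [← hC.gmem.cell t ht id hid]
  exact .ld (hC.ev_addr ht hid hb hi hsb hsi) ((hC.addr_lt ht hid).trans_le hC.room)

theorem ev_zero : Ev p.w p.S s (.k 0) 0 := .k (Par.lit (by omega))

theorem Q_pos : 0 < p.Q := by have := p.lt_Q; omega

/-- Looking up the cell of a block. -/
theorem ev_slot (hC : Core p pat g s.mem) {a b Y j : ℕ} (hY : Leaf p.h Y) (ha : a < 32)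
    (hb : b < 32) (hsa : s.reg a = p.encH (g.H Y)) (hsb : s.reg b = j) (hj : j ≤ p.r) :
    Ev p.w p.S s (tabE 0 (.v a) (.v b) (.k 0) (.k 0)) ((g.H Y).slot j) := by
  obtain ⟨h1, h2⟩ := hC.ginv.encH_spec hC.sub hY
  have hlt := ((hC.ginv.inv Y hY).slot_lt j).trans_le (hC.ginv.cnt_le hC.sub (Par.grp hY))
  refine Ev.tab hC.stat (by omega) (Ev.reg ha hsa) (Ev.reg hb hsb) ev_zero ev_zero h1
    (hj.trans_lt p.r_lt) Q_pos Q_pos ?_ (Par.of_lt_Q (hlt.trans p.KK_lt))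
  rw [Par.F, h2]

end Core

/-! ### Enumerating the ones of a chunk -/

theorem nextOne_spec {β o : ℕ} (P : Finset ℕ) (ho : o ≤ β) :
    o ≤ nextOne β P o ∧ nextOne β P o ≤ β ∧ (nextOne β P o < β → nextOne β P o ∉ P) ∧
      ∀ y, o ≤ y → y < nextOne β P o → y ∈ P := by
  have hmem : nextOne β P o ∈ {x | o ≤ x ∧ (x ∈ P → β ≤ x)} :=
    Nat.sInf_mem ⟨β, ho, fun _ => le_rfl⟩
  refine ⟨hmem.1, Nat.sInf_le ⟨ho, fun _ => le_rfl⟩, fun h hP => ?_, fun y hy hlt => ?_⟩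
  · have := hmem.2 hP; omega
  · by_contra hP
    exact Nat.notMem_of_lt_sInf hlt ⟨hy, fun h => absurd h hP⟩

theorem nextNE_spec {r j : ℕ} (H : Hdr) (hj : j < r) :
    j < nextNE r H j ∧ nextNE r H j ≤ r ∧ (nextNE r H j < r → H.ne (nextNE r H j) = true) ∧
      ∀ y, j < y → y < nextNE r H j → H.ne y = false := by
  have hmem : nextNE r H j ∈ {x | j < x ∧ (x < r → H.ne x = true)} :=
    Nat.sInf_mem ⟨r, hj, fun h => absurd h (lt_irrefl _)⟩
  refine ⟨hmem.1, Nat.sInf_le ⟨hj, fun h => absurd h (lt_irrefl _)⟩, hmem.2, fun y hy hlt => ?_⟩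
  by_contra hP
  exact Nat.notMem_of_lt_sInf hlt ⟨hy, fun _ => by simpa using hP⟩

/-- The bit at offset `x` of the chunk is one. -/
def IsOne (p : Par) (P : ℕ → Finset ℕ) (x : ℕ) : Prop := x % p.β ∉ P (x / p.β)

theorem isOne_iff {P : ℕ → Finset ℕ} {j o : ℕ} (ho : o < p.β) :
    IsOne p P (j * p.β + o) ↔ o ∉ P j := by
  rw [IsOne, mul_comm, Nat.mul_add_mod, Nat.mod_eq_of_lt ho, Nat.mul_add_div p.β_pos,
    Nat.div_eq_of_lt ho, add_zero]

/-- Register `14` advances to the next one of the chunk (or to the end of the chunk). -/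
def nextP : Cmd :=
  .seq (setE 16 (.v 14 / par 1)) <|
  .seq (setE 17 (.v 14 - .v 16 * par 1)) <|
  .seq (setE 18 (tabE 0 (.v 13) (.v 16) (.k 0) (.k 0))) <|
  .seq (setE 19 (.ld (addrE 12 18))) <|
  .seq (setE 17 (tabE 1 (.v 19) (.v 16) (.v 17) (.k 0))) <|
  .seq (.ite (.eq 17 20)
    (.seq (setE 16 (tabE 2 (.v 13) (.v 16) (.k 0) (.k 0))) <|
     .seq (setE 18 (tabE 0 (.v 13) (.v 16) (.k 0) (.k 0))) <|
     .seq (setE 19 (.ld (addrE 12 18)))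
     (setE 17 (tabE 1 (.v 19) (.v 16) (.k 0) (.k 0))))
    .skip)
  (setE 14 (.v 16 * par 1 + .v 17))

def nextT : ℕ := 400

theorem ev_next {m : ℕ → ℕ} {R : ℕ → ℕ} {O : List ℕ} (hC : Core p pat g m) {a b Y j o : ℕ}
    (hY : Leaf p.h Y) (ha : a < 32) (hb : b < 32) {eo : Ex}
    (hsa : R a = p.encC (g.cell (Y / p.K) ((g.H Y).slot j))) (hsb : R b = j) (hj : j ≤ p.r)
    (ho : o < p.β) (heo : Ev p.w p.S ⟨R, m, O⟩ eo o) :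
    Ev p.w p.S ⟨R, m, O⟩ (tabE 1 (.v a) (.v b) eo (.k 0))
      (if j < p.r then nextOne p.β (pat Y j) o else 0) := by
  obtain ⟨h1, h2⟩ := hC.ginv.encC_spec ((hC.ginv.inv Y hY).slot_lt j)
  refine Ev.tab hC.stat (by omega) (Ev.reg ha hsa) (Ev.reg hb hsb) heo Core.ev_zero h1
    (hj.trans_lt p.r_lt) (ho.trans p.β_lt) Core.Q_pos ?_ ?_
  · rw [Par.F, h2]
    split_ifs with hjr
    · rw [(hC.ginv.inv Y hY).content j hjr]
    · rfl
  · split_ifs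
    · exact Par.of_lt_Q ((nextOne_spec _ ho.le).2.1.trans_lt p.β_lt)
    · exact Par.lit (by omega)

-- At most one jump is needed: if the current block has no further one, the header names the next
-- block that has one, and the first one of that block is found by a lookup. So the cost does not
-- depend on how many zeros are skipped.
open Function in
theorem nextP_spec {m : ℕ → ℕ} {R : ℕ → ℕ} {O : List ℕ} (hC : Core p pat g m) {Y x : ℕ}
    (hY : Leaf p.h Y) (h12 : R 12 = Y / p.K * p.K) (h13 : R 13 = p.encH (g.H Y)) (h14 : R 14 = x)
    (hx : x ≤ p.L) (h20 : R 20 = p.β) :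
    WP p.w p.S nextP ⟨R, m, O⟩ nextT fun s' => s'.mem = m ∧ s'.out = O ∧
      (∀ i, i ≠ 14 → (i < 16 ∨ 19 < i) → s'.reg i = R i) ∧ x ≤ s'.reg 14 ∧ s'.reg 14 ≤ p.L ∧
      (s'.reg 14 < p.L → IsOne p (pat Y) (s'.reg 14)) ∧
      ∀ y, x ≤ y → y < s'.reg 14 → ¬ IsOne p (pat Y) y := by
  have hgrp := Par.grp hY
  have hI := hC.ginv.inv Y hY
  obtain ⟨hH1, hH2⟩ := hC.ginv.encH_spec hC.sub hY
  have hβ : ∀ R' O', Ev p.w p.S ⟨R', m, O'⟩ (par 1) p.β := fun R' O' => by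
    have := Ev.par (p := p) (s := ⟨R', m, O'⟩) (by omega : 1 < 16)
    rwa [show (NState.mk R' m O').mem 1 = p.β from hC.stat.β] at this
  have hdm := Nat.div_add_mod' x p.β
  have hml := Nat.mod_lt x p.β_pos
  set j := x / p.β with hj
  set o := x % p.β with ho
  -- Equality occurs when the search starts at the end of the chunk.
  have hjr : j ≤ p.r := Nat.div_le_of_le_mul (by rw [mul_comm]; exact hx)
  have ho' : x - j * p.β = o := by omega
  unfold nextP nextT
  refine .set_seq (x := j) (by omega) (.div (Ev.reg (by omega) h14) (hβ _ _)) (by decide) ?_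
  refine .set_seq (x := o) (by omega) ?_ (by decide) ?_
  · rw [← ho']
    exact .sub (Ev.reg (by omega) h14) (.mul (Ev.reg (by omega) rfl) (hβ _ _)
      (Par.of_lt_L (by omega))) (by omega)
  refine .set_seq (by omega) (hC.ev_slot (j := j) hY (by omega) (by omega) h13 rfl hjr)
    (by decide) ?_
  refine .set_seq (by omega) (hC.ev_cell (t := Y / p.K) hgrp (hI.slot_lt j) (by omega) (by omega)
    h12 rfl) (by decide) ?_
  refine .set_seq (by omega) (ev_next hC (j := j) (o := o) hY (by omega) (by omega) rfl rfl hjr hml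
    (Ev.reg (by omega) rfl)) (by decide) ?_
  have hfin : ∀ (R' : ℕ → ℕ) (j' o' : ℕ), R' 16 = j' → R' 17 = o' →
      (∀ i, i ≠ 14 → (i < 16 ∨ 19 < i) → R' i = R i) → x ≤ j' * p.β + o' → j' * p.β + o' ≤ p.L →
      (j' * p.β + o' < p.L → IsOne p (pat Y) (j' * p.β + o')) →
      (∀ y, x ≤ y → y < j' * p.β + o' → ¬ IsOne p (pat Y) y) →
      WP p.w p.S (setE 14 (.v 16 * par 1 + .v 17)) ⟨R', m, O⟩ 20 fun s' => s'.mem = m ∧ s'.out = O ∧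
        (∀ i, i ≠ 14 → (i < 16 ∨ 19 < i) → s'.reg i = R i) ∧ x ≤ s'.reg 14 ∧ s'.reg 14 ≤ p.L ∧
        (s'.reg 14 < p.L → IsOne p (pat Y) (s'.reg 14)) ∧
        ∀ y, x ≤ y → y < s'.reg 14 → ¬ IsOne p (pat Y) y := by
    intro R' j' o' h16 h17 hR h1 h2 h3 h4
    refine .set_le (x := j' * p.β + o') (by omega) (.add (.mul (Ev.reg (by omega) h16) (hβ _ _)
      (Par.of_lt_L (by omega))) (Ev.reg (by omega) h17) (Par.of_lt_L h2)) (by decide) ?_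
    refine ⟨rfl, rfl, fun i hi hi' => ?_, ?_⟩
    · simp only [update_of_ne hi]; exact hR i hi hi'
    · simp only [update_self]; exact ⟨h1, h2, h3, h4⟩
  have hframe : ∀ {R' : ℕ → ℕ} (i v : ℕ), (16 ≤ i ∧ i ≤ 19) →
      (∀ i, i ≠ 14 → (i < 16 ∨ 19 < i) → R' i = R i) →
      ∀ i', i' ≠ 14 → (i' < 16 ∨ 19 < i') → update R' i v i' = R i' := by
    intro R' i v hi hR i' h1 h2
    rw [update_of_ne (by omega)]; exact hR i' h1 h2
  have hR5 := hframe 17 (if j < p.r then nextOne p.β (pat Y j) o else 0) (by omega) <|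
    hframe 19 (p.encC (g.cell (Y / p.K) ((g.H Y).slot j))) (by omega) <|
    hframe 18 ((g.H Y).slot j) (by omega) <| hframe 17 o (by omega) <| hframe 16 j (by omega)
      fun _ _ _ => rfl
  have hjL : ∀ {i : ℕ}, i < p.r → i * p.β + p.β ≤ p.L := fun {i} hi => by
    have := Nat.mul_le_mul_right p.β (Nat.succ_le_of_lt hi)
    rwa [Nat.succ_mul] at this
  obtain ⟨a1, a2, a3, a4⟩ := nextOne_spec (pat Y j) hml.le
  have hblock : ∀ y, x ≤ y → y < j * p.β + nextOne p.β (pat Y j) o → ¬ IsOne p (pat Y) y := by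
    intro y hy hy'
    obtain ⟨z, rfl⟩ := Nat.exists_eq_add_of_le (show j * p.β ≤ y by omega)
    rw [isOne_iff (by omega), not_not]
    exact a4 z (by omega) (by omega)
  refine .seq_le (u := 200) (by decide) (.ite_le ⟨by omega, by omega⟩ (by omega) (fun hc => ?_)
    fun hc => ?_)
  · replace hc : (if j < p.r then nextOne p.β (pat Y j) o else 0) = p.β := hc.trans h20
    have hjr' : j < p.r := by
      by_contra hh
      rw [if_neg hh] at hc
      exact p.β_pos.ne hc
    rw [if_pos hjr'] at hc
    obtain ⟨b1, b2, b3, b4⟩ := nextNE_spec (g.H Y) hjr'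
    set j' := nextNE p.r (g.H Y) j with hj'
    refine .set_seq (x := j') (by omega) (Ev.tab (b := j) hC.stat (by omega) (Ev.reg (by omega) h13)
      (Ev.reg (by omega) rfl) Core.ev_zero Core.ev_zero hH1 (hjr'.trans p.r_lt) Core.Q_pos
      Core.Q_pos (by rw [Par.F, hH2]) (Par.of_lt_Q (b2.trans_lt p.r_lt))) (by decide) ?_
    refine .set_seq (by omega) (hC.ev_slot (j := j') hY (by omega) (by omega) h13 rfl b2)
      (by decide) ?_
    refine .set_seq (by omega) (hC.ev_cell (t := Y / p.K) hgrp (hI.slot_lt j') (by omega) (by omega)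
      h12 rfl) (by decide) ?_
    refine .set_le (by omega) (ev_next hC (j := j') (o := 0) hY (by omega) (by omega) rfl rfl b2
      p.β_pos Core.ev_zero) (by decide) ?_
    have hgap : ∀ y, x ≤ y → y < j' * p.β → ¬ IsOne p (pat Y) y := by
      intro y hy hy'
      rcases Nat.lt_or_ge y (j * p.β + nextOne p.β (pat Y j) o) with h | h
      · exact hblock y hy h
      · rw [hc] at h
        have h1 : j < y / p.β := by
          rw [← Nat.succ_le_iff, Nat.le_div_iff_mul_le p.β_pos, Nat.succ_mul]; exact h
        have h2 : y / p.β < j' := by rwa [Nat.div_lt_iff_lt_mul p.β_pos]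
        rw [IsOne, not_not]
        have h3 := b4 _ h1 h2
        have h4 := (hI.ne (y / p.β) (by omega)).not
        rw [h3] at h4
        simp only [Bool.false_eq_true, not_false_eq_true, true_iff, not_not] at h4
        rw [h4, mem_range]
        exact Nat.mod_lt _ p.β_pos
    have hxj : x ≤ j' * p.β := by
      have := Nat.mul_le_mul_right p.β (Nat.succ_le_of_lt b1)
      rw [Nat.succ_mul] at this
      omega
    refine WP.mono (hfin _ j' (if j' < p.r then nextOne p.β (pat Y j') 0 else 0) rfl rfl
      (hframe _ _ (by omega) <| hframe _ _ (by omega) <|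
      hframe _ _ (by omega) <| hframe _ _ (by omega) hR5) ?_ ?_ ?_ ?_) (by decide) fun _ h => h
    · exact hxj.trans (Nat.le_add_right _ _)
    · split_ifs with h
      · have := hjL h
        have := (nextOne_spec (pat Y j') p.β_pos.le).2.1
        omega
      · have : j' = p.r := by omega
        rw [this]; exact le_rfl
    · intro hlt
      have h : j' < p.r := by
        by_contra hh
        rw [if_neg hh, show j' = p.r by omega] at hlt
        exact lt_irrefl _ hlt
      rw [if_pos h]
      obtain ⟨c1, c2, c3, c4⟩ := nextOne_spec (pat Y j') p.β_pos.le
      have : nextOne p.β (pat Y j') 0 < p.β := by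
        by_contra hh
        refine ((hI.ne j' h).1 (b3 h)) (Subset.antisymm (hC.sub Y j') fun y hy => ?_)
        exact c4 y (by omega) (by have := mem_range.1 hy; omega)
      rw [isOne_iff this]
      exact c3 this
    · intro y hy hy'
      rcases Nat.lt_or_ge y (j' * p.β) with h | h
      · exact hgap y hy h
      · have hr' : j' < p.r := by
          by_contra hh
          rw [if_neg hh] at hy'
          omega
        rw [if_pos hr'] at hy'
        obtain ⟨z, rfl⟩ := Nat.exists_eq_add_of_le h
        obtain ⟨c1, c2, c3, c4⟩ := nextOne_spec (pat Y j') p.β_pos.le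
        rw [isOne_iff (by omega), not_not]
        exact c4 z (by omega) (by omega)
  · refine .skip_le (by omega) (WP.mono (hfin _ j (if j < p.r then nextOne p.β (pat Y j) o else 0)
      rfl rfl hR5 ?_ ?_ ?_ ?_) (by decide) fun _ h => h)
    all_goals
      replace hc : ¬ (if j < p.r then nextOne p.β (pat Y j) o else 0) = p.β := fun h =>
        hc (h.trans h20.symm)
    all_goals
      split_ifs at hc ⊢ with hjr'
    · omega
    · have : j = p.r := by omega
      rw [this]; exact hx
    · have := hjL hjr'; omega
    · have : j = p.r := by omega
      rw [this]; exact le_rfl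
    · intro _
      rw [isOne_iff (by omega)]
      exact a3 (by omega)
    · have : j = p.r := by omega
      rw [this]
      intro h
      exact absurd h (lt_irrefl _)
    · exact hblock
    · intro y hy hy'
      have : o = 0 := by
        have : j = p.r := by omega
        rw [this] at hdm
        change p.L + o = x at hdm
        omega
      omega

end ZeroReport

end

section
open Finset
namespace ZeroReport
open Chunk Trie WordRAM BitVector

variable {p : Par} {B : Fin p.n → Bool} {g : Ghost}

theorem ones_skip {a x b : ℕ} (hax : a ≤ x) (h : ∀ y, a ≤ y → y < x → ¬ one p B y) :
    ones p B a b = ones p B x b := by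
  rcases Nat.le_total x b with hb | hb
  · rw [ones_append hax hb, ones_eq_zero h, zero_add]
  · rw [ones_eq_zero (fun y h1 h2 => h y h1 (h2.trans_le hb)),
      ones_eq_zero fun y h1 h2 => absurd (h1.trans_lt h2) hb.not_gt]

theorem isOne_pat {Y x : ℕ} (hY : p.Y₀ ≤ Y) : IsOne p (pat p B Y) x ↔ one p B (p.pos Y + x) := by
  rw [IsOne, not_mem_pat_iff hY (Nat.mod_lt _ p.β_pos), Nat.div_add_mod']

/-- Report the ones of chunk number `v 10` from offset `v 14` to offset `v 15 - 1`. -/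
def scanP : Cmd :=
  .seq (
    .seq (setE 11 ((.v 10 - par 7) * par 0)) <|
    .seq (setE 12 (.v 10 / par 2 * par 2)) <|
    .seq (setE 13 (fldE 0 (.v 10))) <|
    .seq (setE 20 (par 1)) nextP) <|
  .loop (.lt 14 15) (.seq (emitE (.v 11 + .v 14)) <| .seq (setE 14 (.v 14 + .k 1)) nextP)

/-- The contents of the registers while chunk `Y` is scanned up to offset `q - 1`. -/
structure Scan (p : Par) (g : Ghost) (Y q : ℕ) (R : ℕ → ℕ) : Prop where
  pos : R 11 = p.pos Y
  base : R 12 = Y / p.K * p.K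
  hdr : R 13 = p.encH (g.H Y)
  last : R 15 = q
  beta : R 20 = p.β

theorem Scan.congr {Y q : ℕ} {R R' : ℕ → ℕ} (hR : Scan p g Y q R)
    (h : ∀ i, i ≠ 14 → (i < 16 ∨ 19 < i) → R' i = R i) : Scan p g Y q R' :=
  ⟨(h _ (by omega) (by omega)).trans hR.pos, (h _ (by omega) (by omega)).trans hR.base,
    (h _ (by omega) (by omega)).trans hR.hdr, (h _ (by omega) (by omega)).trans hR.last,
    (h _ (by omega) (by omega)).trans hR.beta⟩

/-- Invariant: the current offset is either a one or not below `q`. So each iteration emits a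
position and its cost is charged to it; `d` only serves for the induction. -/
theorem scan_loop {m : ℕ → ℕ} (hC : Core p (pat p B) g m) {Y q : ℕ} (hY : Leaf p.h Y)
    (hY₀ : p.Y₀ ≤ Y) (hq : q ≤ p.L) (hn : p.pos Y + q ≤ p.n) (d : ℕ) :
    ∀ (R : ℕ → ℕ) (O : List ℕ) (x : ℕ), q - x ≤ d → Scan p g Y q R → R 14 = x →
      (x < q → IsOne p (pat p B Y) x) →
      WP p.w p.S (.loop (.lt 14 15) (.seq (emitE (.v 11 + .v 14)) <|
        .seq (setE 14 (.v 14 + .k 1)) nextP)) ⟨R, m, O⟩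
        (500 * (ones p B (p.pos Y + x) (p.pos Y + q)).card + 1) fun s' => s'.mem = m ∧
          (s'.out : Multiset ℕ) = (O : Multiset ℕ) + ones p B (p.pos Y + x) (p.pos Y + q) ∧
          ∀ i, (i < 11 ∨ 20 < i) → s'.reg i = R i := by
  induction d with
  | zero =>
    intro R O x hd hR hx h1
    have h0 : ones p B (p.pos Y + x) (p.pos Y + q) = 0 := ones_eq_zero fun y _ _ => by omega
    rw [h0]
    refine WP.mono (WP.loop_false ⟨by omega, by omega⟩ ?_ ⟨rfl, by simp, fun _ _ => rfl⟩) (by simp)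
      fun _ h => h
    change ¬ R 14 < R 15
    rw [hx, hR.last]; omega
  | succ d ih =>
    intro R O x hd hR hx h1
    by_cases hxq : x < q
    · have hone : one p B (p.pos Y + x) := (isOne_pat hY₀).1 (h1 hxq)
      have hcons : ones p B (p.pos Y + x) (p.pos Y + q) =
          {p.pos Y + x} + ones p B (p.pos Y + x + 1) (p.pos Y + q) :=
        ones_eq_cons le_rfl (by omega) hone fun y _ _ => by omega
      rw [hcons, Multiset.card_add, Multiset.card_singleton]
      have hnw := p.n_le
      refine WP.mono (WP.loop_true (t := 450)
        (t' := 500 * (ones p B (p.pos Y + x + 1) (p.pos Y + q)).card + 1) ⟨by omega, by omega⟩ ?_ ?_)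
        (by omega) fun _ h => h
      · change R 14 < R 15
        rw [hx, hR.last]; exact hxq
      refine .emit_seq (.add (Ev.reg (by omega) hR.pos) (Ev.reg (by omega) hx) (by omega))
        (by decide) ?_
      refine .set_seq (x := x + 1) (by omega) (.add (Ev.reg (by omega) hx) (.k (Par.lit (by omega)))
        (Par.of_lt_L (by omega))) (by decide) ?_
      refine WP.mono (nextP_spec (x := x + 1) hC hY
        ((Function.update_of_ne (by omega) _ _).trans hR.base)
        ((Function.update_of_ne (by omega) _ _).trans hR.hdr) (Function.update_self _ _ _)
        (by omega) ((Function.update_of_ne (by omega) _ _).trans hR.beta)) (by decide) ?_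
      rintro ⟨R', m', O'⟩ ⟨hm, hO, hR', hge, hle, his, hno⟩
      simp only at hm hO hR' hge hle his hno
      subst hm hO
      have hRR : ∀ i, i ≠ 14 → (i < 16 ∨ 19 < i) → R' i = R i := fun i h h' => by
        rw [hR' i h h', Function.update_of_ne h]
      have hskip : ones p B (p.pos Y + x + 1) (p.pos Y + q) =
          ones p B (p.pos Y + R' 14) (p.pos Y + q) := by
        refine ones_skip (by omega) fun y hy hy' => ?_
        obtain ⟨z, rfl⟩ := Nat.exists_eq_add_of_le (show p.pos Y ≤ y by omega)
        rw [← isOne_pat hY₀]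
        exact hno z (by omega) (by omega)
      rw [hskip]
      refine WP.mono (ih R' _ (R' 14) (by omega) (hR.congr hRR) rfl fun h => his (by omega)) le_rfl ?_
      rintro s' ⟨a, b, c⟩
      refine ⟨a, ?_, fun i hi => (c i hi).trans (hRR i (by omega) (by omega))⟩
      rw [b, ← Multiset.coe_add, ← add_assoc]
      rfl
    · have h0 : ones p B (p.pos Y + x) (p.pos Y + q) = 0 := ones_eq_zero fun y _ _ => by omega
      rw [h0]
      refine WP.mono (WP.loop_false ⟨by omega, by omega⟩ ?_ ⟨rfl, by simp, fun _ _ => rfl⟩) (by simp)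
        fun _ h => h
      change ¬ R 14 < R 15
      rw [hx, hR.last]; omega

theorem Ev.par' {m R : ℕ → ℕ} {O : List ℕ} {i x : ℕ} (hi : i < 16) (h : m i = x) :
    Ev p.w p.S ⟨R, m, O⟩ (ZeroReport.par i) x := by
  subst h; exact Ev.par (s := ⟨R, m, O⟩) hi

theorem Ev.fld' {m R : ℕ → ℕ} {O : List ℕ} {f x y : ℕ} {e : Ex} (he : Ev p.w p.S ⟨R, m, O⟩ e x)
    (hx : x < p.D) (hf : f < 16) (h : m (16 * x + f) = y) : Ev p.w p.S ⟨R, m, O⟩ (fldE f e) y := by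
  subst h; exact Ev.fld he hx hf

theorem Par.pos_succ {Y : ℕ} (hY : p.Y₀ ≤ Y) : p.pos (Y + 1) = p.pos Y + p.L := by
  unfold Par.pos
  rw [Nat.sub_add_comm hY, Nat.succ_mul]

def scanT : ℕ := 600

theorem scanP_spec {m R : ℕ → ℕ} {O : List ℕ} (hC : Core p (pat p B) g m) {Y x q : ℕ}
    (hY : Leaf p.h Y) (hY₀ : p.Y₀ ≤ Y) (hxq : x < q) (hq : q ≤ p.L) (hn : p.pos Y + q ≤ p.n)
    (h10 : R 10 = Y) (h14 : R 14 = x) (h15 : R 15 = q) :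
    WP p.w p.S scanP ⟨R, m, O⟩ (scanT * ((ones p B (p.pos Y + x) (p.pos Y + q)).card + 1))
      fun s' => s'.mem = m ∧
          (s'.out : Multiset ℕ) = (O : Multiset ℕ) + ones p B (p.pos Y + x) (p.pos Y + q) ∧
          ∀ i, (i < 11 ∨ 20 < i) → s'.reg i = R i := by
  have hnw := p.n_le
  have hYD : Y < p.D := hY.2
  unfold scanP scanT
  refine WP.mono (t := 550 + (500 * (ones p B (p.pos Y + x) (p.pos Y + q)).card + 1)) (WP.seq ?_)
    (by omega) fun _ h => h
  refine .set_seq (x := p.pos Y) (by omega) (.mul (.sub (Ev.reg (by omega) h10)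
    (Ev.par' (by omega) hC.stat.Y₀) hY₀) (Ev.par' (by omega) hC.stat.L)
    (show p.pos Y < _ by omega)) (by decide) ?_
  refine .set_seq (x := Y / p.K * p.K) (by omega) (.mul (.div (Ev.reg (by omega) h10)
    (Ev.par' (by omega) hC.stat.K)) (Ev.par' (by omega) hC.stat.K)
    (Par.of_lt_D ((Nat.div_mul_le_self Y p.K).trans_lt hYD))) (by decide) ?_
  refine .set_seq (x := p.encH (g.H Y)) (by omega) (Ev.fld' (Ev.reg (by omega) h10) hYD (by omega)
    (hC.gmem.hdr Y hY)) (by decide) ?_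
  refine .set_seq (x := p.β) (by omega) (Ev.par' (by omega) hC.stat.β) (by decide) ?_
  refine WP.mono (nextP_spec (x := x) hC hY rfl rfl h14 (by omega) rfl) (by decide) ?_
  rintro ⟨R', m', O'⟩ ⟨hm, hO, hR', hge, hle, his, hno⟩
  simp only at hm hO hR' hge hle his hno
  subst hm hO
  have hskip : ones p B (p.pos Y + x) (p.pos Y + q) =
      ones p B (p.pos Y + R' 14) (p.pos Y + q) := by
    refine ones_skip (by omega) fun y hy hy' => ?_
    obtain ⟨z, rfl⟩ := Nat.exists_eq_add_of_le (show p.pos Y ≤ y by omega)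
    rw [← isOne_pat hY₀]
    exact hno z (by omega) (by omega)
  rw [hskip]
  refine WP.mono (scan_loop hC hY hY₀ hq hn q R' _ (R' 14) (by omega) ⟨?_, ?_, ?_, ?_, ?_⟩ rfl
    fun h => his (by omega)) le_rfl ?_
  · exact hR' 11 (by omega) (by omega)
  · exact hR' 12 (by omega) (by omega)
  · exact hR' 13 (by omega) (by omega)
  · exact (hR' 15 (by omega) (by omega)).trans h15
  · exact hR' 20 (by omega) (by omega)
  rintro s' ⟨a, b, c⟩
  refine ⟨a, b, fun i hi => (c i hi).trans ((hR' i (by omega) (by omega)).trans ?_)⟩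
  simp only [Function.update_of_ne (show i ≠ 11 by omega), Function.update_of_ne (show i ≠ 12 by omega),
    Function.update_of_ne (show i ≠ 13 by omega), Function.update_of_ne (show i ≠ 20 by omega)]

end ZeroReport

end

section
open Finset
namespace ZeroReport
open Chunk Trie WordRAM BitVector

variable {p : Par} {B : Fin p.n → Bool} {g : Ghost}

/-! ### The sequence of chunks with a one -/

/-- `y` follows `x` in `A`. -/
def Consec (A : Set ℕ) (x y : ℕ) : Prop := x ∈ A ∧ y ∈ A ∧ x < y ∧ ∀ a ∈ A, ¬ (x < a ∧ a < y)

theorem exists_prev {A : Set ℕ} {x z : ℕ} (hx : x ∈ A) (hz : z ∈ A) (hxz : x < z) :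
    ∃ y, Consec A y z := by
  classical
  refine ⟨Nat.findGreatest (· ∈ A) (z - 1), Nat.findGreatest_spec (P := (· ∈ A))
    (by omega : x ≤ z - 1) hx, hz, ?_, ?_⟩
  · have := Nat.findGreatest_le (P := (· ∈ A)) (z - 1)
    omega
  · rintro a ha ⟨h1, h2⟩
    exact Nat.findGreatest_is_greatest h1 (by omega) ha

theorem exists_next {A : Set ℕ} {x z : ℕ} (hx : x ∈ A) (hz : z ∈ A) (hxz : x < z) :
    ∃ y, Consec A x y := by
  classical
  have h : ∃ y, x < y ∧ y ∈ A := ⟨z, hxz, hz⟩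
  exact ⟨Nat.find h, hx, (Nat.find_spec h).2, (Nat.find_spec h).1,
    fun a ha ⟨h1, h2⟩ => Nat.find_min h h2 ⟨h1, ha⟩⟩

theorem exists_isFirst {A : Set ℕ} {lt : ℕ → ℕ → Prop} (hd : Dir lt) {D j v z : ℕ}
    (hA : ∀ a ∈ A, a < D) (hz : z ∈ A) (hv : z >>> j = v) : ∃ m, IsFirst lt A j v m := by
  classical
  rcases hd with rfl | rfl
  · have h : ∃ y, y ∈ A ∧ y >>> j = v := ⟨z, hz, hv⟩
    exact ⟨Nat.find h, (Nat.find_spec h).1, (Nat.find_spec h).2,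
      fun a ha hav h2 => Nat.find_min h h2 ⟨ha, hav⟩⟩
  · have h := Nat.findGreatest_spec (P := fun y => y ∈ A ∧ y >>> j = v) (hA z hz).le ⟨hz, hv⟩
    exact ⟨_, h.1, h.2, fun a ha hav h2 => Nat.findGreatest_is_greatest h2 (hA a ha).le ⟨ha, hav⟩⟩

theorem Par.two_le (p : Par) : 2 ≤ 2 ^ p.h := by
  by_contra hh
  have h1 := p.fits
  have h2 : 2 ^ p.h * (p.r * p.β) ≤ 1 * (p.r * p.β) := Nat.mul_le_mul_right _ (by omega)
  have h3 : 0 < p.r * p.β := p.L_pos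
  omega

/-- A sentinel, which provides a predecessor for every chunk of positions. -/
theorem alive_first (B : Fin p.n → Bool) : 2 ^ p.h ∈ Alive p B := by
  refine ⟨⟨le_rfl, Nat.pow_lt_pow_right one_lt_two p.h.lt_succ_self⟩, 0, p.r_pos,
    pat_ne_iff.2 ⟨0, p.β_pos, fun h => ?_⟩⟩
  have := (mem_pat.1 h).2.1
  unfold Par.Y₀ at this
  omega

/-- A sentinel: this chunk starts at or beyond position `n`, where all bits count as ones. -/
theorem alive_last (B : Fin p.n → Bool) : 2 ^ (p.h + 1) - 1 ∈ Alive p B := by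
  have h2 := p.two_le
  have hp : 2 ^ (p.h + 1) = 2 ^ p.h * 2 := pow_succ ..
  refine ⟨⟨by omega, by omega⟩, 0, p.r_pos, pat_ne_iff.2 ⟨0, p.β_pos, fun h => ?_⟩⟩
  refine (mem_pat.1 h).2.2 fun hlt => absurd hlt ?_
  have h1 := p.fits
  have h3 : p.pos (2 ^ (p.h + 1) - 1) = (2 ^ p.h - 2) * (p.r * p.β) := by
    unfold Par.pos Par.Y₀ Par.L
    congr 1; omega
  rw [Nat.sub_mul] at h3
  omega

theorem Par.pos_mono {a b : ℕ} (h : a ≤ b) : p.pos a ≤ p.pos b :=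
  Nat.mul_le_mul_right _ (Nat.sub_le_sub_right h _)

theorem ones_gap {a b : ℕ} (ha : p.Y₀ ≤ a) (hb : b ≤ p.D) (hab : a ≤ b)
    (h : ∀ Y, a ≤ Y → Y < b → Y ∉ Alive p B) : ones p B (p.pos a) (p.pos b) = 0 := by
  induction b, hab using Nat.le_induction with
  | base => exact ones_eq_zero fun x h1 h2 => by omega
  | succ b hab ih =>
    have hY : Leaf p.h b := ⟨by unfold Par.Y₀ at ha; omega, hb⟩
    rw [ones_append (Par.pos_mono hab) (Par.pos_mono (Nat.le_succ b)),
      ih (by omega) fun Y h1 h2 => h Y h1 (by omega),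
      ones_of_not_alive hY (by omega) (h b hab (by omega)), add_zero]

/-- The memory `m` holds a doubly linked list of the elements of `A` and pointers for finding
the first and the last element of `A` below a node of the trie. -/
structure Links (p : Par) (A : Set ℕ) (m : ℕ → ℕ) : Prop where
  list : ∀ x y, Consec A x y → m (16 * x + 1) = y ∧ m (16 * y + 2) = x
  min : TrieOK p.b p.k p.h (· < ·) A fun v => m (16 * v + 3)
  max : TrieOK p.b p.k p.h (· > ·) A fun v => m (16 * v + 4)
  min_leaf : ∀ v, 1 ≤ v → v < p.D → Leaf p.h (m (16 * v + 3))
  max_leaf : ∀ v, 1 ≤ v → v < p.D → Leaf p.h (m (16 * v + 4))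

/-- The memory `m` represents the bit vector `B`. -/
structure Rep (p : Par) (B : Fin p.n → Bool) (g : Ghost) (m : ℕ → ℕ) : Prop
    extends Links p (Alive p B) m where
  zeros_le : zeros B ≤ p.m
  core : Core p (pat p B) g m

/-! ### Searching for a chunk with a one -/

/-- Descend in the trie from the ancestor of `v 7` at height `v 8`. -/
def descP (f : ℕ) : Cmd :=
  .loop (.lt 24 8) (.seq (setE 7 (fldE f (.bin .shr (.v 7) (.v 8))))
    (setE 8 (tabE 9 (.v 8) (.k 0) (.k 0) (.k 0))))

theorem Leaf.one_le_shiftRight {h x j : ℕ} (hx : Leaf h x) (hj : j ≤ h) : 1 ≤ x >>> j := by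
  rw [Nat.shiftRight_eq_div_pow, Nat.le_div_iff_mul_le (by positivity), one_mul]
  exact (Nat.pow_le_pow_right two_pos hj).trans hx.1

-- The current leaf has the same ancestor at the current height as the first element in question,
-- and each pointer improves the agreement from height `j` to height `down j`, raising `lev`. If the
-- subtree is empty, the search still ends in some leaf, which has to be rejected by a later test.
open Function in
theorem descP_spec {m : ℕ → ℕ} (hs : Stat p m) {lt : ℕ → ℕ → Prop} {A : Set ℕ} {f j₀ v₀ : ℕ}
    (hf : f < 16)
    (hT : TrieOK p.b p.k p.h lt A fun v => m (16 * v + f))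
    (hTl : ∀ v, 1 ≤ v → v < p.D → Leaf p.h (m (16 * v + f))) {O : List ℕ} (d : ℕ) :
    ∀ (R : ℕ → ℕ) (y j : ℕ), p.k - lev p.b p.k j ≤ d → R 7 = y → R 8 = j → R 24 = 0 → Leaf p.h y →
      j ≤ j₀ → j ≤ p.h → (∀ x, IsFirst lt A j₀ v₀ x → y >>> j = x >>> j) →
      WP p.w p.S (descP f) ⟨R, m, O⟩ (100 * d + 1) fun s' => s'.mem = m ∧ s'.out = O ∧
        Leaf p.h (s'.reg 7) ∧ (∀ x, IsFirst lt A j₀ v₀ x → s'.reg 7 = x) ∧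
        ∀ i, i ≠ 7 → i ≠ 8 → s'.reg i = R i := by
  induction d with
  | zero =>
    intro R y j hd h7 h8 h24 hy hj hjh hx
    -- A positive height below `b ^ k` has `lev` less than `k`.
    obtain rfl : j = 0 := by
      by_contra hh
      have := lev_lt (k := p.k) (by omega : 1 ≤ j) (hjh.trans_lt p.h_lt_pow)
      omega
    refine WP.loop_false ⟨by omega, by omega⟩ (fun h : R 24 < R 8 => by omega)
      ⟨rfl, rfl, by rw [← h7] at hy; exact hy, fun x h => ?_, fun _ _ _ => rfl⟩
    exact h7.trans (hx x h)
  | succ d ih =>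
    intro R y j hd h7 h8 h24 hy hj hjh hx
    rcases Nat.eq_zero_or_pos j with rfl | hpos
    · refine WP.mono (WP.loop_false ⟨by omega, by omega⟩ (fun h : R 24 < R 8 => by omega)
        ⟨rfl, rfl, by rw [← h7] at hy; exact hy, fun x h => ?_, fun _ _ _ => rfl⟩) (by omega) fun _ h => h
      exact h7.trans (hx x h)
    · have hjb := hjh.trans_lt p.h_lt_pow
      have hdl := down_lt (k := p.k) hpos hjb
      have hll := lev_lt_lev_down (k := p.k) hpos hjb
      have hlk := lev_lt (k := p.k) hpos hjb
      have h1 := Leaf.one_le_shiftRight hy hjh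
      have h2 : y >>> j < p.D := hy.shiftRight_lt j
      refine WP.mono (WP.loop_true (t := 99) (t' := 100 * d + 1) ⟨by omega, by omega⟩
        (show R 24 < R 8 by omega) ?_) (by omega) fun _ h => h
      refine .set_seq (x := m (16 * (y >>> j) + f)) (by omega)
        (Ev.fld' (.shr (Ev.reg (by omega) h7) (Ev.reg (by omega) h8)) h2 hf rfl)
        (Nat.le_of_ble_eq_true rfl) ?_
      refine .set_le (x := down p.b p.k j) (by omega) (Ev.tab hs (by omega)
        (Ev.reg (by omega) h8) Core.ev_zero Core.ev_zero Core.ev_zero (hjh.trans_lt p.h_lt)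
        Core.Q_pos Core.Q_pos Core.Q_pos rfl (Par.of_lt_Q (hdl.trans (hjh.trans_lt p.h_lt))))
        (Nat.le_of_ble_eq_true rfl) ?_
      refine WP.mono (ih _ (m (16 * (y >>> j) + f)) (down p.b p.k j) (by omega) rfl rfl h24
        (hTl _ h1 h2) (by omega) (by omega) fun x hxx => ?_) le_rfl ?_
      · exact hT.step hpos hjh hj hxx (hx x hxx)
      · rintro s' ⟨a, b, c, d, e⟩
        refine ⟨a, b, c, d, fun i hi hi' => (e i hi hi').trans ?_⟩
        simp only [update_of_ne hi, update_of_ne hi']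

/-! ### Enumerating the chunks with a one -/

/-- Report the ones of chunk `v 9` and follow the pointer in field `f`. -/
def visitP (f : ℕ) : Cmd :=
  .seq (.seq (setE 10 (.v 9)) <| .seq (setE 14 (.k 0)) (setE 15 (par 0))) <|
  .seq scanP (setE 9 (fldE f (.v 9)))

def visitT : ℕ := 1300

open Function in
theorem visitP_spec {m R : ℕ → ℕ} {O : List ℕ} (hC : Core p (pat p B) g m) {Y z f : ℕ}
    (hY : Y ∈ Alive p B) (hY₀ : p.Y₀ ≤ Y) (hn : p.pos (Y + 1) ≤ p.n) (hf : f < 16)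
    (h9 : R 9 = Y) (hz : m (16 * Y + f) = z) :
    WP p.w p.S (visitP f) ⟨R, m, O⟩ (visitT * (ones p B (p.pos Y) (p.pos (Y + 1))).card)
      fun s' => s'.mem = m ∧ s'.reg 9 = z ∧
        (s'.out : Multiset ℕ) = (O : Multiset ℕ) + ones p B (p.pos Y) (p.pos (Y + 1)) ∧
        ∀ i, (i < 9 ∨ 20 < i) → s'.reg i = R i := by
  have h1 := card_ones_pos hY₀ hY
  have hL := Par.pos_succ hY₀
  rw [hL] at hn h1 ⊢
  unfold visitT
  refine WP.mono (WP.seq (t := 20) (t' := scanT * ((ones p B (p.pos Y) (p.pos Y + p.L)).card + 1) + 10)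
    ?_) (by unfold scanT; omega) fun _ h => h
  refine .set_seq (x := Y) (by omega) (Ev.reg (by omega) h9) (by decide) ?_
  refine .set_seq (x := 0) (by omega) Core.ev_zero (by decide) ?_
  refine .set_le (x := p.L) (by omega) (Ev.par' (by omega) hC.stat.L) (by decide) ?_
  refine WP.seq ?_
  refine WP.mono (scanP_spec (x := 0) (q := p.L) hC hY.1 hY₀ p.L_pos le_rfl hn rfl rfl rfl) le_rfl ?_
  rintro ⟨R', m', O'⟩ ⟨hm, hO, hR⟩
  simp only at hm hO hR
  subst hm
  rw [add_zero] at hO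
  have hR' : ∀ i, (i < 10 ∨ 20 < i) → R' i = R i := fun i hi => by
    rw [hR i (by omega), update_of_ne (by omega), update_of_ne (by omega), update_of_ne (by omega)]
  refine .set_le (x := z) (by omega) (Ev.fld' (Ev.reg (by omega) ((hR' 9 (by omega)).trans h9))
    hY.1.2 hf hz) (Nat.le_of_ble_eq_true rfl) ⟨rfl, rfl, hO, fun i hi => ?_⟩
  rw [← hR' i (by omega)]
  exact update_of_ne (by omega) _ _

/-- Report all chunks from `v 9` down to `v 2 + 1`. -/
def downP : Cmd := .loop (.lt 2 9) (visitP 2)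

/-- Report all chunks from `v 9` up to `v 3 - 1`. -/
def upP : Cmd := .loop (.lt 9 3) (visitP 1)

def walkT : ℕ := 1301

/-- Chunks skipped by the list contain no ones, and every chunk visited contains at least one, so
the whole walk is paid for by its output. The walk ends at the latest at the sentinel. -/
theorem downP_spec {m : ℕ → ℕ} (hM : Rep p B g m) {Ys : ℕ} (hYs : p.Y₀ ≤ Ys) (z : ℕ) :
    ∀ (R : ℕ → ℕ) (O : List ℕ), z ∈ Alive p B → p.pos (z + 1) ≤ p.n → R 2 = Ys → R 9 = z →
      WP p.w p.S downP ⟨R, m, O⟩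
        (walkT * (ones p B (p.pos (Ys + 1)) (p.pos (z + 1))).card + 1) fun s' => s'.mem = m ∧
        (s'.out : Multiset ℕ) = (O : Multiset ℕ) + ones p B (p.pos (Ys + 1)) (p.pos (z + 1)) ∧
        ∀ i, (i < 9 ∨ 20 < i) → s'.reg i = R i := by
  induction z using Nat.strong_induction_on with
  | _ z ih =>
  intro R O hz hn h2 h9
  by_cases hlt : Ys < z
  · obtain ⟨y, hy⟩ := exists_prev (alive_first B) hz (by unfold Par.Y₀ at hYs; omega)
    have hsplit : ones p B (p.pos (Ys + 1)) (p.pos (z + 1)) =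
        ones p B (p.pos z) (p.pos (z + 1)) + ones p B (p.pos (Ys + 1)) (p.pos (y + 1)) := by
      rw [ones_append (Par.pos_mono hlt) (Par.pos_mono (Nat.le_succ z)), add_comm]
      congr 1
      have hzD : z ≤ p.D := hz.1.2.le
      rcases Nat.le_total (Ys + 1) (y + 1) with h | h
      · rw [ones_append (Par.pos_mono h) (Par.pos_mono (Nat.succ_le_of_lt hy.2.2.1)),
          ones_gap (a := y + 1) (by omega) hzD hy.2.2.1 fun Y h1 h2 hY => hy.2.2.2 Y hY ⟨h1, h2⟩,
          add_zero]
      · rw [ones_gap (by omega) hzD hlt fun Y h1 h2 hY => hy.2.2.2 Y hY ⟨by omega, h2⟩,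
          ones_eq_zero fun x h1 h2 => absurd (h1.trans_lt h2) (Par.pos_mono h).not_gt]
    have hcard := card_ones_pos (by omega) hz
    rw [hsplit, Multiset.card_add]
    refine WP.mono (WP.loop_true ⟨by omega, by omega⟩ (show R 2 < R 9 by omega) <|
      WP.mono (visitP_spec hM.core hz (by omega) hn (by omega) h9 (hM.list _ _ hy).2) le_rfl ?_)
      (t := _ + (walkT * (ones p B (p.pos (Ys + 1)) (p.pos (y + 1))).card + 1) + 1)
      (by unfold walkT visitT; omega) fun _ h => h
    rintro ⟨R', m', O'⟩ ⟨hm, h9', hO, hR⟩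
    simp only at hm h9' hO hR
    subst hm
    refine WP.mono (ih y hy.2.2.1 R' O' hy.1 ((Par.pos_mono (by have := hy.2.2.1; omega)).trans hn)
      ((hR 2 (by omega)).trans h2) h9') le_rfl ?_
    rintro s' ⟨a, b, c⟩
    refine ⟨a, ?_, fun i hi => (c i hi).trans (hR i hi)⟩
    rw [b, hO, add_assoc]
  · have h0 : ones p B (p.pos (Ys + 1)) (p.pos (z + 1)) = 0 := ones_eq_zero fun x h1 h2 =>
      absurd (h1.trans_lt h2) (Par.pos_mono (by omega)).not_gt
    rw [h0]
    exact WP.mono (WP.loop_false ⟨by omega, by omega⟩ (fun h : R 2 < R 9 => by omega)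
      ⟨rfl, by simp, fun _ _ => rfl⟩) (by omega) fun _ h => h

theorem upP_spec {m : ℕ → ℕ} (hM : Rep p B g m) {Ye : ℕ} (hYe : Ye < p.D) (hn : p.pos Ye ≤ p.n)
    (d : ℕ) : ∀ (R : ℕ → ℕ) (O : List ℕ) (z : ℕ), p.D - z ≤ d → z ∈ Alive p B → p.Y₀ ≤ z →
      R 3 = Ye → R 9 = z →
      WP p.w p.S upP ⟨R, m, O⟩
        (walkT * (ones p B (p.pos z) (p.pos Ye)).card + 1) fun s' => s'.mem = m ∧
        (s'.out : Multiset ℕ) = (O : Multiset ℕ) + ones p B (p.pos z) (p.pos Ye) := by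
  induction d with
  | zero => intro R O z hd hz; have : z < p.D := hz.1.2; omega
  | succ d ih =>
  intro R O z hd hz hz₀ h3 h9
  by_cases hlt : z < Ye
  · obtain ⟨y, hy⟩ := exists_next hz (alive_last B) (by unfold Par.D at hYe; omega)
    have hyD : y < p.D := hy.2.1.1.2
    have hsplit : ones p B (p.pos z) (p.pos Ye) =
        ones p B (p.pos z) (p.pos (z + 1)) + ones p B (p.pos y) (p.pos Ye) := by
      rw [ones_append (Par.pos_mono (Nat.le_succ z)) (Par.pos_mono hlt)]
      congr 1
      rcases Nat.le_total y Ye with h | h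
      · rw [ones_append (Par.pos_mono (Nat.succ_le_of_lt hy.2.2.1)) (Par.pos_mono h),
          ones_gap (by omega) hyD.le hy.2.2.1 fun Y h1 h2 hY => hy.2.2.2 Y hY ⟨by omega, h2⟩,
          zero_add]
      · rw [ones_gap (by omega) hYe.le hlt fun Y h1 h2 hY => hy.2.2.2 Y hY ⟨h1, by omega⟩,
          ones_eq_zero fun x h1 h2 => absurd (h1.trans_lt h2) (Par.pos_mono h).not_gt]
    have hcard := card_ones_pos hz₀ hz
    rw [hsplit, Multiset.card_add]
    refine WP.mono (WP.loop_true ⟨by omega, by omega⟩ (show R 9 < R 3 by omega) <|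
      WP.mono (visitP_spec hM.core hz hz₀ ((Par.pos_mono hlt).trans hn) (by omega) h9
        (hM.list _ _ hy).1) le_rfl ?_)
      (t := _ + (walkT * (ones p B (p.pos y) (p.pos Ye)).card + 1) + 1)
      (by unfold walkT visitT; omega) fun _ h => h
    rintro ⟨R', m', O'⟩ ⟨hm, h9', hO, hR⟩
    simp only at hm h9' hO hR
    subst hm
    have := hy.2.2.1
    refine WP.mono (ih R' O' y (by omega) hy.2.1 (by omega) ((hR 3 (by omega)).trans h3) h9')
      le_rfl ?_
    rintro s' ⟨a, b⟩
    refine ⟨a, ?_⟩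
    rw [b, hO, add_assoc]
  · have h0 : ones p B (p.pos z) (p.pos Ye) = 0 := ones_eq_zero fun x h1 h2 =>
      absurd (h1.trans_lt h2) (Par.pos_mono (by omega)).not_gt
    rw [h0]
    exact WP.mono (WP.loop_false ⟨by omega, by omega⟩ (fun h : R 9 < R 3 => by omega)
      ⟨rfl, by simp⟩) (by omega) fun _ h => h

end ZeroReport

end

/-! ### Reporting the ones of an interval -/

section
open Finset
namespace ZeroReport
open Chunk Trie WordRAM BitVector

variable {p : Par} {B : Fin p.n → Bool} {g : Ghost}

/-- Test whether chunk `v 7` is strictly between `v 2` and `v 3` and has a one. -/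
def checkP : Cmd :=
  .seq (setE 25 (.k 0)) <| .ite (.lt 2 7) (.ite (.lt 7 3)
    (setE 25 (tabE 3 (fldE 0 (.v 7)) (.k 0) (.k 0) (.k 0))) .skip) .skip

open Function Classical in
theorem checkP_spec {m R : ℕ → ℕ} {O : List ℕ} (hC : Core p (pat p B) g m) {Ys y Ye : ℕ}
    (hy : Leaf p.h y) (h2 : R 2 = Ys) (h3 : R 3 = Ye) (h7 : R 7 = y) :
    WP p.w p.S checkP ⟨R, m, O⟩ 70 fun s' => s'.mem = m ∧ s'.out = O ∧
      (s'.reg 25 = if Ys < y ∧ y < Ye ∧ y ∈ Alive p B then 1 else 0) ∧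
      ∀ i, i ≠ 25 → s'.reg i = R i := by
  have hlit : (1 : ℕ) < 2 ^ p.w := Par.lit (by omega)
  refine .set_seq (x := 0) (by omega) Core.ev_zero (by decide) ?_
  have hR : ∀ v i, i ≠ 25 → update R 25 v i = R i := fun v i hi => update_of_ne hi _ _
  refine .ite_le ⟨by omega, by omega⟩ (by decide) (fun h => ?_) fun h => ?_
  · replace h : Ys < y := by rw [← h2, ← h7]; exact h
    refine .ite_le ⟨by omega, by omega⟩ (by decide) (fun h' => ?_) fun h' => ?_
    · replace h' : y < Ye := by rw [← h3, ← h7]; exact h'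
      obtain ⟨e1, e2⟩ := hC.ginv.encH_spec hC.sub hy
      refine .set_le (x := if Ys < y ∧ y < Ye ∧ y ∈ Alive p B then 1 else 0) (by omega)
        (Ev.tab hC.stat (by omega) (Ev.fld' (Ev.reg (by omega) h7) hy.2 (by omega)
        (hC.gmem.hdr y hy)) Core.ev_zero Core.ev_zero Core.ev_zero e1
        Core.Q_pos Core.Q_pos Core.Q_pos ?_ ?_) (by decide) ⟨rfl, rfl, rfl, fun i hi => ?_⟩
      · rw [Par.F, e2]
        refine if_congr ?_ rfl rfl
        rw [and_iff_right h, and_iff_right h', Alive, Set.mem_ofPred_eq, and_iff_right hy]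
        exact exists_congr fun j => and_congr_right fun hj => (hC.ginv.inv y hy).ne j hj
      · split_ifs
        · exact hlit
        · exact Par.lit (by omega)
      · exact (update_of_ne hi _ _).trans (hR 0 i hi)
    · replace h' : ¬ y < Ye := by rw [← h3, ← h7]; exact h'
      refine .skip_le (by decide) ⟨rfl, rfl, ?_, hR _⟩
      rw [if_neg (by tauto)]; rfl
  · replace h : ¬ Ys < y := by rw [← h2, ← h7]; exact h
    refine .skip_le (by decide) ⟨rfl, rfl, ?_, hR _⟩
    rw [if_neg (by tauto)]; rfl

/-- Search for a chunk with a one strictly between `v 2` and `v 3`. -/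
def searchP : Cmd :=
  .seq (.seq (setE 24 (.k 0)) <| .seq (setE 4 (.v 2 + .k 1)) <| .seq (setE 5 (.v 3 - .k 1)) <|
    .seq (setE 6 (fldE 5 (.bin .xor (.v 4) (.v 5)))) <| .seq (setE 7 (.v 5)) (setE 8 (.v 6))) <|
  .seq (descP 3) <| .seq checkP <|
  .ite (.eq 24 25) (.seq (.seq (setE 7 (.v 4)) (setE 8 (.v 6))) <| .seq (descP 4) checkP) .skip

def searchT (k : ℕ) : ℕ := 200 * k + 500

/-- The two children of the lowest common ancestor. -/
theorem shiftRight_eq_or {x y z j : ℕ} (hj : j = Nat.size (x ^^^ y) - 1) (hxz : x ≤ z)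
    (hzy : z ≤ y) : z >>> j = x >>> j ∨ z >>> j = y >>> j := by
  have h1 := shiftRight_mono j hxz
  have h2 := shiftRight_mono j hzy
  have h3 : x >>> (j + 1) = y >>> (j + 1) := shiftRight_eq_iff.2 (by omega)
  rw [Nat.shiftRight_succ, Nat.shiftRight_succ] at h3
  omega

-- Take a chunk with a one in the interval. If it is below the right child of the lowest common
-- ancestor, then the first chunk with a one below that child does not exceed it, and it lies beyond
-- the left end since the left end is below the other child. Below the left child the last one
-- serves in the same way. Both candidates are tested, so a useless result of a descent does no
-- harm.
open Function Classical in
theorem searchP_spec {m R : ℕ → ℕ} {O : List ℕ} (hM : Rep p B g m) {Ys Ye : ℕ}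
    (hYs : p.Y₀ ≤ Ys) (hlt : Ys + 1 < Ye) (hYe : Ye < p.D) (h2 : R 2 = Ys) (h3 : R 3 = Ye) :
    WP p.w p.S searchP ⟨R, m, O⟩ (searchT p.k) fun s' => s'.mem = m ∧ s'.out = O ∧
      s'.reg 24 = 0 ∧ s'.reg 2 = Ys ∧ s'.reg 3 = Ye ∧
      ((s'.reg 25 = 1 ∧ Ys < s'.reg 7 ∧ s'.reg 7 < Ye ∧ s'.reg 7 ∈ Alive p B) ∨
       (s'.reg 25 = 0 ∧ ∀ Y, Ys < Y → Y < Ye → Y ∉ Alive p B)) := by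
  have hlo : Leaf p.h (Ys + 1) := ⟨by unfold Par.Y₀ at hYs; omega, by unfold Par.D at hYe; omega⟩
  have hhi : Leaf p.h (Ye - 1) := ⟨by unfold Par.Y₀ at hYs; omega, by unfold Par.D at hYe; omega⟩
  have hx : (Ys + 1) ^^^ (Ye - 1) < p.D := Nat.xor_lt_two_pow hlo.2 hhi.2
  obtain ⟨j, hj⟩ : ∃ j, j = Nat.size ((Ys + 1) ^^^ (Ye - 1)) - 1 := ⟨_, rfl⟩
  have hjh : j ≤ p.h := by have := hlo.size_xor_le hhi; omega
  have hAD : ∀ a ∈ Alive p B, a < p.D := fun a ha => ha.1.2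
  unfold searchP searchT
  refine WP.mono (t := 60 + (100 * p.k + 1 + (70 + (100 * p.k + 200)))) (WP.seq ?_) (by omega)
    fun _ h => h
  refine .set_seq (x := 0) (by omega) Core.ev_zero (by decide) ?_
  refine .set_seq (x := Ys + 1) (by omega) (.add (Ev.reg (by omega) h2) (.k (Par.lit (by omega)))
    (Par.of_lt_D hlo.2)) (by decide) ?_
  refine .set_seq (x := Ye - 1) (by omega) (.sub (Ev.reg (by omega) h3) (.k (Par.lit (by omega)))
    (by omega)) (by decide) ?_
  refine .set_seq (x := j) (by omega) (Ev.fld' (.xor (Ev.reg (by omega) rfl) (Ev.reg (by omega) rfl))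
    hx (by omega) ((hM.core.stat.bl _ hx).trans hj.symm)) (by decide) ?_
  refine .set_seq (x := Ye - 1) (by omega) (Ev.reg (by omega) rfl) (by decide) ?_
  refine .set_le (x := j) (by omega) (Ev.reg (by omega) rfl) (by decide) ?_
  refine WP.seq (WP.mono (descP_spec hM.core.stat (by omega) hM.min hM.min_leaf
    (j₀ := j) (v₀ := (Ye - 1) >>> j) p.k _ (Ye - 1) j (by omega) rfl rfl rfl hhi le_rfl
    hjh fun x hx => hx.2.1.symm) le_rfl ?_)
  rintro ⟨R₁, m₁, O₁⟩ ⟨hm, hO, hleaf, hfirst, hR⟩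
  simp only at hm hO hleaf hfirst hR
  subst hm hO
  have e2 : R₁ 2 = Ys := (hR 2 (by omega) (by omega)).trans h2
  have e3 : R₁ 3 = Ye := (hR 3 (by omega) (by omega)).trans h3
  have e4 : R₁ 4 = Ys + 1 := hR 4 (by omega) (by omega)
  have e6 : R₁ 6 = j := hR 6 (by omega) (by omega)
  have e24 : R₁ 24 = 0 := hR 24 (by omega) (by omega)
  refine WP.seq (WP.mono (checkP_spec hM.core hleaf e2 e3 rfl) le_rfl ?_)
  rintro ⟨R₂, m₂, O₂⟩ ⟨hm, hO, h25, hR₂⟩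
  simp only at hm hO h25 hR₂
  subst hm hO
  refine WP.mono (WP.ite (t := 100 * p.k + 199) ⟨by omega, by omega⟩ (fun hc => ?_) fun hc => ?_)
    (by omega) fun _ h => h
  · replace hc : R₂ 24 = R₂ 25 := hc
    rw [h25, hR₂ 24 (by omega), e24] at hc
    have hno : ¬ (Ys < R₁ 7 ∧ R₁ 7 < Ye ∧ R₁ 7 ∈ Alive p B) := fun h => by
      rw [if_pos h] at hc; omega
    refine WP.mono (t := 20 + (100 * p.k + 1 + 70)) (WP.seq ?_) (by omega) fun _ h => h
    refine .set_seq (x := Ys + 1) (by omega) (Ev.reg (by omega) ((hR₂ 4 (by omega)).trans e4))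
      (by decide) ?_
    refine .set_le (x := j) (by omega) (Ev.reg (by omega) ((hR₂ 6 (by omega)).trans e6))
      (by decide) ?_
    refine WP.seq (WP.mono (descP_spec hM.core.stat (by omega) hM.max hM.max_leaf
      (j₀ := j) (v₀ := (Ys + 1) >>> j) p.k _ (Ys + 1) j (by omega) rfl rfl
      ((hR₂ 24 (by omega)).trans e24) hlo le_rfl hjh fun x hx => hx.2.1.symm) le_rfl ?_)
    rintro ⟨R₃, m₃, O₃⟩ ⟨hm, hO, hleaf', hfirst', hR₃⟩
    simp only at hm hO hleaf' hfirst' hR₃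
    subst hm hO
    have hRR : ∀ i, i ≠ 7 → i ≠ 8 → i ≠ 25 → R₃ i = R₁ i := fun i a b c => by
      rw [hR₃ i a b, update_of_ne b, update_of_ne a, hR₂ i c]
    refine WP.mono (checkP_spec hM.core hleaf' ((hRR 2 (by omega) (by omega) (by omega)).trans e2)
      ((hRR 3 (by omega) (by omega) (by omega)).trans e3) rfl) le_rfl ?_
    rintro ⟨R₄, m₄, O₄⟩ ⟨hm, hO, h25', hR₄⟩
    simp only at hm hO h25' hR₄
    subst hm hO
    refine ⟨rfl, rfl, ?_, ?_, ?_, ?_⟩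
    · exact (hR₄ 24 (by omega)).trans ((hRR 24 (by omega) (by omega) (by omega)).trans e24)
    · exact (hR₄ 2 (by omega)).trans ((hRR 2 (by omega) (by omega) (by omega)).trans e2)
    · exact (hR₄ 3 (by omega)).trans ((hRR 3 (by omega) (by omega) (by omega)).trans e3)
    · have e7 : R₄ 7 = R₃ 7 := hR₄ 7 (by omega)
      simp only [e7]
      by_cases hyes : Ys < R₃ 7 ∧ R₃ 7 < Ye ∧ R₃ 7 ∈ Alive p B
      · exact .inl ⟨by rw [h25', if_pos hyes], hyes⟩
      · refine .inr ⟨by rw [h25', if_neg hyes], fun Y hY1 hY2 hY => ?_⟩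
        -- In case of equality there is a single chunk to consider, the height is `0`, and there are
        -- no two children.
        rcases (shiftRight_mono j (show Ys + 1 ≤ Ye - 1 by omega)).eq_or_lt with heq | hne
        · have hj0 := shiftRight_eq_iff.1 heq
          obtain rfl : j = 0 := by omega
          simp only [Nat.shiftRight_zero] at heq
          obtain ⟨x, hx⟩ := exists_isFirst (lt := (· < ·)) (j := 0) (v := (Ye - 1) >>> 0)
            (.inl rfl) hAD hY (by simp only [Nat.shiftRight_zero]; omega)
          have h1 := hfirst x hx
          have h2 := hx.2.1
          simp only [Nat.shiftRight_zero] at h2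
          exact hno (h1 ▸ ⟨by omega, by omega, hx.1⟩)
        rcases shiftRight_eq_or hj (show Ys + 1 ≤ Y by omega) (show Y ≤ Ye - 1 by omega) with h | h
        · obtain ⟨x, hx⟩ := exists_isFirst (lt := (· > ·)) (.inr rfl) hAD hY h
          have h1 := hfirst' x hx
          have h2 := hx.2.2 Y hY h
          have h3 := hx.2.1
          refine hyes (h1 ▸ ⟨by omega, ?_, hx.1⟩)
          by_contra hh
          have h4 : (Ye - 1) >>> j ≤ x >>> j := shiftRight_mono j (by omega)
          omega
        · obtain ⟨x, hx⟩ := exists_isFirst (lt := (· < ·)) (.inl rfl) hAD hY h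
          have h1 := hfirst x hx
          have h2 := hx.2.2 Y hY h
          have h3 := hx.2.1
          refine hno (h1 ▸ ⟨?_, by omega, hx.1⟩)
          by_contra hh
          have h4 : x >>> j ≤ (Ys + 1) >>> j := shiftRight_mono j (by omega)
          omega
  · replace hc : ¬ R₂ 24 = R₂ 25 := hc
    rw [h25, hR₂ 24 (by omega), e24] at hc
    have hyes : Ys < R₁ 7 ∧ R₁ 7 < Ye ∧ R₁ 7 ∈ Alive p B := by
      by_contra h
      rw [if_neg h] at hc; exact hc rfl
    refine .skip_le (by omega) ⟨rfl, rfl, (hR₂ 24 (by omega)).trans e24,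
      (hR₂ 2 (by omega)).trans e2, (hR₂ 3 (by omega)).trans e3, .inl ⟨?_, ?_⟩⟩
    · simp only; rw [h25, if_pos hyes]
    · simp only; rw [hR₂ 7 (by omega)]; exact hyes

/-- Report all chunks strictly between `v 2` and `v 3`. -/
def midP : Cmd :=
  .seq searchP <| .ite (.lt 24 25) (.seq (setE 9 (.v 7)) <| .seq downP <|
    .seq (setE 9 (fldE 1 (.v 7))) upP) .skip

/-- One chunk with a one suffices as an entry into the list: the list is followed from it downwards,
and from its successor upwards. -/
theorem midP_spec {m R : ℕ → ℕ} {O : List ℕ} (hM : Rep p B g m) {Ys Ye : ℕ}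
    (hYs : p.Y₀ ≤ Ys) (hlt : Ys + 1 < Ye) (hYe : Ye < p.D) (hn : p.pos Ye ≤ p.n)
    (h2 : R 2 = Ys) (h3 : R 3 = Ye) :
    WP p.w p.S midP ⟨R, m, O⟩
      (searchT p.k + walkT * (ones p B (p.pos (Ys + 1)) (p.pos Ye)).card + 100) fun s' =>
        s'.mem = m ∧
        (s'.out : Multiset ℕ) = (O : Multiset ℕ) + ones p B (p.pos (Ys + 1)) (p.pos Ye) := by
  unfold midP
  refine WP.mono (t := _ + (walkT * (ones p B (p.pos (Ys + 1)) (p.pos Ye)).card + 100)) (WP.seq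
    (WP.mono (searchP_spec hM hYs hlt hYe h2 h3) le_rfl ?_)) (by omega) fun _ h => h
  rintro ⟨R₁, m₁, O₁⟩ ⟨hm, hO, h24, e2, e3, hcase⟩
  simp only at hm hO h24 e2 e3 hcase
  subst hm hO
  refine WP.mono (WP.ite (t := walkT * (ones p B (p.pos (Ys + 1)) (p.pos Ye)).card + 50)
    ⟨by omega, by omega⟩ (fun hc => ?_) fun hc => ?_) (by omega) fun _ h => h
  · replace hc : R₁ 24 < R₁ 25 := hc
    rcases hcase with ⟨-, h7, h7', hal⟩ | ⟨h, -⟩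
    swap
    · omega
    obtain ⟨y, hy⟩ : ∃ y, y = R₁ 7 := ⟨_, rfl⟩
    rw [← hy] at h7 h7' hal
    obtain ⟨z, hz⟩ := exists_next hal (alive_last B) (by unfold Par.D at hYe; omega)
    have hyz := hz.2.2.1
    have hzD : z < p.D := hz.2.1.1.2
    have hsplit : ones p B (p.pos (Ys + 1)) (p.pos Ye) =
        ones p B (p.pos (Ys + 1)) (p.pos (y + 1)) + ones p B (p.pos z) (p.pos Ye) := by
      rw [ones_append (Par.pos_mono (show Ys + 1 ≤ y + 1 by omega)) (Par.pos_mono h7')]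
      congr 1
      rcases Nat.le_total z Ye with h | h
      · rw [ones_append (Par.pos_mono (Nat.succ_le_of_lt hz.2.2.1)) (Par.pos_mono h),
          ones_gap (by omega) hzD.le hyz fun Y h1 h2 hY => hz.2.2.2 Y hY ⟨by omega, h2⟩,
          zero_add]
      · rw [ones_gap (by omega) hYe.le h7' fun Y h1 h2 hY => hz.2.2.2 Y hY ⟨h1, by omega⟩,
          ones_eq_zero fun x h1 h2 => absurd (h1.trans_lt h2) (Par.pos_mono h).not_gt]
    rw [hsplit, Multiset.card_add]
    refine WP.mono (WP.seq (t := 3) (t' := walkT * (ones p B (p.pos (Ys + 1)) (p.pos (y + 1))).card + 1 +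
      (15 + (walkT * (ones p B (p.pos z) (p.pos Ye)).card + 1)))
      (.set_le (x := y) (by omega) (Ev.reg (by omega) hy.symm) (by decide) ?_))
      (by unfold walkT; omega) fun _ h => h
    refine WP.seq (WP.mono (downP_spec hM hYs y _ _ hal ((Par.pos_mono h7').trans hn) e2 rfl) le_rfl ?_)
    rintro ⟨R₂, m₂, O₂⟩ ⟨hm, hO, hR⟩
    simp only at hm hO hR
    subst hm
    refine WP.seq (.set_le (x := z) (by omega) (Ev.fld' (x := y) (Ev.reg (by omega)
      ((hR 7 (by omega)).trans hy.symm)) hal.1.2 (by omega) (hM.list _ _ hz).1) (by decide) ?_)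
    refine WP.mono (upP_spec hM hYe hn p.D _ _ z (by omega) hz.2.1 (by omega)
      ((hR 3 (by omega)).trans e3) rfl) le_rfl ?_
    rintro s' ⟨a, b⟩
    exact ⟨a, by rw [b, hO, add_assoc]⟩
  · replace hc : ¬ R₁ 24 < R₁ 25 := hc
    rcases hcase with ⟨h, -⟩ | ⟨-, h⟩
    · omega
    · refine .skip_le (by omega) ⟨rfl, ?_⟩
      rw [ones_gap (by omega) hYe.le hlt.le fun Y h1 h2 => h Y h1 h2, add_zero]

/-- Report the ones at the positions from `v 0` to `v 1`. -/
def reportP : Cmd :=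
  .ite (.lt 1 0) .skip <|
  .seq (
    .seq (setE 2 (.v 0 / par 0 + par 7)) <|
    .seq (setE 3 (.v 1 / par 0 + par 7)) <|
    .seq (setE 21 (.v 0 - .v 0 / par 0 * par 0)) <|
    .seq (setE 22 (.v 1 - .v 1 / par 0 * par 0 + .k 1)) <|
    .seq (setE 10 (.v 2)) (setE 14 (.v 21))) <|
  .ite (.eq 2 3) (.seq (setE 15 (.v 22)) scanP) <|
  .seq (setE 15 (par 0)) <| .seq scanP <|
  .seq (.seq (setE 10 (.v 3)) <| .seq (setE 14 (.k 0)) (setE 15 (.v 22))) <|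
  .seq scanP <| .seq (setE 4 (.v 2 + .k 1)) <|
  .ite (.lt 4 3) midP .skip

def reportT (k : ℕ) : ℕ := searchT k + 2000

theorem Par.pos_add {x : ℕ} (p : Par) : p.pos (p.chunk x) + (x - x / p.L * p.L) = x := by
  unfold Par.pos Par.chunk
  have := Nat.div_mul_le_self x p.L
  rw [Nat.add_sub_cancel]
  omega

theorem scanP_interval {m R : ℕ → ℕ} {O : List ℕ} (hC : Core p (pat p B) g m) {Y a b : ℕ}
    (x q : ℕ) (hY : Leaf p.h Y) (hY₀ : p.Y₀ ≤ Y) (ha : p.pos Y + x = a) (hb : p.pos Y + q = b)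
    (hab : a < b) (hq : q ≤ p.L) (hn : b ≤ p.n) (h10 : R 10 = Y) (h14 : R 14 = x) (h15 : R 15 = q) :
    WP p.w p.S scanP ⟨R, m, O⟩ (scanT * ((ones p B a b).card + 1)) fun s' => s'.mem = m ∧
      (s'.out : Multiset ℕ) = (O : Multiset ℕ) + ones p B a b ∧
        ∀ i, (i < 11 ∨ 20 < i) → s'.reg i = R i := by
  subst ha hb
  exact scanP_spec hC hY hY₀ (by omega) hq hn h10 h14 h15

/-- Only the scans of the two end chunks and the search between them may be without output; they
cost a constant that depends on `k` alone. -/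
theorem reportP_spec {m R : ℕ → ℕ} {O : List ℕ} (hM : Rep p B g m) {s e : ℕ} (hs : s < p.n)
    (he : e < p.n) (h0 : R 0 = s) (h1 : R 1 = e) :
    WP p.w p.S reportP ⟨R, m, O⟩ (reportT p.k * ((ones p B s (e + 1)).card + 1)) fun s' =>
        s'.mem = m ∧ (s'.out : Multiset ℕ) = (O : Multiset ℕ) + ones p B s (e + 1) := by
  have hnw := p.n_le
  rcases Nat.lt_or_ge e s with hse | hse
  · rw [ones_eq_zero (a := s) (b := e + 1) fun x _ _ => by omega]
    exact WP.mono (t := 2) (.ite_le ⟨by omega, by omega⟩ (by omega) (fun _ => .skip_le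
      (by omega) ⟨rfl, by simp⟩) fun h => absurd (show R 1 < R 0 by omega) h)
      (by unfold reportT; simp only [Multiset.card_zero]; omega) fun _ h => h
  have hL := p.L_pos
  have hCs := Par.leaf_chunk hs
  have hCe := Par.leaf_chunk he
  have hps := p.pos_add (x := s)
  have hpe := p.pos_add (x := e)
  have hms : s - s / p.L * p.L < p.L := by
    have := Nat.div_add_mod' s p.L; have := Nat.mod_lt s hL; omega
  have hme : e - e / p.L * p.L < p.L := by
    have := Nat.div_add_mod' e p.L; have := Nat.mod_lt e hL; omega
  have hYs : p.Y₀ ≤ p.chunk s := Nat.le_add_left _ _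
  have hYe : p.Y₀ ≤ p.chunk e := Nat.le_add_left _ _
  have hYse : p.chunk s ≤ p.chunk e := Nat.add_le_add_right (Nat.div_le_div_right hse) _
  have hC := hM.core
  have hdm : ∀ x, x / p.L * p.L ≤ x := fun x => Nat.div_mul_le_self x p.L
  have hdms := hdm s
  have hdme := hdm e
  have hT : searchT p.k + 2000 = reportT p.k := rfl
  have hT3 : 2000 * ((ones p B s (e + 1)).card + 1) + searchT p.k ≤
      reportT p.k * ((ones p B s (e + 1)).card + 1) := by
    rw [← hT, Nat.add_mul]
    have := Nat.le_mul_of_pos_right (searchT p.k)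
      (show 0 < (ones p B s (e + 1)).card + 1 by omega)
    omega
  refine WP.mono (t := (200 + (scanT * ((ones p B s (e + 1)).card + 1) + (scanT + (searchT p.k +
    (walkT * (ones p B s (e + 1)).card + 300))))) + 1)
    (WP.ite ⟨by omega, by omega⟩ (fun h => absurd h (show ¬ R 1 < R 0 by omega)) fun _ => ?_)
    (le_trans ?_ hT3) fun _ h => h
  swap
  · rw [show scanT = 600 from rfl, show walkT = 1301 from rfl]
    clear hT3 hT
    omega
  refine WP.seq ?_
  refine .set_seq (x := p.chunk s) (by omega) (.add (.div (Ev.reg (by omega) h0)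
    (Ev.par' (by omega) hC.stat.L)) (Ev.par' (by omega) hC.stat.Y₀) (Par.of_lt_D hCs.2))
    (by decide) ?_
  refine .set_seq (x := p.chunk e) (by omega) (.add (.div (Ev.reg (by omega) h1)
    (Ev.par' (by omega) hC.stat.L)) (Ev.par' (by omega) hC.stat.Y₀) (Par.of_lt_D hCe.2))
    (by decide) ?_
  refine .set_seq (x := s - s / p.L * p.L) (by omega) (.sub (Ev.reg (by omega) h0) (.mul (.div
    (Ev.reg (by omega) h0) (Ev.par' (by omega) hC.stat.L)) (Ev.par' (by omega) hC.stat.L)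
    (by omega)) (by omega)) (by decide) ?_
  refine .set_seq (x := e - e / p.L * p.L + 1) (by omega) (.add (.sub (Ev.reg (by omega) h1) (.mul (.div
    (Ev.reg (by omega) h1) (Ev.par' (by omega) hC.stat.L)) (Ev.par' (by omega) hC.stat.L)
    (by omega)) (by omega)) (.k (Par.lit (by omega))) (Par.of_lt_L (by omega))) (by decide) ?_
  refine .set_seq (x := p.chunk s) (by omega) (Ev.reg (by omega) rfl) (by decide) ?_
  refine .set_le (x := s - s / p.L * p.L) (by omega) (Ev.reg (by omega) rfl) (by decide) ?_
  by_cases hYY : p.chunk s = p.chunk e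
  · refine WP.mono (t := 10 + scanT * ((ones p B s (e + 1)).card + 1) + 1) (WP.ite ⟨by omega, by omega⟩
      (fun _ => WP.seq ?_) fun h => absurd hYY h) (by omega) fun _ h => h
    refine .set_le (x := e - e / p.L * p.L + 1) (by omega) (Ev.reg (by omega) rfl) (by decide) ?_
    exact WP.mono (scanP_interval hC (s - s / p.L * p.L) (e - e / p.L * p.L + 1) hCs hYs hps
      (by rw [hYY]; omega) (by omega) hme he rfl rfl rfl) le_rfl fun s' h => ⟨h.1, h.2.1⟩
  · have hlt : p.chunk s < p.chunk e := by omega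
    have hpL := Par.pos_succ hYs
    have hpLe : p.pos (p.chunk s + 1) ≤ p.pos (p.chunk e) := Par.pos_mono hlt
    have hsplit : ones p B s (e + 1) = ones p B s (p.pos (p.chunk s + 1)) +
        (ones p B (p.pos (p.chunk s + 1)) (p.pos (p.chunk e)) +
          ones p B (p.pos (p.chunk e)) (e + 1)) := by
      rw [← ones_append hpLe (by omega), ← ones_append (by omega) (by omega)]
    have hcard := congrArg Multiset.card hsplit
    rw [Multiset.card_add, Multiset.card_add] at hcard
    refine WP.mono (t := 10 + (scanT * ((ones p B s (p.pos (p.chunk s + 1))).card + 1) +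
      (20 + (scanT * ((ones p B (p.pos (p.chunk e)) (e + 1)).card + 1) + (10 + (searchT p.k +
      walkT * (ones p B (p.pos (p.chunk s + 1)) (p.pos (p.chunk e))).card + 100 + 1))))) + 1)
      (WP.ite ⟨by omega, by omega⟩ (fun h => absurd h hYY) fun _ => WP.seq ?_)
      (by unfold scanT walkT; omega) fun _ h => h
    refine .set_le (x := p.L) (by omega) (Ev.par' (by omega) hC.stat.L) (by decide) ?_
    refine WP.seq (WP.mono (scanP_interval hC (s - s / p.L * p.L) p.L hCs hYs hps hpL.symm (by omega)
      le_rfl (by omega) rfl rfl rfl) le_rfl ?_)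
    rintro ⟨R₁, m₁, O₁⟩ ⟨hm, hO₁, hR₁⟩
    simp only at hm hO₁ hR₁
    subst hm
    refine WP.seq ?_
    refine .set_seq (x := p.chunk e) (by omega) (Ev.reg (by omega) (hR₁ 3 (by omega))) (by decide) ?_
    refine .set_seq (x := 0) (by omega) Core.ev_zero (by decide) ?_
    refine .set_le (x := e - e / p.L * p.L + 1) (by omega) (Ev.reg (by omega) (hR₁ 22 (by omega)))
      (by decide) ?_
    refine WP.seq (WP.mono (scanP_interval hC 0 (e - e / p.L * p.L + 1) hCe hYe rfl (by omega)
      (by omega) hme he rfl rfl rfl) le_rfl ?_)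
    rintro ⟨R₂, m₂, O₂⟩ ⟨hm, hO₂, hR₂⟩
    simp only [add_zero] at hm hO₂ hR₂
    subst hm
    have e2 : R₂ 2 = p.chunk s := (hR₂ 2 (by omega)).trans (hR₁ 2 (by omega))
    have e3 : R₂ 3 = p.chunk e := (hR₂ 3 (by omega)).trans (hR₁ 3 (by omega))
    refine WP.seq (.set_le (x := p.chunk s + 1) (by omega) (.add (Ev.reg (by omega) e2)
      (.k (Par.lit (by omega))) (Par.of_lt_D (by have := hCe.2; unfold Par.D; omega))) (by decide) ?_)
    refine WP.ite ⟨by omega, by omega⟩ (fun hc => ?_) fun hc => ?_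
    · replace hc : p.chunk s + 1 < R₂ 3 := hc
      refine WP.mono (midP_spec hM hYs (e3 ▸ hc) hCe.2 (by omega) e2 e3) le_rfl ?_
      rintro s' ⟨a, b⟩
      refine ⟨a, ?_⟩
      rw [b, hO₂, hO₁, hsplit, add_assoc, add_assoc, add_comm (ones p B (p.pos (p.chunk e)) (e + 1))]
    · replace hc : ¬ p.chunk s + 1 < R₂ 3 := hc
      have heq : p.chunk s + 1 = p.chunk e := by omega
      refine .skip_le (by omega) ⟨rfl, ?_⟩
      rw [hO₂, hO₁, hsplit, heq, add_assoc]
      congr 2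
      rw [ones_eq_zero (a := p.pos (p.chunk e)) (b := p.pos (p.chunk e)) fun x _ _ => by omega,
        zero_add]

end ZeroReport

end

section
open Finset
namespace Chunk
variable {r β Z : ℕ} {cell : ℕ → Cell} {own : ℕ → ℕ} {cnt Y : ℕ} {H : Hdr}
  {pat pat' : ℕ → Finset ℕ} {nb : ℕ}

theorem Inv.congr (hI : Inv r β Z cell own cnt Y H pat nb) (h : ∀ j < r, pat' j = pat j) :
    Inv r β Z cell own cnt Y H pat' nb := by
  have hw : ∀ f id, weight r Z H.slot pat' f id = weight r Z H.slot pat f id := fun f id =>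
    sum_congr rfl fun j hj => by rw [h j (mem_range.1 hj)]
  have hs : ∑ j ∈ range r, cap Z #(pat' j) = ∑ j ∈ range r, cap Z #(pat j) :=
    sum_congr rfl fun j hj => by rw [h j (mem_range.1 hj)]
  refine ⟨fun j hj => ?_, fun j hj => ?_, hI.beyond, hI.slot_lt, hI.opn_lt, hI.slot_own,
    fun j hj => ?_, fun j hj => ?_, fun j hj => ?_, fun id f => ?_, ?_, hI.fill_le, ?_⟩
  · rw [h j hj]; exact hI.content j hj
  · rw [h j hj]; exact hI.ne j hj
  · rw [h j hj]; exact hI.slot_ne j hj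
  · rw [h j hj]; exact hI.big j hj
  · rw [h j hj]; exact hI.small j hj
  · rw [hw]; exact hI.weight_le id f
  · simp only [hw]; exact hI.opn
  · rw [hs]; exact hI.count

end Chunk

namespace ZeroReport
open Chunk Trie WordRAM BitVector Function

variable {p : Par} {B : Fin p.n → Bool} {g : Ghost} {A : Set ℕ} {m m' : ℕ → ℕ}

theorem GInv.congr {P P' : ℕ → ℕ → Finset ℕ} (hG : GInv p P g)
    (h : ∀ Y, ∀ j < p.r, P' Y j = P Y j) : GInv p P' g :=
  { hG with inv := fun Y hY => (hG.inv Y hY).congr (h Y) }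

/-! ### Changes of the memory -/

/-- The addresses of the pointers. -/
def Par.Ptr (p : Par) (a : ℕ) : Prop := ∃ x f, 1 ≤ x ∧ x < p.D ∧ 1 ≤ f ∧ f ≤ 4 ∧ a = 16 * x + f

theorem Par.Ptr.wr {a : ℕ} (h : p.Ptr a) : p.Wr a := by
  obtain ⟨x, f, h1, h2, h3, h4, h5⟩ := h
  exact .inr (.inl ⟨x, f, h1, h2, by omega, by omega, h5⟩)

theorem Par.Grp.one_le {s : ℕ} (h : p.Grp s) : 1 ≤ s * p.K := by
  have := (Par.grp_bounds h).1
  have : 0 < 2 ^ p.h := by positivity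
  omega

theorem Leaf.pos {h Y : ℕ} (hY : Leaf h Y) : 1 ≤ Y := by
  have := hY.1
  have : 0 < 2 ^ h := by positivity
  omega

theorem Par.fld_lt_HB {x f : ℕ} (hx : x < p.D) (hf : f < 16) : 16 * x + f < p.HB := by
  unfold Par.HB Par.TB
  omega

theorem Par.not_ptr {x f : ℕ} (hf : f < 16) (h : f = 0 ∨ 4 < f) : ¬ p.Ptr (16 * x + f) := by
  rintro ⟨x', f', h1, h2, h3, h4, h5⟩
  omega

theorem Par.not_ptr_of_HB_le {a : ℕ} (ha : p.HB ≤ a) : ¬ p.Ptr a := by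
  rintro ⟨x', f', h1, h2, h3, h4, h5⟩
  have := Par.fld_lt_HB h2 (by omega : f' < 16)
  omega

/-- Deleting a chunk from the list and the trie writes pointers only, which the headers, cells and
page tables do not share. -/
theorem Core.congr {P : ℕ → ℕ → Finset ℕ} (hC : Core p P g m) (h : ∀ a, ¬ p.Ptr a → m' a = m a) :
    Core p P g m' := by
  refine ⟨hC.stat.congr fun a ha => h a fun h' => ha h'.wr, hC.ginv, ⟨fun Y hY => ?_,
    fun s hs i hi => ?_, fun s hs => ?_, fun s hs id hid => ?_, ?_⟩, hC.sub, hC.room⟩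
  · rw [h _ (Par.not_ptr (by omega) (by omega))]; exact hC.gmem.hdr Y hY
  · rw [h _ (Par.not_ptr (by omega) (by omega))]; exact hC.gmem.pt s hs i hi
  · rw [h _ (Par.not_ptr (by omega) (by omega))]; exact hC.gmem.cnt s hs
  · rw [h _ (Par.not_ptr_of_HB_le (by omega))]; exact hC.gmem.cell s hs id hid
  · rw [h 6 (Par.not_ptr (x := 0) (f := 6) (by omega) (by omega))]; exact hC.gmem.bump

theorem Links.congr (hL : Links p A m) (hA : ∀ a ∈ A, Leaf p.h a)
    (h : ∀ x f, 1 ≤ x → x < p.D → 1 ≤ f → f ≤ 4 → m' (16 * x + f) = m (16 * x + f)) :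
    Links p A m' := by
  have hv : ∀ {lt : ℕ → ℕ → Prop} {j v x : ℕ}, j ≤ p.h → IsFirst lt A j v x → 1 ≤ v ∧ v < p.D :=
    fun {lt j v x} hj hx => hx.2.1 ▸ ⟨Leaf.one_le_shiftRight (hA x hx.1) hj,
      (hA x hx.1).shiftRight_lt j⟩
  refine ⟨fun x y hxy => ?_, fun j h1 h2 v x hx => ?_, fun j h1 h2 v x hx => ?_,
    fun v h1 h2 => ?_, fun v h1 h2 => ?_⟩
  · rw [h x 1 (Leaf.pos (hA x hxy.1)) (hA x hxy.1).2 (by omega) (by omega),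
      h y 2 (Leaf.pos (hA y hxy.2.1)) (hA y hxy.2.1).2 (by omega) (by omega)]
    exact hL.list x y hxy
  · simp only [h v 3 (hv h2 hx).1 (hv h2 hx).2 (by omega) (by omega)]
    exact hL.min j h1 h2 v x hx
  · simp only [h v 4 (hv h2 hx).1 (hv h2 hx).2 (by omega) (by omega)]
    exact hL.max j h1 h2 v x hx
  · rw [h v 3 h1 h2 (by omega) (by omega)]; exact hL.min_leaf v h1 h2
  · rw [h v 4 h1 h2 (by omega) (by omega)]; exact hL.max_leaf v h1 h2

/-- The address of a cell. -/
def Par.addr (p : Par) (g : Ghost) (s id : ℕ) : ℕ := p.HB + p.K * g.pg s (id / p.K) + id % p.K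

/-- An address determines the page and the place in it by division by `K`, and different page table
entries in use refer to different pages. -/
theorem GInv.addr_inj {P : ℕ → ℕ → Finset ℕ} (hG : GInv p P g) {s s' id id' : ℕ} (hs : p.Grp s)
    (hs' : p.Grp s') (hid : id < g.cnt s) (hid' : id' < g.cnt s')
    (h : p.addr g s id = p.addr g s' id') : s = s' ∧ id = id' := by
  unfold Par.addr at h
  have h1 := Nat.mod_lt id p.K_pos
  have h2 := Nat.mod_lt id' p.K_pos
  have h3 : g.pg s (id / p.K) = g.pg s' (id' / p.K) := by
    have : (p.K * g.pg s (id / p.K) + id % p.K) / p.K = (p.K * g.pg s' (id' / p.K) + id' % p.K) / p.K :=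
      congrArg (· / p.K) (by omega)
    rwa [Nat.mul_add_div p.K_pos, Nat.mul_add_div p.K_pos, Nat.div_eq_of_lt h1, Nat.div_eq_of_lt h2]
      at this
  obtain ⟨h4, h5⟩ := hG.pg_inj s s' _ _ hs hs' (Core.id_div_mul_lt hid) (Core.id_div_mul_lt hid') h3
  rw [h3] at h
  refine ⟨h4, ?_⟩
  rw [← Nat.div_add_mod id p.K, ← Nat.div_add_mod id' p.K, h5]
  omega

/-- The memory after the allocation of a cell: The headers and cells are those of `g`, the page
tables those of `g'`. -/
structure Mid (p : Par) (g g' : Ghost) (m : ℕ → ℕ) : Prop where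
  hdr : ∀ Y, Leaf p.h Y → m (16 * Y + 0) = p.encH (g.H Y)
  pt : ∀ s, p.Grp s → ∀ i, i * p.K < g'.cnt s →
    m (16 * (s * p.K + i) + 6) = p.HB + p.K * g'.pg s i
  cnt : ∀ s, p.Grp s → m (16 * (s * p.K) + 7) = g'.cnt s
  cell : ∀ s, p.Grp s → ∀ id < g.cnt s, m (p.addr g' s id) = p.encC (g.cell s id)
  bump : m 6 = p.HB + p.K * g'.np

variable {Y j : ℕ} {P : Finset ℕ}

theorem Mid.of_old (hm : GMem p g m)
    (hT : (g.H Y).tgt p.Z j P (g.cnt (Y / p.K)) ≠ g.cnt (Y / p.K)) :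
    Mid p g (g.set p Y j P) m := by
  refine ⟨hm.hdr, ?_, ?_, ?_, ?_⟩
  all_goals
    simp only [Ghost.set, Par.addr, if_neg hT, if_neg fun h : _ ∧ _ => hT h.1, update_eq_self]
  · exact hm.pt
  · exact hm.cnt
  · exact hm.cell
  · exact hm.bump

/-- The memory after the allocation of a page, if need be. -/
def pageMem (p : Par) (g : Ghost) (s : ℕ) (m : ℕ → ℕ) : ℕ → ℕ :=
  if p.K ∣ g.cnt s then
    update (update m (16 * (s * p.K + g.cnt s / p.K) + 6) (p.HB + p.K * g.np)) 6
      (p.HB + p.K * g.np + p.K)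
  else m

theorem Mid.of_new {P' : ℕ → ℕ → Finset ℕ} (hm : GMem p g m) (hG : GInv p P' g)
    (hsub : ∀ Y j, P' Y j ⊆ range p.β) (hY : Leaf p.h Y) (hlt : g.cnt (Y / p.K) < p.K * p.K)
    (hT : (g.H Y).tgt p.Z j P (g.cnt (Y / p.K)) = g.cnt (Y / p.K)) :
    Mid p g (g.set p Y j P) (update (pageMem p g (Y / p.K) m) (16 * (Y / p.K * p.K) + 7)
      (g.cnt (Y / p.K) + 1)) := by
  have hgrp := Par.grp hY
  have hK := p.K_pos
  have hdiv : g.cnt (Y / p.K) / p.K < p.K := by rwa [Nat.div_lt_iff_lt_mul hK]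
  set s := Y / p.K with hs
  have hs1 := hgrp.one_le
  have hb := Par.grp_bounds hgrp
  have hsD : s * p.K + p.K ≤ p.D := hb.2
  -- values at addresses that are not affected
  have hoff : ∀ a, a ≠ 16 * (s * p.K) + 7 → a ≠ 6 → a ≠ 16 * (s * p.K + g.cnt s / p.K) + 6 →
      update (pageMem p g s m) (16 * (s * p.K) + 7) (g.cnt s + 1) a = m a := by
    intro a h1 h2 h3
    rw [update_of_ne h1, pageMem]
    split_ifs
    · rw [update_of_ne h2, update_of_ne h3]
    · rfl
  refine ⟨fun Y' hY' => ?_, fun t ht i hi => ?_, fun t ht => ?_, fun t ht id hid => ?_, ?_⟩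
  · rw [hoff _ (by omega) (by omega) (by omega)]; exact hm.hdr Y' hY'
  · simp only [Ghost.set, ← hs, hT, if_true, true_and] at hi ⊢
    rw [update_of_ne (by omega), pageMem]
    have ht1 := ht.one_le
    by_cases hk : p.K ∣ g.cnt s
    · rw [if_pos hk, if_pos hk, update_of_ne (by omega)]
      by_cases hts : t = s
      · subst hts
        rw [update_self] at hi ⊢
        by_cases hi' : i = g.cnt s / p.K
        · subst hi'
          rw [update_self, update_self]
        · rw [update_of_ne hi', update_of_ne (by omega)]
          refine hm.pt s ht i (lt_of_le_of_ne (by omega) fun hh => hi' ?_)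
          rw [← hh, Nat.mul_div_cancel _ hK]
      · rw [update_of_ne hts] at hi ⊢
        have hiK : i < p.K := by
          have := hG.cnt_le hsub ht
          exact Nat.lt_of_mul_lt_mul_right (hi.trans_le this)
        rw [update_of_ne, hm.pt t ht i hi]
        intro hh
        refine hts ?_
        have e : t * p.K + i = s * p.K + g.cnt s / p.K := by omega
        have := congrArg (· / p.K) e
        simpa [mul_comm _ p.K, Nat.mul_add_div hK, Nat.div_eq_of_lt hiK, Nat.div_eq_of_lt hdiv]
          using this
    · rw [if_neg hk, if_neg hk]
      refine hm.pt t ht i ?_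
      by_cases hts : t = s
      · subst hts
        rw [update_self] at hi
        exact lt_of_le_of_ne (by omega) fun hh => hk ⟨i, by rw [← hh, mul_comm]⟩
      · rwa [update_of_ne hts] at hi
  · simp only [Ghost.set, ← hs, hT, if_true]
    by_cases hts : t = s
    · subst hts; rw [update_self, update_self]
    · rw [update_of_ne hts, hoff _ _ (by omega) (by omega)]
      · exact hm.cnt t ht
      · intro hh
        exact hts (Nat.eq_of_mul_eq_mul_right hK (by omega))
  · have hpg : p.addr (g.set p Y j P) t id = p.HB + p.K * g.pg t (id / p.K) + id % p.K := by
      simp only [Ghost.set, Par.addr, ← hs, hT, true_and]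
      split_ifs with hk
      · by_cases hts : t = s
        · subst hts
          rw [update_self, update_of_ne]
          intro hh
          have h1 := Nat.div_mul_cancel hk
          have h2 := Nat.div_mul_le_self id p.K
          rw [hh, h1] at h2
          omega
        · rw [update_of_ne hts]
      · rfl
    rw [hpg, hoff]
    · exact hm.cell t ht id hid
    all_goals
      have h1 := Par.fld_lt_HB (show s * p.K < p.D by omega) (by omega : 7 < 16)
      have h2 := Par.fld_lt_HB (show s * p.K + g.cnt s / p.K < p.D by omega) (by omega : 6 < 16)
      omega
  · simp only [Ghost.set, ← hs, hT, true_and]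
    rw [update_of_ne (by omega), pageMem]
    split_ifs with hk
    · rw [update_self, mul_add, mul_one, add_assoc]
    · exact hm.bump

/-- Once the page tables are those of the new state, writing the target cell and the header
completes the change; by `GInv.addr_inj` no other cell is hit. -/
theorem GMem.of_mid {P' : ℕ → ℕ → Finset ℕ} {T : ℕ} (hY : Leaf p.h Y)
    (hG : GInv p P' (g.set p Y j P)) (hsub : ∀ Y j, P' Y j ⊆ range p.β) (hm : Mid p g (g.set p Y j P) m)
    (hT : (g.H Y).tgt p.Z j P (g.cnt (Y / p.K)) = T) (hTlt : T < (g.set p Y j P).cnt (Y / p.K)) :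
    GMem p (g.set p Y j P) (update (update m (p.addr (g.set p Y j P) (Y / p.K) T)
      (p.encC ((g.set p Y j P).cell (Y / p.K) T))) (16 * Y + 0)
      (p.encH ((g.set p Y j P).H Y))) := by
  have hgrp := Par.grp hY
  have hYD : Y < p.D := hY.2
  have haddr : ∀ t id, p.HB ≤ p.addr (g.set p Y j P) t id := fun t id => by
    unfold Par.addr; omega
  have hlow : ∀ {x f t id}, x < p.D → f < 16 → 16 * x + f ≠ p.addr (g.set p Y j P) t id :=
    fun {x f t id} hx hf h => by
      have := Par.fld_lt_HB hx hf
      have := haddr t id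
      omega
  refine ⟨fun Y' hY' => ?_, fun t ht i hi => ?_, fun t ht => ?_, fun t ht id hid => ?_, ?_⟩
  · by_cases h : Y' = Y
    · subst h; rw [update_self]
    · rw [update_of_ne (by omega), update_of_ne (hlow hY'.2 (by omega)), hm.hdr Y' hY']
      simp only [Ghost.set, update_of_ne h]
  · have hiK : t * p.K + i < p.D := Par.rec_lt ht
      (Nat.lt_of_mul_lt_mul_right (hi.trans_le (hG.cnt_le hsub ht)))
    rw [update_of_ne (by omega), update_of_ne (hlow hiK (by omega))]
    exact hm.pt t ht i hi
  · have := (Par.grp_bounds ht).2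
    rw [update_of_ne (by omega), update_of_ne (hlow (by have := p.K_pos; unfold Par.D; omega)
      (by omega))]
    exact hm.cnt t ht
  · change update _ _ _ (p.addr (g.set p Y j P) t id) = _
    rw [update_of_ne (hlow hYD (by omega)).symm]
    by_cases h : t = Y / p.K ∧ id = T
    · obtain ⟨rfl, rfl⟩ := h
      rw [update_self]
    · rw [update_of_ne fun hh => h (hG.addr_inj ht hgrp hid hTlt hh)]
      have hcell : (g.set p Y j P).cell t id = g.cell t id := by
        simp only [Ghost.set, hT]
        by_cases hts : t = Y / p.K
        · subst hts
          rw [update_self, update_of_ne fun hh => h ⟨rfl, hh⟩]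
        · rw [update_of_ne hts]
      have hcnt : id < g.cnt t := by
        simp only [Ghost.set, hT] at hid
        by_cases hts : t = Y / p.K
        · subst hts
          rw [update_self] at hid
          split_ifs at hid with hc
          · have : id ≠ T := fun hh => h ⟨rfl, hh⟩
            omega
          · exact hid
        · rwa [update_of_ne hts] at hid
      rw [hcell]
      exact hm.cell t ht id hcnt
  · rw [update_of_ne (by have := Leaf.pos hY; omega), update_of_ne]
    · exact hm.bump
    · exact hlow (x := 0) (f := 6) p.D_pos (by omega)

end ZeroReport

end

section
open Finset
namespace ZeroReport
open Chunk Trie WordRAM BitVector Function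

variable {p : Par} {A : Set ℕ} {lt : ℕ → ℕ → Prop}

/-! ### Deleting a chunk from the list and the trie -/

/-- Let the pointers in field `f` at the ancestors of `v 2` from height `v 20` to `v b` point to
`v a`. -/
def spliceP (f a b : ℕ) : Cmd :=
  .loop (.lt 20 b) <| .seq (storeE (.bin .shr (.v 2) (.v 20) * .k 16 + .k f) (.v a))
    (setE 20 (tabE 10 (.v 20) (.k 0) (.k 0) (.k 0)))

theorem Par.up_lt {c : ℕ} (hc : 1 ≤ c) (hch : c ≤ p.h) : up p.b p.k c < 2 ^ p.w := by
  have h1 := up_le (b := p.b) (k := p.k) hc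
  have h2 := p.h_lt
  have h3 := p.lt_Q
  have h4 : p.Q * 2 ≤ p.Q ^ 5 := by
    calc p.Q * 2 ≤ p.Q * p.Q := Nat.mul_le_mul_left _ (by omega)
      _ = p.Q ^ 2 := by ring
      _ ≤ p.Q ^ 5 := Nat.pow_le_pow_right (by omega) (by omega)
  have := p.space'
  have := p.S_le
  unfold Par.HB at *
  omega

/-- The loop invariant is `PartOK`; the potential of the height bounds the number of writes, hence
the time, in terms of `b * k`. -/
theorem spliceP_spec {m₀ : ℕ → ℕ} (hs : Stat p m₀) {f a b pr x nx : ℕ} (hf : 1 ≤ f) (hf' : f ≤ 4)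
    (ha : a < 20) (hb : b < 20) (hd : Dir lt) (hA : ∀ y ∈ A, Leaf p.h y)
    (hT₀ : TrieOK p.b p.k p.h lt A fun v => m₀ (16 * v + f)) (hB : Between lt A pr x nx)
    {O : List ℕ} (d : ℕ) :
    ∀ (R m : ℕ → ℕ) (c : ℕ), pot p.b p.k c ≤ d → R 2 = x → R a = nx → R b = Nat.size (x ^^^ pr) →
      R 20 = c → Nat.size (x ^^^ nx) ≤ c → 1 ≤ c →
      PartOK p.b p.k p.h lt A (fun v => m₀ (16 * v + f)) x c (fun v => m (16 * v + f)) →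
      (∀ z, (∀ v, 1 ≤ v → v < p.D → z ≠ 16 * v + f) → m z = m₀ z) →
      (∀ v, 1 ≤ v → v < p.D → Leaf p.h (m (16 * v + f))) →
      WP p.w p.S (spliceP f a b) ⟨R, m, O⟩ (100 * (d + 1) + 1) fun s' =>
        TrieOK p.b p.k p.h lt (A \ {x}) (fun v => s'.mem (16 * v + f)) ∧
        (∀ z, (∀ v, 1 ≤ v → v < p.D → z ≠ 16 * v + f) → s'.mem z = m₀ z) ∧
        (∀ v, 1 ≤ v → v < p.D → Leaf p.h (s'.mem (16 * v + f))) ∧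
        (∀ i, i ≠ 20 → s'.reg i = R i) ∧ s'.out = O := by
  have hend : ∀ (R m : ℕ → ℕ) (c : ℕ), R b = Nat.size (x ^^^ pr) → R 20 = c →
      Nat.size (x ^^^ pr) ≤ c →
      PartOK p.b p.k p.h lt A (fun v => m₀ (16 * v + f)) x c (fun v => m (16 * v + f)) →
      (∀ z, (∀ v, 1 ≤ v → v < p.D → z ≠ 16 * v + f) → m z = m₀ z) →
      (∀ v, 1 ≤ v → v < p.D → Leaf p.h (m (16 * v + f))) →
      WP p.w p.S (spliceP f a b) ⟨R, m, O⟩ 1 fun s' =>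
        TrieOK p.b p.k p.h lt (A \ {x}) (fun v => s'.mem (16 * v + f)) ∧
        (∀ z, (∀ v, 1 ≤ v → v < p.D → z ≠ 16 * v + f) → s'.mem z = m₀ z) ∧
        (∀ v, 1 ≤ v → v < p.D → Leaf p.h (s'.mem (16 * v + f))) ∧
        (∀ i, i ≠ 20 → s'.reg i = R i) ∧ s'.out = O := fun R m c h1 h2 h3 hP hm hl =>
    WP.loop_false ⟨by omega, by omega⟩ (fun h : R 20 < R b => by omega)
      ⟨hP.finish hd hT₀ hB h3, hm, hl, fun _ _ => rfl, rfl⟩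
  have hx := hA x hB.mem
  have hprh := hx.size_xor_le (hA pr hB.pr_mem)
  induction d using Nat.strong_induction_on with
  | _ d ih =>
  intro R m c hpot h2 ha' hb' h20 hc hc1 hP hm hl
  by_cases hlt : c < Nat.size (x ^^^ pr)
  swap
  · exact WP.mono (hend R m c hb' h20 (by omega) hP hm hl) (by omega) fun _ h => h
  have hch : c ≤ p.h := by omega
  have hv1 := Leaf.one_le_shiftRight hx hch
  have hvD : x >>> c < p.D := hx.shiftRight_lt c
  have hup := lt_up (k := p.k) (j := c) p.b_ge
  have hupw := Par.up_lt hc1 hch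
  have hPs := hP.step p.b_ge hd hA hT₀ hB hc hlt
  have hmem : ∀ v, update m (16 * (x >>> c) + f) nx (16 * v + f) =
      update (fun v => m (16 * v + f)) (x >>> c) nx v := by
    intro v
    by_cases h : v = x >>> c
    · subst h; rw [update_self, update_self]
    · rw [update_of_ne h, update_of_ne (by omega)]
  rw [← funext hmem] at hPs
  have hm' : ∀ z, (∀ v, 1 ≤ v → v < p.D → z ≠ 16 * v + f) →
      update m (16 * (x >>> c) + f) nx z = m₀ z := fun z hz => by
    rw [update_of_ne (hz _ hv1 hvD)]; exact hm z hz
  have hl' : ∀ v, 1 ≤ v → v < p.D → Leaf p.h (update m (16 * (x >>> c) + f) nx (16 * v + f)) :=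
    fun v h1 h2 => by
      rw [hmem]
      by_cases h : v = x >>> c
      · subst h; rw [update_self]; exact hA nx hB.nx_mem
      · rw [update_of_ne h]; exact hl v h1 h2
  have hs' : Stat p (update m (16 * (x >>> c) + f) nx) := hs.congr fun z hz => hm' z
    fun v h1 h2 h => hz (.inr (.inl ⟨v, f, h1, h2, by omega, by omega, h⟩))
  refine WP.mono (WP.loop_true (t := 99) (t' := 100 * d + 1) (c := .lt 20 b) ⟨by omega, by omega⟩
    (show R 20 < R b by omega) ?_) (by omega) fun _ h => h
  refine .store_seq (x := 16 * (x >>> c) + f) (y := nx) (Ev.fld_addr (.shr (Ev.reg (by omega) h2)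
    (Ev.reg (by omega) h20)) hvD (by omega)) (Ev.reg (by omega) ha') (Par.fld_lt hvD (by omega))
    (Nat.le_of_ble_eq_true rfl) ?_
  refine .set_le (x := up p.b p.k c) (by omega) (Ev.tab hs' (by omega) (Ev.reg (by omega) h20)
    Core.ev_zero Core.ev_zero Core.ev_zero (hch.trans_lt p.h_lt) Core.Q_pos Core.Q_pos Core.Q_pos
    rfl hupw) (Nat.le_of_ble_eq_true rfl) ?_
  have hR : ∀ i, i ≠ 20 → update R 20 (up p.b p.k c) i = R i := fun i hi => update_of_ne hi _ _
  -- The potential is known to decrease only while the next height is below `b ^ k`. Otherwise the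
  -- loop ends at once, without the induction hypothesis.
  by_cases hlt' : up p.b p.k c < Nat.size (x ^^^ pr)
  · have hpl := pot_up_lt (k := p.k) p.b_ge hc1 ((hlt'.le.trans hprh).trans_lt p.h_lt_pow)
    refine WP.mono (ih _ (hpl.trans_le hpot) _ _ _ le_rfl h2 ((hR a (by omega)).trans ha')
      ((hR b (by omega)).trans hb') rfl (by omega) (by omega) hPs hm' hl') (by omega) ?_
    rintro s' ⟨k1, k2, k3, k4, k5⟩
    exact ⟨k1, k2, k3, fun i hi => (k4 i hi).trans (hR i hi), k5⟩
  · refine WP.mono (hend _ _ (up p.b p.k c) ((hR b (by omega)).trans hb') rfl (by omega) hPs hm' hl')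
      (by omega) ?_
    rintro s' ⟨k1, k2, k3, k4, k5⟩
    exact ⟨k1, k2, k3, fun i hi => (k4 i hi).trans (hR i hi), k5⟩

/-- The removal of `x` creates the pair of its neighbours. Every other consecutive pair was
consecutive before, and it involves neither of the two links that are overwritten. -/
theorem consec_diff {pr x nx y z : ℕ} (hp : Consec A pr x) (hn : Consec A x nx)
    (h : Consec (A \ {x}) y z) : (y = pr ∧ z = nx) ∨ (Consec A y z ∧ y ≠ pr ∧ z ≠ nx) := by
  obtain ⟨⟨hy, hyx⟩, ⟨hz, hzx⟩, hyz, hno⟩ := h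
  have hyx : y ≠ x := hyx
  have hzx : z ≠ x := hzx
  have h1 := hp.2.2.1
  have h2 := hn.2.2.1
  have a1 := hp.2.2.2 y hy
  have a2 := hp.2.2.2 z hz
  have a3 := hn.2.2.2 y hy
  have a4 := hn.2.2.2 z hz
  have a5 := hno pr ⟨hp.1, fun hh : pr = x => by omega⟩
  have a6 := hno nx ⟨hn.2.1, fun hh : nx = x => by omega⟩
  by_cases hx : y < x ∧ x < z
  · exact .inl ⟨by omega, by omega⟩
  · refine .inr ⟨⟨hy, hz, hyz, fun a ha hh => ?_⟩, by omega, by omega⟩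
    by_cases hax : a = x
    · exact hx (hax ▸ hh)
    · exact hno a ⟨ha, hax⟩ hh

/-- Delete `v 2` from the list and the trie. -/
def deleteP : Cmd :=
  .seq (
    .seq (setE 16 (fldE 2 (.v 2))) <| .seq (setE 17 (fldE 1 (.v 2))) <|
    .seq (storeE (.v 16 * .k 16 + .k 1) (.v 17)) <| .seq (storeE (.v 17 * .k 16 + .k 2) (.v 16)) <|
    .seq (setE 18 (fldE 5 (.bin .xor (.v 2) (.v 17)) + .k 1)) <|
    .seq (setE 19 (fldE 5 (.bin .xor (.v 2) (.v 16)) + .k 1)) (setE 20 (.v 18))) <|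
  .seq (spliceP 3 17 19) <| .seq (setE 20 (.v 19)) (spliceP 4 16 18)

def deleteT (p : Par) : ℕ := 200 * (p.b * p.k) + 400

/-- The same splicing is run twice, for the first and for the last elements; reversing the order
exchanges the two neighbours and the two heights that bound the range to be repaired. -/
theorem deleteP_spec {m R : ℕ → ℕ} {O : List ℕ} (hs : Stat p m) (hL : Links p A m)
    (hA : ∀ y ∈ A, Leaf p.h y) {pr x nx : ℕ} (hpr : Consec A pr x) (hnx : Consec A x nx)
    (h2 : R 2 = x) :
    WP p.w p.S deleteP ⟨R, m, O⟩ (deleteT p) fun s' =>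
      Links p (A \ {x}) s'.mem ∧ (∀ a, ¬ p.Ptr a → s'.mem a = m a) := by
  have hx := hA x hpr.2.1
  have hprL := hA pr hpr.1
  have hnxL := hA nx hnx.2.1
  have h1 := hpr.2.2.1
  have h3 := hnx.2.2.1
  have hx1 := Leaf.pos hx
  have hpr1 := Leaf.pos hprL
  have hnx1 := Leaf.pos hnxL
  have hB : Between (· < ·) A pr x nx := ⟨hpr.2.1, hpr.1, hnx.2.1, h1, h3,
    fun a ha h h' => hnx.2.2.2 a ha ⟨h, h'⟩, fun a ha h h' => hpr.2.2.2 a ha ⟨h', h⟩⟩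
  have hB' : Between (· > ·) A nx x pr := ⟨hpr.2.1, hnx.2.1, hpr.1, h3, h1,
    fun a ha h h' => hpr.2.2.2 a ha ⟨h', h⟩, fun a ha h h' => hnx.2.2.2 a ha ⟨h, h'⟩⟩
  have hsz : ∀ y, y ≠ x → 1 ≤ Nat.size (x ^^^ y) := fun y hy => by
    rw [Nat.succ_le_iff, Nat.size_pos, Nat.pos_iff_ne_zero]
    intro h
    exact hy (Nat.xor_eq_zero_iff.1 h).symm
  have hszn := hsz nx (by omega)
  have hszp := hsz pr (by omega)
  have hxn : x ^^^ nx < p.D := Nat.xor_lt_two_pow hx.2 hnxL.2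
  have hxp : x ^^^ pr < p.D := Nat.xor_lt_two_pow hx.2 hprL.2
  have hszn' := hx.size_xor_le hnxL
  have hszp' := hx.size_xor_le hprL
  obtain ⟨m₁, hm₁⟩ : ∃ m₁, m₁ = update (update m (16 * pr + 1) nx) (16 * nx + 2) pr := ⟨_, rfl⟩
  have hs₁ : Stat p m₁ := hs.congr fun a ha => by
    rw [hm₁, update_of_ne, update_of_ne]
    · exact fun h => ha (.inr (.inl ⟨pr, 1, hpr1, hprL.2, by omega, by omega, h⟩))
    · exact fun h => ha (.inr (.inl ⟨nx, 2, hnx1, hnxL.2, by omega, by omega, h⟩))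
  have hm1 : ∀ z, (z % 16 = 1 → z ≠ 16 * pr + 1) → (z % 16 = 2 → z ≠ 16 * nx + 2) → m₁ z = m z := by
    intro z hz hz'
    rw [hm₁, update_of_ne (by omega), update_of_ne (by omega)]
  unfold deleteP deleteT
  refine WP.mono (t := 100 + (100 * (p.b * p.k + 1) + 1 + (3 + (100 * (p.b * p.k + 1) + 1))))
    (WP.seq ?_) (by omega) fun _ h => h
  refine .set_seq (x := pr) (by omega) (Ev.fld' (Ev.reg (by omega) h2) hx.2 (by omega)
    (hL.list _ _ hpr).2) (by decide) ?_
  refine .set_seq (x := nx) (by omega) (Ev.fld' (Ev.reg (by omega) h2) hx.2 (by omega)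
    (hL.list _ _ hnx).1) (by decide) ?_
  refine .store_seq (x := 16 * pr + 1) (y := nx) (Ev.fld_addr (Ev.reg (by omega) rfl) hprL.2
    (by omega)) (Ev.reg (by omega) rfl) (Par.fld_lt hprL.2 (by omega)) (by decide) ?_
  refine .store_seq (x := 16 * nx + 2) (y := pr) (Ev.fld_addr (Ev.reg (by omega) rfl) hnxL.2
    (by omega)) (Ev.reg (by omega) rfl) (Par.fld_lt hnxL.2 (by omega)) (by decide) ?_
  rw [← hm₁]
  refine .set_seq (x := Nat.size (x ^^^ nx) - 1 + 1) (by omega) (.add (Ev.fld' (.xor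
    (Ev.reg (by omega) h2) (Ev.reg (by omega) rfl)) hxn (by omega) (hs₁.bl _ hxn))
    (.k (Par.lit (by omega))) (Par.of_lt_Q (by have := p.h_lt; omega))) (by decide) ?_
  refine .set_seq (x := Nat.size (x ^^^ pr) - 1 + 1) (by omega) (.add (Ev.fld' (.xor
    (Ev.reg (by omega) h2) (Ev.reg (by omega) rfl)) hxp (by omega) (hs₁.bl _ hxp))
    (.k (Par.lit (by omega))) (Par.of_lt_Q (by have := p.h_lt; omega))) (by decide) ?_
  refine .set_le (x := Nat.size (x ^^^ nx) - 1 + 1) (by omega) (Ev.reg (by omega) rfl) (by decide) ?_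
  -- The records store bit lengths less one. The xor of different leaves is not zero, so adding one
  -- restores its bit length.
  rw [Nat.sub_add_cancel hszn, Nat.sub_add_cancel hszp]
  have e3 : (fun v => m₁ (16 * v + 3)) = fun v => m (16 * v + 3) :=
    funext fun v => hm1 _ (by omega) (by omega)
  have e4 : (fun v => m₁ (16 * v + 4)) = fun v => m (16 * v + 4) :=
    funext fun v => hm1 _ (by omega) (by omega)
  have hmin := hL.min
  have hmax := hL.max
  rw [← e3] at hmin
  rw [← e4] at hmax
  refine WP.seq (WP.mono (spliceP_spec hs₁ (f := 3) (by omega) (by omega) (by omega) (by omega)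
    (.inl rfl) hA hmin hB (p.b * p.k) _ m₁ (Nat.size (x ^^^ nx)) pot_le h2 rfl rfl rfl le_rfl hszn
    (PartOK.start (.inl rfl) hmin hB) (fun _ _ => rfl) fun v h h' => ?_) le_rfl ?_)
  · rw [hm1 _ (by omega) (by omega)]; exact hL.min_leaf v h h'
  rintro ⟨R₂, m₂, O₂⟩ ⟨hT₂, hm₂, hl₂, hR₂, hO₂⟩
  simp only at hT₂ hm₂ hl₂ hR₂ hO₂
  subst hO₂
  have hs₂ : Stat p m₂ := hs₁.congr fun z hz => hm₂ z
    fun v h1 h2 h => hz (.inr (.inl ⟨v, 3, h1, h2, by omega, by omega, h⟩))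
  refine WP.seq (.set_le (x := Nat.size (x ^^^ pr)) (by omega) (Ev.reg (by omega) (hR₂ 19 (by omega)))
    (by decide) ?_)
  have e4' : (fun v => m₂ (16 * v + 4)) = fun v => m₁ (16 * v + 4) :=
    funext fun v => hm₂ _ fun _ _ _ => by omega
  rw [← e4'] at hmax
  refine WP.mono (spliceP_spec hs₂ (f := 4) (by omega) (by omega) (by omega) (by omega)
    (.inr rfl) hA hmax hB' (p.b * p.k) _ m₂ (Nat.size (x ^^^ pr)) pot_le ((hR₂ 2 (by omega)).trans h2)
    (hR₂ 16 (by omega)) (hR₂ 18 (by omega)) rfl le_rfl hszp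
    (PartOK.start (.inr rfl) hmax hB') (fun _ _ => rfl) fun v h h' => ?_) le_rfl ?_
  · rw [hm₂ _ (fun _ _ _ => by omega), hm1 _ (by omega) (by omega)]; exact hL.max_leaf v h h'
  rintro ⟨R₃, m₃, O₃⟩ ⟨hT₃, hm₃, hl₃, -, -⟩
  simp only at hT₃ hm₃ hl₃
  have key : ∀ z, z % 16 ≠ 3 → z % 16 ≠ 4 → m₃ z = m₁ z := fun z h h' => by
    rw [hm₃ _ fun _ _ _ => by omega, hm₂ _ fun _ _ _ => by omega]
  refine ⟨⟨fun y z hyz => ?_, ?_, hT₃, fun v h h' => ?_, hl₃⟩, fun a ha => ?_⟩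
  · simp only
    rw [key _ (by omega) (by omega), key _ (by omega) (by omega)]
    rcases consec_diff hpr hnx hyz with ⟨rfl, rfl⟩ | ⟨hc, hne, hne'⟩
    · rw [hm₁, update_of_ne (by omega), update_self, update_self]
      exact ⟨rfl, rfl⟩
    · rw [hm1 _ (by omega) (by omega), hm1 _ (by omega) (by omega)]
      exact hL.list y z hc
  · have : (fun v => m₃ (16 * v + 3)) = fun v => m₂ (16 * v + 3) :=
      funext fun v => hm₃ _ fun _ _ _ => by omega
    rw [this]; exact hT₂
  · simp only
    rw [hm₃ _ fun _ _ _ => by omega]; exact hl₂ v h h'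
  · have hne : ∀ v f, 1 ≤ v → v < p.D → 1 ≤ f → f ≤ 4 → a ≠ 16 * v + f :=
      fun v f h1 h2 h3 h4 h => ha ⟨v, f, h1, h2, h3, h4, h⟩
    simp only
    rw [hm₃ _ fun v h h' => hne v 4 h h' (by omega) le_rfl,
      hm₂ _ fun v h h' => hne v 3 h h' (by omega) (by omega), hm₁,
      update_of_ne (hne nx 2 hnx1 hnxL.2 (by omega) (by omega)),
      update_of_ne (hne pr 1 hpr1 hprL.2 (by omega) (by omega))]

end ZeroReport

end

section
open Finset
namespace ZeroReport
open Chunk Trie WordRAM BitVector Function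

variable {p : Par} {B : Fin p.n → Bool} {g : Ghost}

/-! ### Setting a bit to zero -/

/-- Allocate a page for the group with base `v 7` and cell number `v 11`. -/
def pageP : Cmd :=
  .seq (storeE ((.v 7 + .v 11 / par 2) * .k 16 + .k 6) (par 6)) (storeE (.k 6) (par 6 + par 2))

/-- Allocate cell number `v 11` for the group with base `v 7`; its contents are put in `v 14`. -/
def newCellP : Cmd :=
  .seq (setE 15 (.v 11 - .v 11 / par 2 * par 2)) <| .seq (.ite (.eq 15 24) pageP .skip) <|
  .seq (storeE (.v 7 * .k 16 + .k 7) (.v 11 + .k 1)) (setE 14 (tabE 7 (.v 4) (.v 10) (.k 0) (.k 0)))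

/-- Give block `v 4` of chunk `v 2` the set of zeros with code `v 10`. -/
def writeP : Cmd :=
  .seq (setE 11 (fldE 7 (.v 7))) <| .seq (setE 12 (tabE 5 (.v 6) (.v 4) (.v 10) (.v 11))) <|
  .seq (.ite (.eq 12 11) newCellP (setE 14 (tabE 6 (.ld (addrE 7 12)) (.v 4) (.v 10) (.k 0)))) <|
  .seq (setE 13 (tabE 8 (.v 6) (.v 4) (.v 10) (.v 11))) <|
  .seq (storeE (addrE 7 12) (.v 14)) <| .seq (storeE (.v 2 * .k 16 + .k 0) (.v 13))
  (setE 25 (tabE 3 (.v 13) (.k 0) (.k 0) (.k 0)))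

def writeT : ℕ := 600

theorem newCellP_spec {m R : ℕ → ℕ} {O : List ℕ} (hC : Core p (pat p B) g m) {t j c : ℕ}
    {P : Finset ℕ} (hgrp : p.Grp t) (hj : j < p.r) (hP : P ⊆ range p.β)
    (hcnt : g.cnt t < p.K * p.K) (hroom : p.K ∣ g.cnt t → p.HB + p.K * g.np + p.K ≤ p.S)
    (hc : p.encC (Cell.blank.set p.Z j P) = c) (hcQ : c < p.Q)
    (h4 : R 4 = j) (h7 : R 7 = t * p.K) (h10 : R 10 = p.encP P + 1)
    (h11 : R 11 = g.cnt t) (h24 : R 24 = 0) :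
    WP p.w p.S newCellP ⟨R, m, O⟩ 150 fun s' =>
      s'.mem = update (pageMem p g t m) (16 * (t * p.K) + 7) (g.cnt t + 1) ∧
      s'.reg 14 = c ∧ (∀ i, i ≠ 14 → i ≠ 15 → s'.reg i = R i) ∧ s'.out = O ∧ Stat p s'.mem := by
  have hs := hC.stat
  have hdm := Nat.div_mul_le_self (g.cnt t) p.K
  have hdvd : g.cnt t - g.cnt t / p.K * p.K = 0 ↔ p.K ∣ g.cnt t := by
    rw [← Nat.mod_eq_sub_div_mul, Nat.dvd_iff_mod_eq_zero]
  have hKK := p.KK_lt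
  have hS := p.S_lt
  have hKQ : p.K < p.Q := (Nat.le_mul_self p.K).trans_lt hKK
  have hr := Par.rec_lt hgrp (show g.cnt t / p.K < p.K by rwa [Nat.div_lt_iff_lt_mul p.K_pos])
  have hr0 : t * p.K < p.D := by simpa using Par.rec_lt hgrp p.K_pos
  have hr1 := hgrp.one_le
  have hr2 : 1 ≤ t * p.K + g.cnt t / p.K := hr1.trans (Nat.le_add_right _ _)
  have hne : ∀ {a z : ℕ}, a < 16 → 1 ≤ z → a ≠ 16 * z + 6 := by omega
  have hpage : Stat p (pageMem p g t m) := hs.congr fun a ha => by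
    unfold pageMem
    split_ifs
    · rw [update_of_ne, update_of_ne]
      · exact fun h => ha (.inr (.inl ⟨t * p.K + g.cnt t / p.K, 6, hr2, hr, by omega, by omega, h⟩))
      · exact fun h => ha (.inl h)
    · rfl
  have hfin : Stat p (update (pageMem p g t m) (16 * (t * p.K) + 7) (g.cnt t + 1)) :=
    hpage.congr fun a ha => update_of_ne (fun h => ha (.inr (.inl ⟨t * p.K, 7, hr1, hr0, by omega,
      by omega, h⟩))) _ _
  obtain ⟨hP1, hP2⟩ := p.encP_spec P hP
  refine .set_seq (x := g.cnt t - g.cnt t / p.K * p.K) (by omega) (.sub (Ev.reg (by omega) h11)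
    (.mul (.div (Ev.reg (by omega) h11) (Ev.par' (by omega) hs.K)) (Ev.par' (by omega) hs.K)
    (Par.of_lt_Q (by omega))) hdm) (by decide) ?_
  refine .seq_le (u := 60) (by decide) (WP.mono (Q := fun s' => s' =
    ⟨update R 15 (g.cnt t - g.cnt t / p.K * p.K), pageMem p g t m, O⟩) (.ite_le (t := 60)
    ⟨by omega, by omega⟩ (by omega) (fun h => ?_) fun h => ?_) le_rfl ?_)
  · replace h : g.cnt t - g.cnt t / p.K * p.K = R 24 := h
    rw [h24, hdvd] at h
    have hroom' := hroom h
    have hlt : p.HB + p.K * g.np < 2 ^ p.w := by omega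
    refine .store_seq (x := 16 * (t * p.K + g.cnt t / p.K) + 6) (y := p.HB + p.K * g.np)
      (Ev.fld_addr (.add (Ev.reg (by omega) h7) (.div (Ev.reg (by omega) h11)
        (Ev.par' (by omega) hs.K)) (Par.of_lt_D hr)) hr (by omega))
      (Ev.par' (by omega) hC.gmem.bump) (Par.fld_lt hr (by omega)) (by decide) ?_
    refine .store_le (x := 6) (y := p.HB + p.K * g.np + p.K) (.k (Par.lit (by omega)))
      (.add (Ev.par' (by omega) ?_) (Ev.par' (by omega) ?_) (by omega))
      (Par.fld_lt (x := 0) (f := 6) p.D_pos (by omega)) (by decide) ?_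
    · rw [update_of_ne (hne (by omega) hr2)]; exact hC.gmem.bump
    · rw [update_of_ne (hne (by omega) hr2)]; exact hs.K
    · simp only [pageMem, if_pos h]
  · replace h : ¬ g.cnt t - g.cnt t / p.K * p.K = R 24 := h
    rw [h24, hdvd] at h
    exact .skip_le (by omega) (by simp only [pageMem, if_neg h])
  rintro _ rfl
  refine .store_seq (x := 16 * (t * p.K) + 7) (y := g.cnt t + 1) (Ev.fld_addr (Ev.reg (by omega) h7)
    hr0 (by omega)) (.add (Ev.reg (by omega) h11) (.k (Par.lit (by omega))) (Par.of_lt_Q (by omega)))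
    (Par.fld_lt hr0 (by omega)) (by decide) ?_
  refine .set_le (x := c) (by omega) (Ev.tab hfin (by omega) (Ev.reg (by omega) h4)
    (Ev.reg (by omega) h10) Core.ev_zero Core.ev_zero (hj.trans p.r_lt) hP1 Core.Q_pos Core.Q_pos ?_
    (Par.of_lt_Q hcQ)) (by decide) ⟨rfl, rfl, fun i h1 h2 => ?_, rfl, hfin⟩
  · rw [Par.F, Nat.add_sub_cancel, hP2, hc]
  · exact (update_of_ne h1 _ _).trans (update_of_ne h2 _ _)

-- Target, new cell and new header are table values of the old header, the code of the new set and
-- the number of cells. The page tables are brought up to date first, because the address of the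
-- target cell may be on a page that is just being allocated.
open Classical in
theorem writeP_spec {m R : ℕ → ℕ} {O : List ℕ} (hC : Core p (pat p B) g m) {i : Fin p.n}
    (hz : zeros (update B i false) ≤ p.m) (hi : p.offset i ∉ pat p B (p.chunk i) (p.block i))
    {P : Finset ℕ} (hP : P = insert (p.offset i) (pat p B (p.chunk i) (p.block i)))
    (h2 : R 2 = p.chunk i) (h4 : R 4 = p.block i) (h6 : R 6 = p.encH (g.H (p.chunk i)))
    (h7 : R 7 = p.chunk i / p.K * p.K) (h10 : R 10 = p.encP P + 1) (h24 : R 24 = 0) :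
    WP p.w p.S writeP ⟨R, m, O⟩ writeT fun s' =>
      Core p (pat p (update B i false)) (g.set p (p.chunk i) (p.block i) P) s'.mem ∧
      (∀ a, p.Ptr a → s'.mem a = m a) ∧ s'.reg 2 = p.chunk i ∧ s'.reg 24 = 0 ∧
      s'.reg 25 = if p.chunk i ∈ Alive p (update B i false) then 1 else 0 := by
  have hY := Par.leaf_chunk i.2
  have hj := Par.block_lt (p := p) i
  have hs := hC.stat
  have hPβ : P ⊆ range p.β := by
    rw [hP]
    exact insert_subset (mem_range.2 (Par.offset_lt i)) (pat_subset _ _ _)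
  -- For block numbers from `r` on, `pat` reads positions of later chunks, so the two descriptions
  -- of the new blocks agree only for `j < r`.
  have hG := (hC.ginv.set hY hj hi hP hPβ).congr (P' := pat p (update B i false)) fun Y j hj => by
    rw [pat_update i hj]
    split_ifs with h
    · obtain ⟨rfl, rfl⟩ := h
      rw [update_self, update_self, hP]
    · by_cases hY : Y = p.chunk i
      · subst hY
        rw [update_self, update_of_ne fun hh => h ⟨rfl, hh⟩]
      · rw [update_of_ne hY]
  have hsub := pat_subset (p := p) (update B i false)
  -- The bound on the zeros of the new bit vector guarantees room for the page that may be needed.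
  have hnp := hG.np_le ((sum_card_pat_le _).trans hz)
  have hroom : p.HB + p.K * (g.set p (p.chunk i) (p.block i) P).np ≤ p.S := by
    have := p.space'
    unfold Par.HS at this
    omega
  obtain ⟨hP1, hP2⟩ := p.encP_spec P hPβ
  obtain ⟨Y, hYe⟩ : ∃ Y, Y = p.chunk i := ⟨_, rfl⟩
  obtain ⟨j, hje⟩ : ∃ j, j = p.block i := ⟨_, rfl⟩
  obtain ⟨t, hte⟩ : ∃ t, t = Y / p.K := ⟨_, rfl⟩
  rw [← hYe] at hY h2 h6 h7 hnp hroom hG ⊢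
  rw [← hje] at h4 hj hnp hroom hG ⊢
  have hgrp := Par.grp hY
  have hI := hG.inv Y hY
  obtain ⟨hH1, hH2⟩ := hC.ginv.encH_spec hC.sub hY
  obtain ⟨hH1', hH2'⟩ := hG.encH_spec hsub hY
  rw [← hte] at h7 hgrp
  obtain ⟨T, hT⟩ : ∃ T, (g.H Y).tgt p.Z j P (g.cnt t) = T := ⟨_, rfl⟩
  have hslot : ((g.set p Y j P).H Y).slot j = T := by
    simp only [Ghost.set, update_self, Hdr.set, ← hte, hT]
  have hTlt : T < (g.set p Y j P).cnt t := by rw [hte, ← hslot]; exact hI.slot_lt j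
  have hcl := hG.cnt_le hsub hgrp
  have hKK := p.KK_lt
  have hcell : (g.set p Y j P).cell t T = tgtCell p.Z (g.H Y) (g.cell t) (g.cnt t) j P := by
    simp only [Ghost.set, ← hte, hT, update_self]
  obtain ⟨hc1, -⟩ := hG.encC_spec hTlt
  have hcnt' : (g.set p Y j P).cnt t = if T = g.cnt t then g.cnt t + 1 else g.cnt t := by
    simp only [Ghost.set, ← hte, hT, update_self]
  have hcntK : g.cnt t < p.Q := by split_ifs at hcnt' <;> omega
  have hr0 : t * p.K < p.D := by simpa using Par.rec_lt hgrp p.K_pos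
  have hr1 := hgrp.one_le
  refine .set_seq (x := g.cnt t) (by omega) (Ev.fld' (Ev.reg (by omega) h7) hr0 (by omega)
    (hC.gmem.cnt t hgrp)) (by decide) ?_
  refine .set_seq (x := T) (by omega) (Ev.tab (d := g.cnt t) hs (by omega) (Ev.reg (by omega) h6)
    (Ev.reg (by omega) h4) (Ev.reg (by omega) h10) (Ev.reg (by omega) rfl) hH1 (hj.trans p.r_lt)
    hP1 hcntK (by rw [Par.F, hH2, Nat.add_sub_cancel, hP2, hT]) (Par.of_lt_Q (by omega)))
    (by decide) ?_
  refine .seq_le (u := 200) (by decide) (WP.mono (Q := fun s' => Mid p g (g.set p Y j P) s'.mem ∧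
    s'.reg 14 = p.encC ((g.set p Y j P).cell t T) ∧ (∀ i, i ≠ 14 → i ≠ 15 → s'.reg i =
    update (update R 11 (g.cnt t)) 12 T i) ∧ Stat p s'.mem ∧ (∀ a, p.Ptr a → s'.mem a = m a))
    (.ite_le (t := 200) ⟨by omega, by omega⟩ (by omega) (fun h => ?_) fun h => ?_) le_rfl ?_)
  · replace h : T = g.cnt t := h
    rw [if_pos h] at hcnt'
    have hnpe : p.K ∣ g.cnt t → (g.set p Y j P).np = g.np + 1 := fun hk => by
      simp only [Ghost.set, ← hte, hT, if_pos (And.intro h hk)]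
    have hcell' : p.encC (Cell.blank.set p.Z j P) = p.encC ((g.set p Y j P).cell t T) := by
      rw [hcell, tgtCell, hT, if_pos h]
    refine WP.mono (newCellP_spec hC (t := t) (j := j) (P := P) hgrp hj hPβ (by omega)
      (fun hk => ?_) hcell' hc1 h4 h7 h10 rfl h24) (by decide) ?_
    · rw [hnpe hk, mul_add, mul_one] at hroom; omega
    rintro s' ⟨a1, a2, a3, -, a5⟩
    refine ⟨?_, a2, a3, a5, fun a ha => ?_⟩
    · rw [a1, hte]
      exact Mid.of_new hC.gmem hC.ginv hC.sub hY (by rw [← hte]; omega)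
        (by rw [← hte, hT, h])
    · rw [a1, update_of_ne, pageMem]
      · split_ifs
        · rw [update_of_ne, update_of_ne]
          · rintro rfl; exact Par.not_ptr (by omega) (by omega) ha
          · rintro rfl; exact Par.not_ptr (x := 0) (f := 6) (by omega) (by omega) ha
        · rfl
      · rintro rfl; exact Par.not_ptr (by omega) (by omega) ha
  · replace h : ¬ T = g.cnt t := h
    rw [if_neg h] at hcnt'
    have hTlt' : T < g.cnt t := by omega
    obtain ⟨hd1, hd2⟩ := hC.ginv.encC_spec hTlt'
    refine .set_le (x := p.encC ((g.set p Y j P).cell t T)) (by omega) (Ev.tab hs (by omega)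
      (Core.ev_cell (s := ⟨_, m, O⟩) hC (t := t) hgrp hTlt' (by omega) (by omega) h7 rfl)
      (Ev.reg (by omega) h4) (Ev.reg (by omega) h10) Core.ev_zero hd1 (hj.trans p.r_lt) hP1 Core.Q_pos
      ?_ (Par.of_lt_Q hc1)) (by decide) ⟨?_, rfl, fun i h1 h2 => update_of_ne h1 _ _, hs,
      fun a _ => rfl⟩
    · rw [Par.F, Nat.add_sub_cancel, hP2, hd2, hcell, tgtCell, hT, if_neg h]
    · exact Mid.of_old hC.gmem (by rw [← hte, hT]; exact h)
  rintro ⟨R', m', O'⟩ ⟨hM, h14, hR, hs', hPtr⟩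
  simp only at hM h14 hR hs' hPtr
  have g2 : R' 2 = Y := (hR 2 (by omega) (by omega)).trans h2
  have g4 : R' 4 = j := (hR 4 (by omega) (by omega)).trans h4
  have g6 : R' 6 = p.encH (g.H Y) := (hR 6 (by omega) (by omega)).trans h6
  have g7 : R' 7 = t * p.K := (hR 7 (by omega) (by omega)).trans h7
  have g10 : R' 10 = p.encP P + 1 := (hR 10 (by omega) (by omega)).trans h10
  have g11 : R' 11 = g.cnt t := hR 11 (by omega) (by omega)
  have g12 : R' 12 = T := hR 12 (by omega) (by omega)
  have g24 : R' 24 = 0 := (hR 24 (by omega) (by omega)).trans h24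
  have hHset : (g.set p Y j P).H Y = (g.H Y).set p.β p.Z j P (g.cnt t) := by
    simp only [Ghost.set, update_self, ← hte]
  refine .set_seq (x := p.encH ((g.set p Y j P).H Y)) (by omega) (Ev.tab hs' (by omega)
    (Ev.reg (by omega) g6) (Ev.reg (by omega) g4) (Ev.reg (by omega) g10) (Ev.reg (by omega) g11)
    hH1 (hj.trans p.r_lt) hP1 hcntK (by rw [Par.F, hH2, Nat.add_sub_cancel, hP2, hHset])
    (Par.of_lt_Q hH1')) (by decide) ?_
  have haddr : p.addr (g.set p Y j P) t T < p.HB + p.K * (g.set p Y j P).np := by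
    have h1 := hG.pg_lt t hgrp (T / p.K) (Core.id_div_mul_lt hTlt)
    have h2 := Nat.mul_le_mul_left p.K (Nat.succ_le_of_lt h1)
    have h3 := Nat.mod_lt T p.K_pos
    rw [Nat.mul_succ] at h2
    unfold Par.addr
    omega
  have hSw := p.S_lt
  refine .store_seq (x := p.addr (g.set p Y j P) t T) (y := p.encC ((g.set p Y j P).cell t T))
    (Ev.addr hs' hgrp (by omega) (by omega) (by omega) g7 g12 (hM.pt t hgrp _
    (Core.id_div_mul_lt hTlt)) (by unfold Par.addr at haddr; omega)) (Ev.reg (by omega) h14)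
    (by omega) (by decide) ?_
  refine .store_seq (x := 16 * Y + 0) (y := p.encH ((g.set p Y j P).H Y)) (Ev.fld_addr
    (Ev.reg (by omega) g2) hY.2 (by omega)) (Ev.reg (by omega) rfl) (Par.fld_lt hY.2 (by omega))
    (by decide) ?_
  have hgm := GMem.of_mid hY hG hsub hM (by rw [← hte, hT]) (by rw [← hte]; exact hTlt)
  rw [← hte] at hgm
  have hHB : p.HB ≤ p.addr (g.set p Y j P) t T := by unfold Par.addr; omega
  have hst : Stat p (update (update m' (p.addr (g.set p Y j P) t T)
      (p.encC ((g.set p Y j P).cell t T))) (16 * Y + 0) (p.encH ((g.set p Y j P).H Y))) :=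
    hs'.congr fun a ha => by
      rw [update_of_ne, update_of_ne]
      · rintro rfl; exact ha (.inr (.inr hHB))
      · exact fun h => ha (.inr (.inl ⟨Y, 0, Leaf.pos hY, hY.2, by omega, by omega, h⟩))
  refine .set_le (x := if Y ∈ Alive p (update B i false) then 1 else 0) (by omega) (Ev.tab
    (a := p.encH ((g.set p Y j P).H Y)) hst (by omega) (Ev.reg (by omega) rfl) Core.ev_zero Core.ev_zero Core.ev_zero hH1' Core.Q_pos
    Core.Q_pos Core.Q_pos ?_ ?_) (by decide) ⟨⟨hst, hG, hgm, hsub, hroom⟩, fun a ha => ?_, g2, g24,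
    rfl⟩
  · rw [Par.F, hH2']
    refine if_congr ?_ rfl rfl
    rw [Alive, Set.mem_ofPred_eq, and_iff_right hY]
    exact exists_congr fun j => and_congr_right fun hj => hI.ne j hj
  · split_ifs <;> exact Par.lit (by omega)
  · simp only
    rw [update_of_ne, update_of_ne]
    · exact hPtr a ha
    · rintro rfl; exact Par.not_ptr_of_HB_le hHB ha
    · rintro rfl; exact Par.not_ptr (by omega) (by omega) ha

end ZeroReport

end

section
open Finset
namespace ZeroReport
open Chunk Trie WordRAM BitVector Function

variable {p : Par} {B : Fin p.n → Bool} {g : Ghost}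

/-- Set the bit at position `v 0` to zero. -/
def zeroP : Cmd :=
  .seq (
    .seq (setE 1 (.v 0 / par 0)) <| .seq (setE 2 (.v 1 + par 7)) <|
    .seq (setE 3 (.v 0 - .v 1 * par 0)) <| .seq (setE 4 (.v 3 / par 1)) <|
    .seq (setE 5 (.v 3 - .v 4 * par 1)) <| .seq (setE 6 (fldE 0 (.v 2))) <|
    .seq (setE 7 (.v 2 / par 2 * par 2)) <| .seq (setE 8 (tabE 0 (.v 6) (.v 4) (.k 0) (.k 0))) <|
    .seq (setE 9 (.ld (addrE 7 8))) <| .seq (setE 10 (tabE 4 (.v 9) (.v 4) (.v 5) (.k 0)))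
    (setE 24 (.k 0))) <|
  .ite (.lt 24 10) (.seq writeP (.ite (.eq 24 25) deleteP .skip)) .skip

def zeroT (p : Par) : ℕ := deleteT p + 1000

theorem alive_update_of_ne {i : Fin p.n} {Y : ℕ} (h : Y ≠ p.chunk i) :
    Y ∈ Alive p (update B i false) ↔ Y ∈ Alive p B := by
  refine and_congr_right fun _ => exists_congr fun j => and_congr_right fun hj => ?_
  rw [pat_update i hj, if_neg fun hh => h hh.1]

theorem alive_of_notMem {i : Fin p.n} (h : p.offset i ∉ pat p B (p.chunk i) (p.block i)) :
    p.chunk i ∈ Alive p B :=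
  ⟨Par.leaf_chunk i.2, _, Par.block_lt i, pat_ne_iff.2 ⟨_, Par.offset_lt i, h⟩⟩

theorem update_of_mem {i : Fin p.n} (h : p.offset i ∈ pat p B (p.chunk i) (p.block i)) :
    update B i false = B := by
  have := (mem_pat.1 h).2.2
  rw [Par.pos_chunk] at this
  unfold one at this
  push Not at this
  obtain ⟨_, h'⟩ := this
  rw [← (show B i = false by simpa using h'), update_eq_self]

/-- List and trie change only if the chunk loses its last one; then its neighbours in the list exist
because of the sentinels. If the bit is zero already, nothing happens. -/
theorem zeroP_spec {m R : ℕ → ℕ} {O : List ℕ} (hM : Rep p B g m) {i : Fin p.n}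
    (hz : zeros (update B i false) ≤ p.m) (h0 : R 0 = i) :
    WP p.w p.S zeroP ⟨R, m, O⟩ (zeroT p) fun s' => ∃ g', Rep p (update B i false) g' s'.mem := by
  have hC := hM.core
  have hs := hC.stat
  have hi := i.2
  have hnw := p.n_le
  have hY := Par.leaf_chunk i.2
  have hj := Par.block_lt (p := p) i
  have hgrp := Par.grp hY
  have hI := hC.ginv.inv _ hY
  have hlt := hI.slot_lt (p.block i)
  obtain ⟨hc1, hc2⟩ := hC.ginv.encC_spec hlt
  have hdm := Nat.div_mul_le_self (i : ℕ) p.L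
  have hdm2 := Nat.div_mul_le_self (i - i / p.L * p.L : ℕ) p.β
  have hcon := hI.content _ hj
  obtain ⟨P, hP⟩ : ∃ P, P = insert (p.offset i) (pat p B (p.chunk i) (p.block i)) := ⟨_, rfl⟩
  have hPβ : P ⊆ range p.β := by
    rw [hP]
    exact insert_subset (mem_range.2 (Par.offset_lt i)) (pat_subset _ _ _)
  obtain ⟨hP1, hP2⟩ := p.encP_spec P hPβ
  have hdT : 1000 ≤ zeroT p := Nat.le_add_left _ _
  unfold zeroP
  refine WP.mono (t := 350 + (writeT + (deleteT p + 1) + 1)) (WP.seq ?_)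
    (by unfold zeroT writeT; omega) fun _ h => h
  refine .set_seq (x := i / p.L) (by omega) (.div (Ev.reg (by omega) h0) (Ev.par' (by omega) hs.L))
    (by decide) ?_
  refine .set_seq (x := p.chunk i) (by omega) (.add (Ev.reg (by omega) rfl) (Ev.par' (by omega) hs.Y₀)
    (Par.of_lt_D hY.2)) (by decide) ?_
  refine .set_seq (x := i - i / p.L * p.L) (by omega) (.sub (Ev.reg (by omega) h0) (.mul
    (Ev.reg (by omega) rfl) (Ev.par' (by omega) hs.L) (by omega)) (by omega)) (by decide) ?_
  refine .set_seq (x := p.block i) (by omega) (.div (Ev.reg (by omega) rfl) (Ev.par' (by omega) hs.β))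
    (by decide) ?_
  refine .set_seq (x := p.offset i) (by omega) (.sub (Ev.reg (by omega) rfl) (.mul
    (Ev.reg (by omega) rfl) (Ev.par' (by omega) hs.β) ?_) hdm2) (by decide) ?_
  · omega
  refine .set_seq (x := p.encH (g.H (p.chunk i))) (by omega) (Ev.fld' (Ev.reg (by omega) rfl) hY.2
    (by omega) (hC.gmem.hdr _ hY)) (by decide) ?_
  refine .set_seq (x := p.chunk i / p.K * p.K) (by omega) (.mul (.div (Ev.reg (by omega) rfl)
    (Ev.par' (by omega) hs.K)) (Ev.par' (by omega) hs.K)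
    (Par.of_lt_D ((Nat.div_mul_le_self _ p.K).trans_lt hY.2))) (by decide) ?_
  refine .set_seq (by omega) (Core.ev_slot (s := ⟨_, m, O⟩) hC (j := p.block i) hY (by omega)
    (by omega) rfl rfl hj.le) (by decide) ?_
  refine .set_seq (by omega) (Core.ev_cell (s := ⟨_, m, O⟩) hC (t := p.chunk i / p.K) hgrp hlt
    (by omega) (by omega) rfl rfl) (by decide) ?_
  refine .set_seq (x := if p.offset i ∈ pat p B (p.chunk i) (p.block i) then 0 else p.encP P + 1)
    (by omega) (Ev.tab (a := p.encC (g.cell (p.chunk i / p.K) ((g.H (p.chunk i)).slot (p.block i))))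
    (b := p.block i) (c := p.offset i) hs (by omega) (Ev.reg (by omega) rfl)
    (Ev.reg (by omega) rfl) (Ev.reg (by omega) rfl) Core.ev_zero hc1 (hj.trans p.r_lt)
    ((Par.offset_lt i).trans p.β_lt) Core.Q_pos ?_ ?_) (by decide) ?_
  · rw [Par.F, hc2, hcon, ← hP]
  · split_ifs
    · exact Par.lit (by omega)
    · exact Par.of_lt_Q hP1
  refine .set_le (x := 0) (by omega) Core.ev_zero (by decide) ?_
  refine WP.ite ⟨by omega, by omega⟩ (fun h => ?_) fun h => ?_
  · replace h : 0 < if p.offset i ∈ pat p B (p.chunk i) (p.block i) then 0 else p.encP P + 1 := h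
    have ho : p.offset i ∉ pat p B (p.chunk i) (p.block i) := fun hh => by
      rw [if_pos hh] at h; omega
    refine WP.seq (WP.mono (writeP_spec hC hz ho hP rfl rfl rfl rfl (if_neg ho) rfl) le_rfl ?_)
    rintro ⟨R', m', O'⟩ ⟨hC', hPtr, h2, h24, h25⟩
    simp only at hC' hPtr h2 h24 h25
    have hL : Links p (Alive p B) m' := hM.toLinks.congr (fun a ha => ha.1)
      fun x f h1 h2 h3 h4 => hPtr _ ⟨x, f, h1, h2, h3, h4, rfl⟩
    have halive := alive_of_notMem ho
    refine WP.ite ⟨by omega, by omega⟩ (fun hc => ?_) fun hc => ?_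
    · replace hc : R' 24 = R' 25 := hc
      have hdead : p.chunk i ∉ Alive p (update B i false) := fun hh => by
        rw [if_pos hh] at h25; omega
      have heq : Alive p (update B i false) = Alive p B \ {p.chunk i} := by
        ext Y
        by_cases hYi : Y = p.chunk i
        · subst hYi; simp [hdead]
        · rw [alive_update_of_ne hYi]; simp [hYi]
      obtain ⟨pr, hpr⟩ := exists_prev (alive_first B) halive 
        (lt_of_lt_of_le (Nat.lt_succ_self _) (Nat.le_add_left _ _))
      obtain ⟨nx, hnx⟩ := exists_next halive (alive_last B)
        (by have := Par.chunk_lt i.2; unfold Par.D at this; omega)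
      refine WP.mono (deleteP_spec hC'.stat hL (fun a ha => ha.1) hpr hnx h2) le_rfl ?_
      rintro s' ⟨hL', hm'⟩
      rw [← heq] at hL'
      exact ⟨_, hL', hz, hC'.congr hm'⟩
    · replace hc : ¬ R' 24 = R' 25 := hc
      have hal : p.chunk i ∈ Alive p (update B i false) := by
        by_contra hh
        rw [if_neg hh] at h25; omega
      have heq : Alive p (update B i false) = Alive p B := by
        ext Y
        by_cases hYi : Y = p.chunk i
        · subst hYi; exact iff_of_true hal halive
        · rw [alive_update_of_ne hYi]
      rw [← heq] at hL
      exact .skip_le (by unfold deleteT; omega) ⟨_, hL, hz, hC'⟩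
  · replace h : ¬ 0 < if p.offset i ∈ pat p B (p.chunk i) (p.block i) then 0 else p.encP P + 1 := h
    have ho : p.offset i ∈ pat p B (p.chunk i) (p.block i) := by
      by_contra hh
      rw [if_neg hh] at h; omega
    rw [update_of_mem ho]
    exact .skip_le (by unfold writeT; omega) ⟨g, hM⟩

end ZeroReport

end

section
open Finset
namespace ZeroReport
open Chunk Trie WordRAM BitVector Function

variable {p : Par} {B : Fin p.n → Bool} {g : Ghost}

/-! ### The initial memory -/

/-- The state for the bit vector without zeros. -/
def initGhost (p : Par) : Ghost where
  H := fun _ => ⟨fun _ => 0, fun j => decide (j < p.r), 0, 2 * p.Z⟩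
  cell := fun _ _ => Cell.blank
  own := fun _ _ => 0
  cnt := fun _ => 1
  nb := fun _ => 0
  -- Each group starts with one page, which contains its shared empty cell.
  pg := fun s _ => s - 2 ^ p.h / p.K
  np := 2 ^ (p.h + 1) / p.K - 2 ^ p.h / p.K

theorem ginv_init (p : Par) : GInv p (fun _ _ => ∅) (initGhost p) := by
  refine ⟨fun Y hY => ⟨fun j _ => rfl, fun j hj => ?_, fun j hj => ⟨rfl, ?_⟩, fun j => one_pos,
    one_pos, fun j _ => .inl rfl, fun j _ h => absurd rfl h, fun j _ h => ?_, fun j _ _ => ⟨_, rfl⟩,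
    fun id f h => ?_, .inl ⟨rfl, rfl⟩, le_rfl, ?_⟩, fun s id _ => ⟨fun j => empty_subset _,
    fun j _ => rfl, by simp⟩, fun s => rfl, fun s id _ => rfl, fun s => ?_, ?_, fun s hs i _ => ?_,
    fun s s' i i' hs hs' hi hi' he => ?_⟩
  · simp only [initGhost, decide_eq_true_eq]
    refine iff_of_true hj fun h => ?_
    have := mem_range.2 p.β_pos
    rw [← h] at this
    exact absurd this (notMem_empty _)
  · simpa [initGhost] using hj
  · simp at h
  · have := Leaf.pos hY
    change 0 = Y at h
    omega
  · simp [initGhost]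
  · simp [initGhost]
  · simp [initGhost]
  · have := hs.1
    have := hs.2
    simp only [initGhost]
    omega
  · have hi0 : ∀ {i : ℕ}, i * p.K < 1 → i = 0 := fun {i} h => by
      by_contra hne
      have := Nat.mul_pos (Nat.pos_of_ne_zero hne) p.K_pos
      omega
    have h1 := hs.1
    have h2 := hs'.1
    simp only [initGhost] at he hi hi'
    exact ⟨by omega, by rw [hi0 hi, hi0 hi']⟩

/-- The words of a record. -/
noncomputable def initRecord (p : Par) (T₁ T₂ : ℕ → ℕ) (x : ℕ) : ℕ → ℕ
  | 0 => if x = 0 then p.L else p.encH ((initGhost p).H x)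
  | 1 => if x = 0 then p.β else x + 1
  | 2 => if x = 0 then p.K else x - 1
  | 3 => if x = 0 then p.Q else T₁ x
  | 4 => if x = 0 then p.TB else T₂ x
  | 5 => Nat.size x - 1
  | 6 => if x = 0 then p.HB + p.K * (initGhost p).np else p.HB + p.K * (x / p.K - 2 ^ p.h / p.K)
  | 7 => if x = 0 then p.Y₀ else 1
  | _ => 0

open Classical in
noncomputable def initMem (p : Par) (T₁ T₂ : ℕ → ℕ) (x : ℕ) : ℕ :=
  (if x < p.TB then initRecord p T₁ T₂ (x / 16) (x % 16)
  else if x < p.HB then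
    if h : ∃ a : ℕ × ℕ × ℕ × ℕ × ℕ, a.1 < p.Q ∧ a.2.1 < p.Q ∧ a.2.2.1 < p.Q ∧ a.2.2.2.1 < p.Q ∧
      a.2.2.2.2 < p.Q ∧ x = p.TB + p.tabIdx a.1 a.2.1 a.2.2.1 a.2.2.2.1 a.2.2.2.2
    then p.F h.choose.1 h.choose.2.1 h.choose.2.2.1 h.choose.2.2.2.1 h.choose.2.2.2.2 else 0
  else p.encC Cell.blank) % 2 ^ p.w

theorem Par.tabIdx_inj {op a b c d op' a' b' c' d' : ℕ} (ha : a < p.Q) (hb : b < p.Q)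
    (hc : c < p.Q) (hd : d < p.Q) (ha' : a' < p.Q) (hb' : b' < p.Q) (hc' : c' < p.Q) (hd' : d' < p.Q)
    (h : p.tabIdx op a b c d = p.tabIdx op' a' b' c' d') :
    op = op' ∧ a = a' ∧ b = b' ∧ c = c' ∧ d = d' := by
  have key : ∀ {x x' y y' : ℕ}, y < p.Q → y' < p.Q → x * p.Q + y = x' * p.Q + y' → x = x' ∧ y = y' := by
    intro x x' y y' hy hy' h
    have h1 : (x * p.Q + y) / p.Q = x := by
      rw [mul_comm, Nat.mul_add_div (by omega), Nat.div_eq_of_lt hy, add_zero]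
    have h2 : (x' * p.Q + y') / p.Q = x' := by
      rw [mul_comm, Nat.mul_add_div (by omega), Nat.div_eq_of_lt hy', add_zero]
    obtain rfl : x = x' := by rw [← h1, ← h2, h]
    exact ⟨rfl, by omega⟩
  obtain ⟨h1, rfl⟩ := key hd hd' h
  obtain ⟨h2, rfl⟩ := key hc hc' h1
  obtain ⟨h3, rfl⟩ := key hb hb' h2
  obtain ⟨h4, rfl⟩ := key ha ha' h3
  exact ⟨h4, rfl, rfl, rfl, rfl⟩

theorem initMem_rec {T₁ T₂ : ℕ → ℕ} {x f : ℕ} (hx : x < p.D) (hf : f < 16) :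
    initMem p T₁ T₂ (16 * x + f) = initRecord p T₁ T₂ x f % 2 ^ p.w := by
  rw [initMem, if_pos (by unfold Par.TB; omega), show (16 * x + f) / 16 = x by omega,
    show (16 * x + f) % 16 = f by omega]

theorem initMem_tab {T₁ T₂ : ℕ → ℕ} {op a b c d : ℕ} (ho : op < p.Q) (ha : a < p.Q) (hb : b < p.Q)
    (hc : c < p.Q) (hd : d < p.Q) :
    initMem p T₁ T₂ (p.TB + p.tabIdx op a b c d) = p.F op a b c d % 2 ^ p.w := by
  have hlt := Par.tabIdx_lt ho ha hb hc hd
  have hex : ∃ z : ℕ × ℕ × ℕ × ℕ × ℕ, z.1 < p.Q ∧ z.2.1 < p.Q ∧ z.2.2.1 < p.Q ∧ z.2.2.2.1 < p.Q ∧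
      z.2.2.2.2 < p.Q ∧ p.TB + p.tabIdx op a b c d =
        p.TB + p.tabIdx z.1 z.2.1 z.2.2.1 z.2.2.2.1 z.2.2.2.2 :=
    ⟨(op, a, b, c, d), ho, ha, hb, hc, hd, rfl⟩
  rw [initMem, if_neg (by omega), if_pos (by unfold Par.HB; omega), dif_pos hex]
  obtain ⟨-, h2, h3, h4, h5, h6⟩ := hex.choose_spec
  obtain ⟨e1, e2, e3, e4, e5⟩ := Par.tabIdx_inj ha hb hc hd h2 h3 h4 h5 (Nat.add_left_cancel h6)
  rw [← e1, ← e2, ← e3, ← e4, ← e5]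

theorem pat_true (p : Par) : pat p (fun _ => true) = fun _ _ => ∅ := by
  funext Y j
  refine eq_empty_of_forall_notMem fun o ho => ?_
  exact (mem_pat.1 ho).2.2 fun _ => rfl

theorem mem_alive_true {Y : ℕ} : Y ∈ Alive p (fun _ => true) ↔ Leaf p.h Y := by
  refine and_iff_left ⟨0, p.r_pos, pat_ne_iff.2 ⟨0, p.β_pos, ?_⟩⟩
  rw [pat_true]
  exact notMem_empty _

/-- All leaves have a one at the start, so list neighbours are adjacent numbers, and the trie
pointers come from `exists_trieOK`. -/
theorem exists_rep_true (p : Par) :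
    ∃ m : ℕ → ℕ, (∀ a, m a < 2 ^ p.w) ∧ Rep p (fun _ => true) (initGhost p) m := by
  have hA : ∀ a ∈ Alive p (fun _ => true), Leaf p.h a := fun a ha => ha.1
  obtain ⟨T₁, hl₁, hT₁⟩ := exists_trieOK (lt := (· < ·)) p.b p.k p.h (.inl rfl) hA
  obtain ⟨T₂, hl₂, hT₂⟩ := exists_trieOK (lt := (· > ·)) p.b p.k p.h (.inr rfl) hA
  have hwpos : 0 < 2 ^ p.w := by positivity
  have hG := ginv_init p
  have hnp := hG.np_le (m := p.m) (by simp)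
  have hroom : p.HB + p.K * (initGhost p).np ≤ p.S := by
    have := p.space'
    unfold Par.HS at this
    omega
  have hS := p.S_lt
  have hD := p.D_pos
  have hTB : p.TB < 2 ^ p.w := by
    have := p.space'
    unfold Par.HB at this
    omega
  have hzero : ∀ {f v : ℕ}, f < 16 → initRecord p T₁ T₂ 0 f = v → v < 2 ^ p.w →
      initMem p T₁ T₂ f = v := fun {f v} hf h hv => by
    have := initMem_rec (p := p) (T₁ := T₁) (T₂ := T₂) (x := 0) hD hf
    rw [h, Nat.mod_eq_of_lt hv] at this
    simpa using this
  have hrec : ∀ {x f v : ℕ}, x < p.D → f < 16 → initRecord p T₁ T₂ x f = v → v < 2 ^ p.w →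
      initMem p T₁ T₂ (16 * x + f) = v := fun {x f v} hx hf h hv => by
    rw [initMem_rec hx hf, h, Nat.mod_eq_of_lt hv]
  have hgrp : ∀ {s : ℕ}, p.Grp s → s * p.K < p.D := fun {s} hs => by
    simpa using Par.rec_lt hs p.K_pos
  have hKQ : p.K < p.Q := (Nat.le_mul_self p.K).trans_lt p.KK_lt
  have hrecpos : ∀ {x f v : ℕ}, 1 ≤ x → (f = 3 → v = T₁ x) → (f = 4 → v = T₂ x) → (f = 3 ∨ f = 4) →
      initRecord p T₁ T₂ x f = v := by
    rintro x f v hx h3 h4 (rfl | rfl)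
    · rw [h3 rfl]; exact if_neg (by omega)
    · rw [h4 rfl]; exact if_neg (by omega)
  have hpt : ∀ {lt : ℕ → ℕ → Prop} {A : Set ℕ} {j v y : ℕ}, (∀ a ∈ A, Leaf p.h a) → j ≤ p.h →
      IsFirst lt A j v y → 1 ≤ v ∧ v < p.D := fun {lt A j v y} hA hj hy =>
    hy.2.1 ▸ ⟨Leaf.one_le_shiftRight (hA y hy.1) hj, (hA y hy.1).shiftRight_lt j⟩
  have hmin : ∀ v, 1 ≤ v → v < p.D → initMem p T₁ T₂ (16 * v + 3) = T₁ v := fun v h1 h2 =>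
    hrec h2 (by omega) (hrecpos h1 (fun _ => rfl) (by omega) (.inl rfl)) (Par.of_lt_D (hl₁ v).2)
  have hmax : ∀ v, 1 ≤ v → v < p.D → initMem p T₁ T₂ (16 * v + 4) = T₂ v := fun v h1 h2 =>
    hrec h2 (by omega) (hrecpos h1 (by omega) (fun _ => rfl) (.inr rfl)) (Par.of_lt_D (hl₂ v).2)
  refine ⟨initMem p T₁ T₂, fun a => Nat.mod_lt _ hwpos, ⟨fun x y hxy => ?_,
    fun j h1 h2 v y hy => ?_, fun j h1 h2 v y hy => ?_, fun v h1 h2 => ?_, fun v h1 h2 => ?_⟩, ?_,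
    ⟨⟨?_, ?_, ?_, ?_, ?_, ?_, fun op a b c d ho ha hb hc hd => initMem_tab ho ha hb hc hd,
    fun x hx => ?_⟩, ?_, ⟨fun Y hY => ?_, fun s hs i hi => ?_, fun s hs => ?_, fun s hs id hid => ?_,
    ?_⟩, pat_subset _, hroom⟩⟩
  · obtain ⟨hx, hy, hlt, hno⟩ := hxy
    rw [mem_alive_true] at hx hy
    have hx1 := Leaf.pos hx
    have hy2 : y < p.D := hy.2
    obtain rfl : y = x + 1 := by
      by_contra hne
      have h1 := hx.1
      have h2 := hy.2
      exact hno (x + 1) (mem_alive_true.2 ⟨by omega, by omega⟩) ⟨by omega, by omega⟩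
    exact ⟨hrec hx.2 (by omega) (if_neg (by omega)) (Par.of_lt_D hy2),
      hrec hy.2 (by omega) rfl (Par.of_lt_D hx.2)⟩
  · obtain ⟨a, b⟩ := hpt hA h2 hy
    simp only [hmin v a b]
    exact hT₁ j h1 h2 v y hy
  · obtain ⟨a, b⟩ := hpt hA h2 hy
    simp only [hmax v a b]
    exact hT₂ j h1 h2 v y hy
  · rw [hmin v h1 h2]; exact hl₁ v
  · rw [hmax v h1 h2]; exact hl₂ v
  · simp [zeros]
  · exact hzero (by omega) rfl (Par.of_lt_L le_rfl)
  · exact hzero (by omega) rfl (Par.of_lt_Q p.β_lt)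
  · exact hzero (by omega) rfl (Par.of_lt_Q hKQ)
  · refine hzero (by omega) rfl ?_
    have := p.space'
    have := p.Q_le
    unfold Par.HB at *
    omega
  · exact hzero (by omega) rfl hTB
  · refine hzero (by omega) rfl (Par.of_lt_D ?_)
    have := p.two_le
    have hp : 2 ^ (p.h + 1) = 2 ^ p.h * 2 := pow_succ ..
    unfold Par.D Par.Y₀; omega
  · refine hrec hx (by omega) rfl (Par.of_lt_Q (lt_of_le_of_lt ?_ p.h_lt))
    have := Nat.size_le.2 hx
    omega
  · rw [pat_true]; exact hG
  · refine hrec hY.2 (by omega) (if_neg (by have := Leaf.pos hY; omega)) (Par.of_lt_Q ?_)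
    exact (hG.encH_spec (fun _ _ => empty_subset _) hY).1
  · have hi0 : i = 0 := by
      by_contra hne
      have := Nat.mul_pos (Nat.pos_of_ne_zero hne) p.K_pos
      change _ < 1 at hi
      omega
    subst hi0
    have hpg := hG.pg_lt s hs 0 hi
    have h2 := Nat.mul_le_mul_left p.K hpg.le
    refine hrec (hgrp hs) (by omega) ((if_neg (by have := hs.one_le; omega)).trans ?_) (by omega)
    rw [add_zero, Nat.mul_div_cancel _ p.K_pos]
    rfl
  · exact hrec (hgrp hs) (by omega) (if_neg (by have := hs.one_le; omega)) (Par.lit (show 1 ≤ 16 by omega))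
  · have h := (hG.encC_spec hid).1
    have hle : ∀ a b, p.HB ≤ p.HB + a + b := fun a b => by omega
    rw [initMem, if_neg (Nat.not_lt.2 ((Nat.le_add_right _ _).trans (hle _ _))),
      if_neg (Nat.not_lt.2 (hle _ _))]
    exact Nat.mod_eq_of_lt (Par.of_lt_Q h)
  · exact hzero (by omega) rfl (by omega)

/-! ### The data structure -/

/-- `M` is a memory that represents `B`. -/
def Valid (p : Par) (B : Fin p.n → Bool) (M : Fin p.S → BitVec p.w) : Prop :=
  ∃ g m, Rep p B g m ∧ ∀ a, (M a).toNat = m a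

theorem rel_start {w S : ℕ} {M : Fin S → BitVec w} {m : ℕ → ℕ} (h : ∀ a, (M a).toNat = m a)
    (args : List (BitVec w)) :
    Rel (State.start M args) ⟨fun r => (args.getD r 0).toNat, m, []⟩ :=
  ⟨fun _ _ => rfl, h, rfl⟩

theorem Valid.zero {M : Fin p.S → BitVec p.w} (hM : Valid p B M) (i : Fin p.n)
    (hz : zeros (update B i false) ≤ p.m) :
    ∃ (σ : State p.w p.S) (t : ℕ), Exec zeroP (State.start M [BitVec.ofNat p.w i]) σ t ∧
      t ≤ zeroT p ∧ Valid p (update B i false) σ.mem := by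
  obtain ⟨g, m, hR, hm⟩ := hM
  have hi : (i : ℕ) < 2 ^ p.w := i.2.trans_le p.n_le
  obtain ⟨σ, s', t, he, ht, hr, g', hR'⟩ := zeroP_spec hR hz (R := fun r =>
    (([BitVec.ofNat p.w i] : List (BitVec p.w)).getD r 0).toNat) (O := [])
    (by simp [Nat.mod_eq_of_lt hi]) _ (rel_start hm _)
  exact ⟨σ, t, he, ht, g', _, hR', hr.2.1⟩

/-- Restoring a zero to one gives a vector with fewer zeros; the operation that sets it back
produces a memory for the given vector. Only existence matters, so the time of this construction is
irrelevant. -/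
theorem exists_valid (d : ℕ) : ∀ B : Fin p.n → Bool, zeros B = d → zeros B ≤ p.m →
    ∃ M, Valid p B M := by
  induction d with
  | zero =>
    intro B hB _
    obtain ⟨m, hlt, hR⟩ := exists_rep_true p
    have : B = fun _ => true := by
      funext i
      by_contra hne
      have := Finset.card_eq_zero.1 hB
      exact absurd (this ▸ mem_filter.2 ⟨mem_univ i, by simpa using hne⟩ : i ∈ (∅ : Finset _))
        (notMem_empty i)
    subst this
    exact ⟨fun a => BitVec.ofNat p.w (m a), _, m, hR, fun a => by
      simp [Nat.mod_eq_of_lt (hlt a)]⟩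
  | succ d ih =>
    intro B hB hm
    obtain ⟨i, hi⟩ : (univ.filter fun i => B i = false).Nonempty := card_pos.1 (by
      change 0 < zeros B; omega)
    replace hi := (mem_filter.1 hi).2
    have hB' : zeros (update B i true) = d := by
      have : (univ.filter fun j => update B i true j = false) =
          (univ.filter fun j => B j = false).erase i := by
        ext j
        by_cases h : j = i
        · subst h; simp
        · simp [h]
      unfold zeros
      rw [this, card_erase_of_mem (mem_filter.2 ⟨mem_univ i, hi⟩)]
      change zeros B - 1 = d
      omega
    obtain ⟨M, hM⟩ := ih _ hB' (by omega)
    have heq : update (update B i true) i false = B := by rw [update_idem, ← hi, update_eq_self]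
    obtain ⟨σ, t, -, -, h⟩ := hM.zero i (by rw [heq]; exact hm)
    rw [heq] at h
    exact ⟨_, h⟩

/-- The output is known as a multiset, namely that of a finite set of positions. This yields both
that nothing is repeated and that exactly the right positions occur. -/
theorem Valid.report {M : Fin p.S → BitVec p.w} (hM : Valid p B M) (s e : Fin p.n) :
    ∃ (σ : State p.w p.S) (t : ℕ),
      Exec reportP (State.start M [BitVec.ofNat p.w s, BitVec.ofNat p.w e]) σ t ∧
      t ≤ reportT p.k * ((onesIn B s e).card + 1) ∧ σ.out.Nodup ∧
      (∀ x : BitVec p.w, x ∈ σ.out ↔ ∃ j ∈ onesIn B s e, x.toNat = j) ∧ Valid p B σ.mem := by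
  classical
  obtain ⟨g, m, hR, hm⟩ := hM
  have hs : (s : ℕ) < 2 ^ p.w := s.2.trans_le p.n_le
  have he : (e : ℕ) < 2 ^ p.w := e.2.trans_le p.n_le
  have hones : (onesIn B s e).map Fin.valEmbedding = (Ico (s : ℕ) (e + 1)).filter (one p B) := by
    ext x
    simp only [mem_map, onesIn, mem_filter, mem_univ, true_and, mem_Ico, Fin.valEmbedding_apply, one]
    constructor
    · rintro ⟨j, ⟨h1, h2, h3⟩, rfl⟩
      exact ⟨⟨h1, Nat.lt_succ_of_le h2⟩, fun _ => h3⟩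
    · rintro ⟨⟨h1, h2⟩, h3⟩
      have hx : x < p.n := by have := e.2; omega
      exact ⟨⟨x, hx⟩, ⟨h1, Nat.le_of_lt_succ h2, h3 hx⟩, rfl⟩
  obtain ⟨σ, s', t, hex, ht, hr, h1, h2⟩ := reportP_spec hR s.2 e.2 (R := fun r =>
    (([BitVec.ofNat p.w s, BitVec.ofNat p.w e] : List (BitVec p.w)).getD r 0).toNat) (O := [])
    (by simp [Nat.mod_eq_of_lt hs]) (by simp [Nat.mod_eq_of_lt he]) _ (rel_start hm _)
  have hcard : (ones p B s (e + 1)).card = (onesIn B s e).card := by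
    rw [ones, ← hones]
    exact card_map _
  rw [hcard] at ht
  have hout : (σ.out.map BitVec.toNat : Multiset ℕ) = ones p B s (e + 1) := by
    rw [hr.2.2, h2]; simp
  refine ⟨σ, t, hex, ht, ?_, fun x => ?_, g, _, hR, fun a => ?_⟩
  · have : (σ.out.map BitVec.toNat).Nodup := by
      rw [← Multiset.coe_nodup, hout]
      exact Finset.nodup _
    exact this.of_map
  · have hx : x ∈ σ.out ↔ x.toNat ∈ ones p B s (e + 1) := by
      rw [← hout, Multiset.mem_coe, List.mem_map]
      exact ⟨fun h => ⟨x, h, rfl⟩, fun ⟨y, hy, h⟩ => BitVec.eq_of_toNat_eq h ▸ hy⟩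
    rw [hx, ones, ← hones, Finset.mem_val, mem_map]
    exact exists_congr fun j => and_congr_right fun _ => eq_comm
  · rw [hr.2.1, h1]

theorem isZeroReportStructure (p : Par) {m tz tr : ℝ}
    (hm : ∀ B : Fin p.n → Bool, (zeros B : ℝ) ≤ m → zeros B ≤ p.m) (htz : (zeroT p : ℝ) ≤ tz)
    (htr : (reportT p.k : ℝ) ≤ tr) :
    IsZeroReportStructure zeroP reportP p.n p.w p.S m tz tr := by
  refine ⟨Valid p, fun B hB => exists_valid _ B rfl (hm B hB), fun B M hM i hz => ?_,
    fun B M hM s e => ?_⟩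
  · obtain ⟨σ, t, h1, h2, h3⟩ := hM.zero i (hm _ hz)
    exact ⟨σ, t, h1, (Nat.cast_le.2 h2).trans htz, h3⟩
  · obtain ⟨σ, t, h1, h2, h3⟩ := hM.report s e
    refine ⟨σ, t, h1, (Nat.cast_le.2 h2).trans ?_, h3⟩
    push_cast
    exact mul_le_mul_of_nonneg_right htr (by positivity)

end ZeroReport

end

section
open Finset
namespace ZeroReport
open Chunk

/-! ### Codes -/

theorem exists_code {α ι : Type*} [Nonempty α] (T : Finset ι) (f : ι → α) {Q : ℕ} (hT : #T ≤ Q) :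
    ∃ (enc : α → ℕ) (dec : ℕ → α), ∀ x ∈ T, enc (f x) < Q ∧ dec (enc (f x)) = f x := by
  classical
  let s := T.image f
  let i : α → ℕ := fun a => if h : a ∈ s then s.equivFin ⟨a, h⟩ else 0
  have hi : ∀ a, ∀ h : a ∈ s, i a = s.equivFin ⟨a, h⟩ := fun a h => dif_pos h
  have hinj : Set.InjOn i s := fun a ha b hb h => by
    rw [hi a ha, hi b hb] at h
    exact congrArg Subtype.val (s.equivFin.injective (Fin.ext h))
  refine ⟨i, Function.invFunOn i s, fun x hx => ?_⟩
  have hx' : f x ∈ s := mem_image_of_mem f hx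
  refine ⟨?_, hinj.leftInvOn_invFunOn hx'⟩
  rw [hi _ hx']
  exact (Fin.is_lt _).trans_le (card_image_le.trans hT)

/-- In the expansion of `(2 ^ s + 1) ^ #V` a subset with at most `c` elements contributes at least
`2 ^ (s * (#V - c))` (for `c ≤ #V`). Moreover `(1 + 2 ^ (-s)) ^ d ≤ 4` for `d ≤ 2 ^ s`, by
comparison with the exponential function. So `s` bits per element suffice, apart from two bits for
each `2 ^ s` elements of the ground set begun. -/
theorem card_powerset_filter_le {α : Type*} (V : Finset α) (s c : ℕ) :
    #{U ∈ V.powerset | #U ≤ c} ≤ 2 ^ (s * c + 2 * (#V / 2 ^ s + 1)) := by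
  have h1 : #{U ∈ V.powerset | #U ≤ c} * 2 ^ (s * #V) ≤ 2 ^ (s * c) * (2 ^ s + 1) ^ #V := by
    rw [add_comm, ← sum_pow_mul_eq_add_pow, mul_sum]
    refine le_trans ?_ (sum_le_sum_of_subset (filter_subset (fun U => #U ≤ c) V.powerset))
    refine le_trans (le_of_eq ?_) (card_nsmul_le_sum {U ∈ V.powerset | #U ≤ c} _ (2 ^ (s * #V)) fun U hU => ?_)
    · rw [smul_eq_mul]
    · rw [mem_filter, mem_powerset] at hU
      rw [one_pow, one_mul, ← pow_mul, ← pow_add, ← mul_add]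
      have := card_le_card hU.1
      exact Nat.pow_le_pow_right two_pos (Nat.mul_le_mul_left _ (by omega))
  have h2 : ∀ d ≤ 2 ^ s, (2 ^ s + 1) ^ d ≤ 4 * 2 ^ (s * d) := fun d hd => by
    have hp : (0 : ℝ) < 2 ^ s := by positivity
    have h : (1 + 1 / (2 ^ s : ℝ)) ^ d ≤ 4 := by
      calc (1 + 1 / (2 ^ s : ℝ)) ^ d ≤ Real.exp (1 / 2 ^ s) ^ d :=
            pow_le_pow_left₀ (by positivity) (by rw [add_comm]; exact Real.add_one_le_exp _) _
        _ = Real.exp (d * (1 / 2 ^ s)) := (Real.exp_nat_mul _ _).symm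
        _ ≤ Real.exp 1 := by
          refine Real.exp_le_exp.2 ?_
          rw [mul_one_div, div_le_one hp]
          exact_mod_cast hd
        _ ≤ 4 := by have := Real.exp_one_lt_d9; linarith
    have : (2 ^ s + 1 : ℝ) ^ d ≤ 4 * 2 ^ (s * d) := by
      rw [pow_mul, ← div_le_iff₀ (by positivity), ← div_pow, add_div, div_self hp.ne']
      exact h
    exact_mod_cast this
  have h3 : (2 ^ s + 1) ^ #V ≤ 2 ^ (2 * (#V / 2 ^ s + 1)) * 2 ^ (s * #V) := by
    have hV := Nat.div_add_mod #V (2 ^ s)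
    have hd := Nat.mod_lt #V (pow_pos two_pos s)
    set a := #V / 2 ^ s
    set d := #V % 2 ^ s
    rw [← hV, pow_add, pow_mul]
    calc _ ≤ (4 * 2 ^ (s * 2 ^ s)) ^ a * (4 * 2 ^ (s * d)) :=
          Nat.mul_le_mul (Nat.pow_le_pow_left (h2 _ le_rfl) a) (h2 d hd.le)
      _ = _ := by
        rw [show (4 : ℕ) = 2 ^ 2 by rfl, mul_pow, ← pow_mul, ← pow_mul, ← pow_add, ← pow_add,
          ← pow_add, ← pow_add]
        congr 1
        ring
  refine Nat.le_of_mul_le_mul_right (h1.trans ?_) (pow_pos two_pos (s * #V))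
  rw [pow_add, mul_assoc]
  exact Nat.mul_le_mul_left _ h3

/-- A shared cell is a set of at most `2 * Z` pairs of a block and an offset; the other cells are
subsets of a block. -/
theorem exists_encC {r β Z s Q : ℕ}
    (h : 2 ^ (s * (2 * Z) + 2 * (r * β / 2 ^ s + 1)) + 2 ^ β ≤ Q) :
    ∃ (enc : Cell → ℕ) (dec : ℕ → Cell), ∀ c : Cell, c.Valid r β Z → enc c < Q ∧ dec (enc c) = c := by
  classical
  have : Nonempty Cell := ⟨.blank⟩
  let V := range r ×ˢ range β
  obtain ⟨enc, dec, hc⟩ := exists_code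
    ((V.powerset.filter fun U => #U ≤ 2 * Z).disjSum (range β).powerset)
    (Sum.elim (fun U => Cell.bin fun j => (range β).filter fun x => (j, x) ∈ U) Cell.plain)
    (Q := Q) (by
      rw [card_disjSum, card_powerset, card_range]
      refine le_trans (Nat.add_le_add_right (card_powerset_filter_le V s _) _) ?_
      rwa [card_product, card_range, card_range])
  refine ⟨enc, dec, fun c hv => ?_⟩
  cases c with
  | plain P => exact hc (.inr P) (inr_mem_disjSum.2 (mem_powerset.2 hv))
  | bin f =>
    obtain ⟨h1, h2, h3⟩ := hv
    have := hc (.inl ((range r).sigma f |>.image fun x => (x.1, x.2))) (by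
      refine inl_mem_disjSum.2 (mem_filter.2 ⟨mem_powerset.2 fun x hx => ?_, ?_⟩)
      · obtain ⟨y, hy, rfl⟩ := mem_image.1 hx
        rw [mem_sigma] at hy
        exact mem_product.2 ⟨hy.1, h1 _ hy.2⟩
      · exact card_image_le.trans ((card_sigma _ _).trans_le h3))
    have e : (fun j => (range β).filter fun x =>
        (j, x) ∈ ((range r).sigma f).image fun x => (x.1, x.2)) = f := by
      funext j
      ext x
      simp only [mem_filter, mem_image, mem_sigma, Prod.mk.injEq, Sigma.exists]
      constructor
      · rintro ⟨-, a, b, ⟨-, hb⟩, rfl, rfl⟩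
        exact hb
      · intro hx
        refine ⟨h1 j hx, j, x, ⟨?_, hx⟩, rfl, rfl⟩
        by_contra hj
        rw [h2 j (by simpa using hj)] at hx
        exact notMem_empty x hx
    simp only [Sum.elim_inl, e] at this
    exact this

theorem exists_encP {β Q : ℕ} (h : 2 ^ β < Q) : ∃ (enc : Finset ℕ → ℕ) (dec : ℕ → Finset ℕ),
    ∀ P, P ⊆ range β → enc P + 1 < Q ∧ dec (enc P) = P := by
  obtain ⟨enc, dec, hc⟩ := exists_code (range β).powerset id (Q := 2 ^ β) (by simp)
  refine ⟨enc, dec, fun P hP => ?_⟩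
  obtain ⟨h1, h2⟩ := hc P (mem_powerset.2 hP)
  exact ⟨lt_of_le_of_lt h1 h, h2⟩

theorem exists_encH {r K Z Q : ℕ} (h : K ^ r * 2 ^ r * K * (2 * Z + 1) ≤ Q) :
    ∃ (enc : Hdr → ℕ) (dec : ℕ → Hdr), ∀ H : Hdr, (∀ j, H.slot j < K) →
      (∀ j, r ≤ j → H.slot j = 0 ∧ H.ne j = false) → H.opn < K → H.fill ≤ 2 * Z →
      enc H < Q ∧ dec (enc H) = H := by
  classical
  have : Nonempty Hdr := ⟨⟨fun _ => 0, fun _ => false, 0, 0⟩⟩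
  obtain ⟨enc, dec, hc⟩ := exists_code
    (univ : Finset ((Fin r → Fin K) × (Fin r → Bool) × Fin K × Fin (2 * Z + 1)))
    (fun x => ⟨fun j => if h : j < r then x.1 ⟨j, h⟩ else 0,
      fun j => if h : j < r then x.2.1 ⟨j, h⟩ else false, x.2.2.1, x.2.2.2⟩ : _ → Hdr)
    (Q := Q) (by simpa [mul_assoc] using h)
  refine ⟨enc, dec, fun H h1 h2 h3 h4 => ?_⟩
  have := hc (fun j => ⟨H.slot j, h1 j⟩, fun j => H.ne j, ⟨H.opn, h3⟩, ⟨H.fill, by omega⟩) (mem_univ _)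
  have e : (⟨fun j => if h : j < r then H.slot j else 0,
      fun j => if h : j < r then H.ne j else false, H.opn, H.fill⟩ : Hdr) = H := by
    obtain ⟨sl, ne, o, f⟩ := H
    congr 1
    · funext j
      split_ifs with hj
      · rfl
      · exact (h2 j (by omega)).1.symm
    · funext j
      split_ifs with hj
      · rfl
      · exact (h2 j (by omega)).2.symm
  simp only [e] at this
  exact this

end ZeroReport

end

section
open Finset
namespace ZeroReport
open Chunk

/-! ### The choice of the sizes -/

section sizes

variable {q t : ℕ}

/-- The number of blocks of a chunk. -/
def blocks (t : ℕ) : ℕ := 2 ^ t / t + 1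

theorem pow_le_blocks_mul (ht : 1 ≤ t) : 2 ^ t ≤ blocks t * t := by
  have := Nat.lt_div_mul_add (a := 2 ^ t) ht
  rw [blocks, Nat.succ_mul]
  exact this.le

theorem blocks_mul_le : blocks t * t ≤ 2 ^ t + t := by
  rw [blocks, Nat.succ_mul]
  exact Nat.add_le_add_right (Nat.div_mul_le_self _ _) _

theorem blocks_le (t : ℕ) : blocks t ≤ 2 * 2 ^ t := by
  have := Nat.div_le_self (2 ^ t) t
  have := Nat.one_le_two_pow (n := t)
  unfold blocks
  omega

/-- `2 ^ e` is half the largest power of two up to `q / (16 * t)`. It is small enough for `2 * 2 ^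
e` zeros at `t + 4` bits each to fit easily in `q` bits, and large enough, of order `q / t`, for few
cells to be needed. -/
theorem exists_capacity (ht : 1 ≤ t) (htq : 64 * 2 ^ t ≤ q) :
    ∃ e, 2 * 2 ^ e * (16 * t) ≤ q ∧ q < 64 * t * 2 ^ e := by
  have h2 : 2 ≤ q / (16 * t) := by
    have := Nat.lt_two_pow_self (n := t)
    rw [Nat.le_div_iff_mul_le (by omega)]
    omega
  have hl : 1 ≤ Nat.log 2 (q / (16 * t)) := Nat.log_pos one_lt_two h2
  obtain ⟨e, he⟩ := Nat.exists_eq_add_of_le' hl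
  have h3 := Nat.pow_log_le_self 2 (x := q / (16 * t)) (by omega)
  have h4 := Nat.lt_pow_succ_log_self one_lt_two (q / (16 * t))
  rw [he] at h3 h4
  refine ⟨e, ?_, ?_⟩
  · rw [Nat.le_div_iff_mul_le (by omega), pow_succ, mul_comm (2 ^ e)] at h3
    exact h3
  · rw [Nat.succ_eq_add_one, Nat.div_lt_iff_lt_mul (by omega), pow_succ, pow_succ] at h4
    linarith

theorem two_mul_capacity_le {e : ℕ} (ht : 1 ≤ t) (he : 2 * 2 ^ e * (16 * t) ≤ q) : 2 * 2 ^ e ≤ q / 16 := by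
  rw [Nat.le_div_iff_mul_le (by norm_num)]
  nlinarith

/-- The `r` cell numbers take `2 * (t + 10)` bits each. As `r * t` is about `2 ^ t`, they take O(2 ^
t) bits together, and `64 * 2 ^ t ≤ q` leaves room for the remaining fields. -/
theorem header_code_bound {e : ℕ} (ht : 1 ≤ t) (htq : 64 * 2 ^ t ≤ q)
    (he : 2 * 2 ^ e * (16 * t) ≤ q) :
    (2 ^ (t + 10) * 2 ^ (t + 10)) ^ blocks t * 2 ^ blocks t * (2 ^ (t + 10) * 2 ^ (t + 10)) *
      (2 * 2 ^ e + 1) ≤ 2 ^ q := by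
  have h1 := two_mul_capacity_le ht he
  have h2 : 2 * 2 ^ e + 1 ≤ 2 ^ (q / 16) := (Nat.succ_le_succ h1).trans Nat.lt_two_pow_self
  refine (Nat.mul_le_mul_left _ h2).trans ?_
  rw [← pow_add, ← pow_mul, ← pow_add, ← pow_add, ← pow_add]
  refine Nat.pow_le_pow_right two_pos ?_
  have h3 := blocks_mul_le (t := t)
  have h4 := blocks_le t
  have h5 := Nat.lt_two_pow_self (n := t)
  have h6 : 2 ≤ 2 ^ t := Nat.pow_le_pow_right (n := 2) two_pos ht
  have h7 : (t + 10 + (t + 10)) * blocks t = 2 * (blocks t * t) + 20 * blocks t := by ring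
  omega

/-- With `s = t + 4`, the zeros take at most `5 * q / 16` bits, and the ground set of at most `2 * 2
^ t * q` positions costs about `q / 4` more. So both kinds of cells have at most `2 ^ (q - 2)`
values. -/
theorem cell_code_bound {e : ℕ} (ht : 1 ≤ t) (htq : 64 * 2 ^ t ≤ q)
    (he : 2 * 2 ^ e * (16 * t) ≤ q) :
    2 ^ ((t + 4) * (2 * 2 ^ e) + 2 * (blocks t * (q - 2) / 2 ^ (t + 4) + 1)) + 2 ^ (q - 2) ≤ 2 ^ q := by
  have h6 : 2 ≤ 2 ^ t := Nat.pow_le_pow_right (n := 2) two_pos ht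
  have h1 : (t + 4) * (2 * 2 ^ e) ≤ 5 * (q / 16) := by
    have h : (2 * 2 ^ e) * t ≤ q / 16 := by
      rw [Nat.le_div_iff_mul_le (by norm_num)]; linarith
    have := two_mul_capacity_le ht he
    nlinarith
  have h2 : blocks t * (q - 2) / 2 ^ (t + 4) ≤ q / 8 := by
    refine (Nat.div_le_div_right (Nat.mul_le_mul (blocks_le t) (Nat.sub_le q 2))).trans ?_
    rw [pow_add, show 2 * 2 ^ t * q = 2 ^ t * (2 * q) by ring,
      Nat.mul_div_mul_left _ _ (by positivity)]
    omega
  have h3 : 2 ^ ((t + 4) * (2 * 2 ^ e) + 2 * (blocks t * (q - 2) / 2 ^ (t + 4) + 1)) ≤ 2 ^ (q - 2) :=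
    Nat.pow_le_pow_right two_pos (by omega)
  have h4 : 2 ^ q = 2 ^ (q - 2) * 4 := by
    rw [show 4 = 2 ^ 2 by rfl, ← pow_add]; congr 1; omega
  omega

end sizes

-- `L` is of order `q * 2 ^ t / t`, so there are few enough chunks for constantly many words each.
-- The number of leaves is a power of two of order `n / L`. The group size `K` is about `2 ^ t`, up
-- to a constant, which keeps cell numbers at O(t) bits and still exceeds the number of cells that a
-- chunk can use.
set_option maxHeartbeats 1000000 in
theorem exists_par {n w t c m k b q l : ℕ} (hl : 2 ^ l ≤ n) (hl' : n < 2 ^ (l + 1))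
    (hq : 10 * q ≤ l) (hq' : l < 10 * q + 10) (ht : 1 ≤ t) (htq : 64 * 2 ^ t ≤ q)
    (hc : 1024 * (c + 1) ≤ q) (hn : n ≤ 2 ^ w) (hm : m * 2 ^ t ≤ c * n) (hb : 2 ≤ b)
    (hk : l < b ^ k) :
    ∃ p : Par, p.n = n ∧ p.w = w ∧ p.m = m ∧ p.b = b ∧ p.k = k ∧
      p.S * q * 2 ^ t ≤ 600 * (c + 1) * (n * t) := by
  obtain ⟨e, he, he'⟩ := exists_capacity ht htq
  set r := blocks t with hr
  set L := r * (q - 2) with hLdef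
  set h := Nat.clog 2 (n / L + 3) with hh
  set K := 2 ^ (t + 10) with hK
  set Q := 2 ^ q with hQ
  set S := 16 * 2 ^ (h + 1) + Q ^ 5 + (3 * 2 ^ h + 4 * m / 2 ^ e) with hS
  have h2t : 2 ≤ 2 ^ t := Nat.pow_le_pow_right (n := 2) two_pos ht
  have htT := Nat.lt_two_pow_self (n := t)
  have hqQ : q < Q := Nat.lt_two_pow_self
  have hr1 : 1 ≤ r := Nat.le_add_left _ _
  have hr2 : r ≤ 2 * 2 ^ t := blocks_le t
  have hrt := pow_le_blocks_mul ht
  have hrt' := blocks_mul_le (t := t)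
  have hL1 : q - 2 ≤ L := Nat.le_mul_of_pos_left _ hr1
  have hL2 : 2 ^ t * q ≤ 2 * L * t := by
    have : q ≤ 2 * (q - 2) := by omega
    nlinarith
  have hL3 : L ≤ q * q := by
    refine Nat.mul_le_mul ?_ (Nat.sub_le _ _)
    omega
  have hQn : Q ^ 10 ≤ n := by
    rw [hQ, ← pow_mul, mul_comm]
    exact (Nat.pow_le_pow_right two_pos hq).trans hl
  have hKpos : 1 ≤ K := Nat.one_le_two_pow
  have hQpos : 1 ≤ Q := Nat.one_le_two_pow
  have hLn : K * L ≤ n := by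
    have hKQ : K ≤ 2 ^ 4 * q := by
      rw [hK, pow_add]; omega
    calc K * L ≤ Q * q * (q * q) := Nat.mul_le_mul (hKQ.trans (by gcongr; omega)) hL3
      _ ≤ Q * Q * (Q * Q) := by gcongr
      _ = Q ^ 4 := by ring
      _ ≤ Q ^ 10 := Nat.pow_le_pow_right hQpos (by norm_num)
      _ ≤ n := hQn
  have hh1 : n / L + 3 ≤ 2 ^ h := Nat.le_pow_clog one_lt_two _
  have hh2 : 2 ^ h ≤ 2 * (n / L + 3) := by
    have h1 : 1 ≤ h := Nat.clog_pos one_lt_two (Nat.lt_add_left _ (by norm_num))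
    have := Nat.pow_pred_clog_lt_self one_lt_two (x := n / L + 3)
      (Nat.lt_add_left _ (by norm_num))
    obtain ⟨h', hh'⟩ := Nat.exists_eq_add_of_le' h1
    rw [← hh, hh', Nat.pred_succ] at this
    rw [hh', pow_succ]
    omega
  have hhl : h ≤ l := by
    refine Nat.clog_le_of_le_pow ?_
    have h1 : n / L ≤ n / 4 := Nat.div_le_div_left (by omega) (by norm_num)
    have h2 : 2 ^ 3 ≤ 2 ^ l := Nat.pow_le_pow_right two_pos (by omega)
    rw [pow_succ] at hl'
    omega
  have hhL : 2 ^ h * L ≤ 2 * n + 6 * L := by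
    have := Nat.div_mul_le_self n L
    nlinarith
  -- The records are proportional in number to `n / L`; the table is negligible since `Q ^ 10 ≤ n`;
  -- and there are few cells since `2 ^ e` exceeds `q / (64 * t)` and `m ≤ c * n / 2 ^ t`.
  have hSle : S * q * 2 ^ t ≤ 600 * (c + 1) * (n * t) := by
    have h1 : 2 ^ h * (q * 2 ^ t) ≤ 16 * (n * t) := by
      have hLn' : L ≤ n := (Nat.le_mul_of_pos_left _ hKpos).trans hLn
      calc 2 ^ h * (q * 2 ^ t) ≤ 2 ^ h * (2 * L * t) :=
          Nat.mul_le_mul_left _ (by rw [mul_comm]; exact hL2)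
        _ = (2 ^ h * L) * (2 * t) := by ring
        _ ≤ (2 * n + 6 * n) * (2 * t) := Nat.mul_le_mul_right _ (by omega)
        _ = _ := by ring
    have h2 : Q ^ 5 * (q * 2 ^ t) ≤ n * t := by
      calc Q ^ 5 * (q * 2 ^ t) ≤ Q ^ 5 * (Q * Q) := by gcongr; omega
        _ = Q ^ 7 := by ring
        _ ≤ Q ^ 10 := Nat.pow_le_pow_right hQpos (by norm_num)
        _ ≤ n := hQn
        _ ≤ n * t := Nat.le_mul_of_pos_right _ ht
    have h3 : 4 * m / 2 ^ e * (q * 2 ^ t) ≤ 256 * c * (n * t) := by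
      calc 4 * m / 2 ^ e * (q * 2 ^ t) ≤ 4 * m / 2 ^ e * (64 * t * 2 ^ e * 2 ^ t) := by gcongr
        _ = 4 * m / 2 ^ e * 2 ^ e * (64 * t * 2 ^ t) := by ring
        _ ≤ 4 * m * (64 * t * 2 ^ t) :=
          Nat.mul_le_mul_right _ (Nat.div_mul_le_self _ _)
        _ = 256 * t * (m * 2 ^ t) := by ring
        _ ≤ 256 * t * (c * n) := by gcongr
        _ = _ := by ring
    have h4 : S * q * 2 ^ t = 35 * (2 ^ h * (q * 2 ^ t)) + Q ^ 5 * (q * 2 ^ t) +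
        4 * m / 2 ^ e * (q * 2 ^ t) := by rw [hS, pow_succ]; ring
    rw [h4]
    linarith [Nat.zero_le (c * (n * t)), Nat.zero_le (n * t)]
  -- Then every address fits in a word; `c` is negligible against `q`.
  have hSn : S < n := by
    by_contra! hle
    have h1 : 600 * (c + 1) * t < q * 2 ^ t := Nat.mul_lt_mul_of_le_of_lt (by omega) htT (by omega)
    have h2 := Nat.mul_lt_mul_of_pos_left h1 (hQpos.trans ((Nat.le_self_pow (by norm_num) Q).trans hQn))
    refine absurd ?_ h2.not_ge
    calc n * (q * 2 ^ t) ≤ S * (q * 2 ^ t) := Nat.mul_le_mul_right _ hle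
      _ = S * q * 2 ^ t := (mul_assoc ..).symm
      _ ≤ _ := hSle
      _ = n * (600 * (c + 1) * t) := by ring
  obtain ⟨encH, decH, hH⟩ := exists_encH (r := r) (K := K * K) (Z := 2 ^ e) (Q := Q)
    (header_code_bound ht htq he)
  obtain ⟨encC, decC, hC⟩ := exists_encC (r := r) (β := q - 2) (Z := 2 ^ e) (Q := Q)
    (cell_code_bound ht htq he)
  obtain ⟨encP, decP, hP⟩ := exists_encP (β := q - 2) (Q := Q)
    (Nat.pow_lt_pow_right one_lt_two (by omega))
  clear_value S Q K h L r
  exact ⟨{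
    n := n, w := w, S := S, h := h, r := r, β := q - 2, Z := 2 ^ e, e := e, K := K, Q := Q
    b := b, k := k, m := m, encH := encH, decH := decH, encC := encC, decC := decC
    encP := encP, decP := decP
    hZ := rfl
    r_pos := hr1
    β_pos := by omega
    K_pos := by positivity
    K_dvd := by
      rw [hK]
      refine pow_dvd_pow 2 ((Nat.pow_le_pow_iff_right one_lt_two).1 (le_trans ?_ hh1))
      rw [← hK]
      exact ((Nat.le_div_iff_mul_le (by omega)).2 hLn).trans (Nat.le_add_right _ _)
    fits := by
      have := Nat.lt_div_mul_add (a := n) (b := L) (by omega)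
      have := Nat.mul_le_mul_right L hh1
      rw [← hLdef]
      linarith
    S_lt := hSn.trans_le hn
    lt_Q := by omega
    r_lt := by omega
    β_lt := by omega
    h_lt := by
      have h1 := Nat.lt_two_pow_self (n := q - 4)
      have h2 : Q = 2 ^ (q - 4) * 2 ^ 4 := by rw [hQ, ← pow_add]; congr 1; omega
      omega
    KK_lt := by
      rw [hK, hQ, ← pow_add]
      exact Nat.pow_lt_pow_right one_lt_two (by omega)
    space := hS.ge
    n_le := hn
    K_ge := by
      have h1 : 4 * (r * (q - 2)) / 2 ^ e ≤ 512 * 2 ^ t := by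
        refine Nat.div_le_of_le_mul ?_
        calc 4 * (r * (q - 2)) ≤ 4 * (r * (64 * t * 2 ^ e)) := by gcongr; omega
          _ = 2 ^ e * (256 * (r * t)) := by ring
          _ ≤ 2 ^ e * (512 * 2 ^ t) := by rw [hr]; exact Nat.mul_le_mul_left _ (by omega)
      have h2 : K = 2 ^ t * 1024 := hK.trans (pow_add 2 t 10)
      omega
    b_ge := hb
    h_lt_pow := hhl.trans_lt hk
    encH_spec := hH
    encC_spec := hC
    encP_spec := hP }, rfl, rfl, rfl, rfl, rfl, hSle⟩

end ZeroReport

end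

/-! ### Asymptotic estimates and the theorem -/

namespace ZeroReport
open Filter in
-- As `log n ≤ 20 * q`, these bounds give `64 * 2 ^ t ≤ q` and `1024 * (c + 1) ≤ q`; hence the
-- factors `1280 = 20 * 64` and `20480 = 20 * 1024`.
theorem eventually_large (c₁ : ℝ) (c : ℕ) : ∃ n₀ : ℕ, ∀ n : ℕ, n₀ ≤ n →
    1280 * |c₁| + 1 ≤ Real.logb 2 (Real.logb 2 n) ∧ 20480 * (c + 1) + 44 ≤ Real.logb 2 n := by
  have h1 : Tendsto (fun n : ℕ => Real.logb 2 n) atTop atTop :=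
    (Real.tendsto_logb_atTop one_lt_two).comp tendsto_natCast_atTop_atTop
  have h2 := (Real.tendsto_logb_atTop one_lt_two).comp h1
  exact eventually_atTop.1 ((h2.eventually_ge_atTop _).and (h1.eventually_ge_atTop _))

/-- The number of words of the data structure is within the bound. -/
theorem space_bound {S w q t c n : ℕ} {c₂ x τ : ℝ} (hS : S * q * 2 ^ t ≤ 600 * (c + 1) * (n * t))
    (hx : x ≤ 20 * q) (hx0 : 0 ≤ x) (hw : (w : ℝ) ≤ c₂ * x) (h1 : (2 : ℝ) ^ t ≤ τ) (h2 : τ ≤ 2 * 2 ^ t) :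
    ((S * w : ℕ) : ℝ) ≤ 24000 * |c₂| * (c + 1) * (n * Real.logb 2 τ / τ) := by
  have hτ : 0 < τ := lt_of_lt_of_le (by positivity) h1
  have ht : (t : ℝ) ≤ Real.logb 2 τ := by
    rw [Real.le_logb_iff_rpow_le one_lt_two hτ, Real.rpow_natCast]
    exact h1
  have hw' : (w : ℝ) ≤ |c₂| * (20 * q) :=
    hw.trans (mul_le_mul (le_abs_self _) hx hx0 (abs_nonneg _))
  have hS' : (S * q : ℝ) * 2 ^ t ≤ 600 * (c + 1) * (n * t) := by exact_mod_cast hS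
  have h3 : (S * q : ℝ) * τ ≤ 1200 * (c + 1) * (n * Real.logb 2 τ) := by
    calc (S * q : ℝ) * τ ≤ S * q * (2 * 2 ^ t) := by gcongr
      _ = 2 * (S * q * 2 ^ t) := by ring
      _ ≤ 2 * (600 * (c + 1) * (n * t)) := by gcongr
      _ ≤ 2 * (600 * (c + 1) * (n * Real.logb 2 τ)) := by gcongr
      _ = _ := by ring
  rw [← mul_div_assoc, le_div_iff₀ hτ]
  push_cast
  calc (S * w : ℝ) * τ ≤ S * (|c₂| * (20 * q)) * τ := by gcongr
    _ = 20 * |c₂| * (S * q * τ) := by ring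
    _ ≤ 20 * |c₂| * (1200 * (c + 1) * (n * Real.logb 2 τ)) := by gcongr
    _ = _ := by ring

end ZeroReport

open ZeroReport in
theorem mainTheorem7 (ε c₀ c₁ c₂ : ℝ) (hε : 0 < ε) :
    ∃ (zeroP reportP : WordRAM.Cmd) (C : ℝ) (n₀ : ℕ), 0 < C ∧
      ∀ n : ℕ, n₀ ≤ n →
      ∀ τ : ℝ, 2 ≤ τ → τ ≤ c₁ * (Real.logb 2 n / Real.logb 2 (Real.logb 2 n)) →
      ∀ w : ℕ, n ≤ 2 ^ w → (w : ℝ) ≤ c₂ * Real.logb 2 n →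
        ∃ S : ℕ, ((S * w : ℕ) : ℝ) ≤ C * (n * Real.logb 2 τ / τ) ∧
          BitVector.IsZeroReportStructure zeroP reportP n w S
            (c₀ * (n / τ)) (C * Real.logb 2 n ^ ε) C := by
  obtain ⟨n₀, hn₀⟩ := eventually_large c₁ ⌈c₀⌉₊
  set c := ⌈c₀⌉₊
  -- With `b > (log n) ^ ε`, this number of digits makes `b ^ k` exceed every height of the trie.
  set k := ⌈1 / ε⌉₊
  have hk1 : 1 ≤ ε * k := by
    have := Nat.le_ceil (1 / ε)
    rwa [div_le_iff₀' hε] at this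
  -- The first term is for the space. The other two cover the time: at most `200 * b * k` plus a
  -- constant for a deletion, with `b ≤ 2 * (log n) ^ ε`, and `200 * k` plus a constant for a
  -- search.
  refine ⟨ZeroReport.zeroP, ZeroReport.reportP, 24000 * |c₂| * (c + 1) + 400 * k + 2500, n₀,
    by positivity, fun n hn τ hτ hτ' w hnw hw => ?_⟩
  obtain ⟨hll, hx⟩ := hn₀ n hn
  set x := Real.logb 2 n with hxdef
  have hc0 : (0 : ℝ) ≤ c := Nat.cast_nonneg _
  have hx0 : 0 < x := by linarith
  have hn0 : n ≠ 0 := by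
    rintro rfl
    simp [hxdef] at hx0
  set l := Nat.log 2 n with hldef
  have hl : 2 ^ l ≤ n := Nat.pow_log_le_self 2 hn0
  have hl' : n < 2 ^ (l + 1) := Nat.lt_pow_succ_log_self one_lt_two n
  have hlx : (l : ℝ) ≤ x := by
    rw [hxdef, Real.le_logb_iff_rpow_le one_lt_two (by positivity), Real.rpow_natCast]
    exact_mod_cast hl
  have hxl : x < l + 1 := by
    rw [hxdef, Real.logb_lt_iff_lt_rpow one_lt_two (by positivity)]
    exact_mod_cast hl'
  -- This makes `Q ^ 10 ≤ n`, so that the table is small.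
  set q := l / 10 with hqdef
  have hq' : l < 10 * q + 10 := by omega
  have hq'' : (l : ℝ) + 1 ≤ 10 * q + 10 := by exact_mod_cast hq'
  have hxq : x ≤ 20 * q := by linarith
  set t := Nat.log 2 ⌊τ⌋₊ with htdef
  have hfl : 2 ≤ ⌊τ⌋₊ := Nat.le_floor (by exact_mod_cast hτ)
  have ht : 1 ≤ t := Nat.log_pos one_lt_two hfl
  have h1 : (2 : ℝ) ^ t ≤ τ := by
    refine le_trans ?_ (Nat.floor_le (by linarith))
    exact_mod_cast Nat.pow_log_le_self 2 (x := ⌊τ⌋₊) (by omega)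
  have h2 : τ ≤ 2 * 2 ^ t := by
    refine (Nat.lt_of_floor_lt (n := 2 * 2 ^ t) ?_).le.trans (by push_cast; rfl)
    rw [mul_comm, ← pow_succ]
    exact Nat.lt_pow_succ_log_self one_lt_two _
  -- The iterated logarithm in the bound for `τ` absorbs the constant `c₁` and the factor `1280`.
  have htq : 64 * 2 ^ t ≤ q := by
    have h : 1280 * τ ≤ x := by
      set y := Real.logb 2 x
      have hy : 0 < y := by have := abs_nonneg c₁; linarith
      calc 1280 * τ ≤ 1280 * (|c₁| * (x / y)) := by
            gcongr
            exact hτ'.trans (mul_le_mul_of_nonneg_right (le_abs_self _) (by positivity))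
        _ = 1280 * |c₁| * x / y := by ring
        _ ≤ y * x / y := by gcongr; linarith
        _ = x := by field_simp
    have : (64 * 2 ^ t : ℝ) ≤ q := by linarith
    exact_mod_cast this
  have hcq : 1024 * (c + 1) ≤ q := by
    have : (1024 * (c + 1) : ℝ) ≤ q := by linarith
    exact_mod_cast this
  set m := ⌊c₀ * (n / τ)⌋₊ with hm
  have hmt : m * 2 ^ t ≤ c * n := by
    have : (m * 2 ^ t : ℝ) ≤ c * n := by
      have hτ0 : 0 < τ := by linarith
      have : (m : ℝ) ≤ c * (n / τ) := by
        rw [hm]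
        refine (Nat.cast_le.2 (Nat.floor_le_floor
          (mul_le_mul_of_nonneg_right (Nat.le_ceil c₀) (by positivity)))).trans ?_
        exact Nat.floor_le (by positivity)
      calc (m * 2 ^ t : ℝ) ≤ c * (n / τ) * τ := by gcongr
        _ = c * n := by field_simp
    exact_mod_cast this
  set z := x ^ ε with hz
  have hz1 : 1 ≤ z := Real.one_le_rpow (by linarith) hε.le
  set b := ⌊z⌋₊ + 1 with hbdef
  have hb : 2 ≤ b := Nat.succ_le_succ (Nat.le_floor (by exact_mod_cast hz1))
  have hbz : (b : ℝ) ≤ 2 * z := by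
    have := Nat.floor_le (zero_le_one.trans hz1)
    rw [hbdef]; push_cast; linarith
  have hk : l < b ^ k := by
    have hzb : z < b := by rw [hbdef]; push_cast; exact Nat.lt_floor_add_one z
    have hk0 : k ≠ 0 := by rintro h; rw [h] at hk1; norm_num at hk1
    have : (l : ℝ) < b ^ k := by
      calc (l : ℝ) ≤ x := hlx
        _ = x ^ (1 : ℝ) := (Real.rpow_one x).symm
        _ ≤ x ^ (ε * k) := Real.rpow_le_rpow_of_exponent_le (by linarith) hk1
        _ = z ^ k := by rw [Real.rpow_mul hx0.le, Real.rpow_natCast]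
        _ < b ^ k := pow_lt_pow_left₀ hzb (zero_le_one.trans hz1) hk0
    exact_mod_cast this
  obtain ⟨p, hpn, hpw, hpm, hpb, hpk, hS⟩ := exists_par hl hl' (by omega) hq' ht htq hcq hnw hmt hb hk
  have hA : 0 ≤ n * Real.logb 2 τ / τ :=
    div_nonneg (mul_nonneg n.cast_nonneg (Real.logb_nonneg one_lt_two (by linarith))) (by linarith)
  have hs := space_bound hS hxq hx0.le hw h1 h2
  have hkn : (0 : ℝ) ≤ k := k.cast_nonneg
  have hCn : 0 ≤ 24000 * |c₂| * (c + 1) := by positivity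
  refine ⟨p.S, hs.trans (mul_le_mul_of_nonneg_right (by linarith) hA), ?_⟩
  have hz' : (zeroT p : ℝ) ≤ (24000 * |c₂| * (c + 1) + 400 * k + 2500) * z := by
    have h : (b * k : ℝ) ≤ 2 * z * k := by gcongr
    have h' := mul_nonneg hCn (zero_le_one.trans hz1)
    simp only [zeroT, deleteT, hpb, hpk]
    push_cast
    linarith
  have hr' : (reportT p.k : ℝ) ≤ 24000 * |c₂| * (c + 1) + 400 * k + 2500 := by
    simp only [reportT, searchT, hpk]
    push_cast
    linarith
  clear_value k b
  subst hpn hpw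
  exact isZeroReportStructure p (fun B hB => hpm ▸ Nat.le_floor hB) hz' hr'
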